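/- **Partitions.** For $k,l\in\mathbb N_0$ let $P(k,l)$ be the set of partitions of $k$ upper and $l$ lower points. A *full category of partitions* is a collection of subsets $P_X(k,l)\subseteq P(k,l)$ ($k,l\in\mathbb N_0$) that is stable under tensor product (horizontal concatenation), composition (vertical concatenation, the middle points being removed), involution (turning upside down) and rotation (moving the leftmost, resp. rightmost, point of one row to the left, resp. right, end of the other row), and that contains the unit partition in $P(1,1)$ and the pair partition in $P(0,2)$ (each consisting of one block). $\langle p_1,\dots,p_m\rangle$ denotes the smallest full category of partitions containing $p_1,\dots,p_m$. Let $\mathrm{cross}=\{1,2'\}\{2,1'\}\in P(2,2)$, $\mathrm{halflib}=\{1,3'\}\{2,2'\}\{3,1'\}\in P(3,3)$, let $\mathrm{four}\in P(0,4)$ be the four block $\{1,2,3,4\}$, let $\uparrow\otimes\uparrow\,\in P(0,2)$ consist of two singletons, and let $h_s\in P(0,2s)$ have the two blocks $\{1,3,\dots,2s-1\}$ and $\{2,4,\dots,2s\}$. **Quantum groups.** Let $n\ge 1$. An *orthogonal quantum group* $G$ is given by (its $*$-algebra of polynomial functions) a unital complex $*$-algebra $A_G$ generated by self-adjoint elements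 $u_{ij}$, $1\le i,j\le n$, with $\sum_k u_{ik}u_{jk}=\sum_k u_{ki}u_{kj}=\delta_{ij}$, such that there are $*$-homomorphisms $\Delta:A_G\to A_G\otimes A_G$, $\varepsilon:A_G\to\mathbb C$, $S:A_G\to A_G^{op}$ with $\Delta(u_{ij})=\sum_k u_{ik}\otimes u_{kj}$, $\varepsilon(u_{ij})=\delta_{ij}$, $S(u_{ij})=u_{ji}$. $G\subset H$ means that there is a surjective $*$-homomorphism $A_H\to A_G$, $u_{ij}\mapsto u_{ij}$, and $G=H$ that there is such an isomorphism. Put $C_G(k,l)=\{T:(\mathbb C^n)^{\otimes k}\to(\mathbb C^n)^{\otimes l}\text{ linear}\mid Tu^{\otimes k}=u^{\otimes l}T\}$, and for $p\in P(k,l)$ let $T_p(e_{i_1}\otimes\dots\otimes e_{i_k})=\sum_{j}\delta_p(i,j)\,e_{j_1}\otimes\dots\otimes e_{j_l}$, where $\delta_p(i,j)=1$ if the indices agree on every block of $p$ and $0$ otherwise. $G$ *corresponds to* a collection $P_X$ of subsets $P_X(k,l)\subseteq P(k,l)$ if $G$ is an orthogonal quantum group with $S_n\subset G\subset O_n^+$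 and $C_G(k,l)=\mathrm{span}\{T_p\mid p\in P_X(k,l)\}$ for all $k,l$; $G$ is *easy* if it corresponds to some $P_X$ that contains all noncrossing pair partitions. Here $S_n$ is given by the algebra of functions on the symmetric group with $u_{ij}(g)=1$ if $g(i)=j$ and $0$ otherwise. The following are given by the universal unital $*$-algebra generated by self-adjoint $u_{ij}$ subject to the stated relations: - $O_n^+$: orthogonality (the relations $\sum_k u_{ik}u_{jk}=\sum_k u_{ki}u_{kj}=\delta_{ij}$); - $O_n^*$: orthogonality and $abc=cba$ for all $a,b,c\in\{u_{ij}\}$; - $B_n^{\#*}$: the relations of $O_n^*$ and $\sum_k u_{ik}=\sum_k u_{kj}$ for all $i,j$; - $H_n^*$: the relations of $O_n^*$ and $u_{ik}u_{jk}=u_{ki}u_{kj}=0$ for $i\ne j$; - $H_n^{(s)}$: the relations of $H_n^*$ and those expressing $T_{h_s}u^{\otimes 0}=u^{\otimes 2s}T_{h_s}$; - $H_n$: orthogonality, $u_{ik}u_{jk}=u_{ki}u_{kj}=0$ for $i\neq j$, and commutativity of all $u_{ij}$. **Theorem.** Let $P_X$ be a full category of partitions containing $\mathrm{halflib}$ but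 not $\mathrm{cross}$. Then one of the following holds: 1. $P_X=\langle \mathrm{halflib}\rangle$, and $O_n^*$ corresponds to $P_X$ for every $n\ge1$; 2. $P_X=\langle \mathrm{halflib},\uparrow\otimes\uparrow\rangle$, and $B_n^{\#*}$ corresponds to $P_X$ for every $n\ge1$; 3. $P_X=\langle \mathrm{halflib},\mathrm{four}\rangle$, and $H_n^*$ corresponds to $P_X$ for every $n\ge1$; 4. $P_X=\langle \mathrm{halflib},\mathrm{four},h_s\rangle$ for some $s\ge3$, and $H_n^{(s)}$ corresponds to $P_X$ for every $n\ge1$. **Corollary.** Let $n\ge1$. If $G$ is an easy quantum group with $H_n\subsetneq G\subsetneq H_n^*$, then $G=H_n^{(s)}$ for some $s\ge3$. -/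

import Mathlib

universe u v

/-! ## Partitions and full categories of partitions -/

/-- `P(k,l)`: partitions of `k` upper points and `l` lower points, given by the relation
"lies in the same block"; `Sum.inl i` is the `i`-th upper point from the left, `Sum.inr j` is the
`j`-th lower point from the left. -/
abbrev TwoRowPartition (k l : ℕ) : Type := Setoid (Fin k ⊕ Fin l)

namespace TwoRowPartition

/-- The points of the juxtaposition of two two-row diagrams, sorted by the diagram they come
from (the first diagram stands to the left of the second). -/
def splitPoints (k l k' l' : ℕ) :
    Fin (k + k') ⊕ Fin (l + l') ≃ (Fin k ⊕ Fin l) ⊕ (Fin k' ⊕ Fin l') :=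
  (Equiv.sumCongr finSumFinEquiv.symm finSumFinEquiv.symm).trans
    (Equiv.sumSumSumComm (Fin k) (Fin k') (Fin l) (Fin l'))

/-- Tensor product `p ⊗ q`: horizontal concatenation. -/
def tensor {k l k' l' : ℕ} (p : TwoRowPartition k l) (q : TwoRowPartition k' l') :
    TwoRowPartition (k + k') (l + l') where
  r x y := Sum.LiftRel (fun a b => p a b) (fun a b => q a b)
    (splitPoints k l k' l' x) (splitPoints k l k' l' y)
  iseqv :=
    { refl := by
        intro x
        rcases splitPoints k l k' l' x with a | a
        · exact Sum.LiftRel.inl (p.refl a)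
        · exact Sum.LiftRel.inr (q.refl a)
      symm := by
        intro x y
        generalize splitPoints k l k' l' x = a
        generalize splitPoints k l k' l' y = b
        intro h
        cases h with
        | inl h => exact Sum.LiftRel.inl (p.symm h)
        | inr h => exact Sum.LiftRel.inr (q.symm h)
      trans := by
        intro x y z
        generalize splitPoints k l k' l' x = a
        generalize splitPoints k l k' l' y = b
        generalize splitPoints k l k' l' z = c
        intro h h'
        cases h with
        | inl h => cases h' with
          | inl h' => exact Sum.LiftRel.inl (p.trans h h')
        | inr h => cases h' with
          | inr h' => exact Sum.LiftRel.inr (q.trans h h') }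

/-- One step of a connection in the vertical concatenation of `p` (on top) and `q` (below) on the
`k` upper, `l` middle and `m` lower points: two points are joined by a block of `p` or by a block
of `q`. -/
inductive StackStep {k l m : ℕ} (p : TwoRowPartition k l) (q : TwoRowPartition l m) :
    Fin k ⊕ (Fin l ⊕ Fin m) → Fin k ⊕ (Fin l ⊕ Fin m) → Prop
  | top (a b : Fin k ⊕ Fin l) (h : p a b) :
      StackStep p q (Sum.map id Sum.inl a) (Sum.map id Sum.inl b)
  | bottom (a b : Fin l ⊕ Fin m) (h : q a b) : StackStep p q (Sum.inr a) (Sum.inr b)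

/-- Composition `pq`: vertical concatenation with `p` on top of `q`, after which the middle points
are removed. -/
def compose {k l m : ℕ} (p : TwoRowPartition k l) (q : TwoRowPartition l m) :
    TwoRowPartition k m :=
  Setoid.comap (Sum.map id Sum.inr) (Relation.EqvGen.setoid (StackStep p q))

/-- Involution `p*`: the diagram is turned upside down. -/
def involution {k l : ℕ} (p : TwoRowPartition k l) : TwoRowPartition l k :=
  Setoid.comap Sum.swap p

/-- The leftmost upper point is moved to the left of the lower points. -/
def rotateLeftDown {k l : ℕ} (p : TwoRowPartition (k + 1) l) : TwoRowPartition k (l + 1) :=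
  Setoid.comap (Sum.elim (fun i => Sum.inl i.succ) (Fin.cases (Sum.inl 0) Sum.inr)) p

/-- The leftmost lower point is moved to the left of the upper points. -/
def rotateLeftUp {k l : ℕ} (p : TwoRowPartition k (l + 1)) : TwoRowPartition (k + 1) l :=
  Setoid.comap (Sum.elim (Fin.cases (Sum.inr 0) Sum.inl) (fun j => Sum.inr j.succ)) p

/-- The rightmost upper point is moved to the right of the lower points. -/
def rotateRightDown {k l : ℕ} (p : TwoRowPartition (k + 1) l) : TwoRowPartition k (l + 1) :=
  Setoid.comap (Sum.elim (fun i => Sum.inl i.castSucc)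
    (Fin.lastCases (Sum.inl (Fin.last k)) Sum.inr)) p

/-- The rightmost lower point is moved to the right of the upper points. -/
def rotateRightUp {k l : ℕ} (p : TwoRowPartition k (l + 1)) : TwoRowPartition (k + 1) l :=
  Setoid.comap (Sum.elim (Fin.lastCases (Sum.inr (Fin.last l)) Sum.inl)
    (fun j => Sum.inr j.castSucc)) p

/-- The unit partition: one upper point connected with one lower point. -/
def unit : TwoRowPartition 1 1 := ⊤

/-- The pair partition: two connected lower points. -/
def pair : TwoRowPartition 0 2 := ⊤

/-- The crossing partition `{1,2'},{2,1'}`. -/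
def crossing : TwoRowPartition 2 2 := Setoid.ker (Sum.elim id Fin.rev)

/-- The half-liberating partition `{1,3'},{2,2'},{3,1'}`. -/
def halfLiberating : TwoRowPartition 3 3 := Setoid.ker (Sum.elim id Fin.rev)

/-- The four block partition: four connected lower points. -/
def fourBlock : TwoRowPartition 0 4 := ⊤

/-- The tensor product of two singletons: two lower points that are not connected. -/
def doubleSingleton : TwoRowPartition 0 2 := ⊥

/-- The partition `h_s` of `2s` lower points into the points at odd positions and the points at
even positions. -/
def hPartition (s : ℕ) : TwoRowPartition 0 (2 * s) :=
  Setoid.ker (Sum.elim Fin.elim0 (fun j : Fin (2 * s) => (j : ℕ) % 2))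

/-- The position of a point when the upper row is read from left to right and then the lower row
from right to left. -/
def position {k l : ℕ} : Fin k ⊕ Fin l → ℕ :=
  Sum.elim (fun i => (i : ℕ)) (fun j => k + (Fin.rev j : ℕ))

/-- `p` is noncrossing: the lines of `p` can be drawn between the two rows without crossings. -/
def IsNoncrossing {k l : ℕ} (p : TwoRowPartition k l) : Prop :=
  ∀ a b c d : Fin k ⊕ Fin l, position a < position b → position b < position c →
    position c < position d → p a c → p b d → p a b

/-- `p` is a pair partition: every block has exactly two points. -/
def IsPairPartition {k l : ℕ} (p : TwoRowPartition k l) : Prop :=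
  ∀ x : Fin k ⊕ Fin l, ∃! y : Fin k ⊕ Fin l, y ≠ x ∧ p x y

end TwoRowPartition

/-- A collection of subsets `P_X(k,l) ⊆ P(k,l)`. -/
abbrev PartitionFamily : Type := ∀ k l : ℕ, Set (TwoRowPartition k l)

/-- The family `NC₂` of all noncrossing pair partitions. -/
def noncrossingPairs : PartitionFamily :=
  fun _ _ => {p | p.IsNoncrossing ∧ p.IsPairPartition}

open TwoRowPartition in
/-- Full categories of partitions. -/
structure IsFullCategory (C : PartitionFamily) : Prop where
  tensor_mem : ∀ {k l k' l' : ℕ} (p : TwoRowPartition k l) (q : TwoRowPartition k' l'),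
    p ∈ C k l → q ∈ C k' l' → tensor p q ∈ C (k + k') (l + l')
  compose_mem : ∀ {k l m : ℕ} (p : TwoRowPartition k l) (q : TwoRowPartition l m),
    p ∈ C k l → q ∈ C l m → compose p q ∈ C k m
  involution_mem : ∀ {k l : ℕ} (p : TwoRowPartition k l), p ∈ C k l → involution p ∈ C l k
  rotateLeftDown_mem : ∀ {k l : ℕ} (p : TwoRowPartition (k + 1) l),
    p ∈ C (k + 1) l → rotateLeftDown p ∈ C k (l + 1)
  rotateLeftUp_mem : ∀ {k l : ℕ} (p : TwoRowPartition k (l + 1)),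
    p ∈ C k (l + 1) → rotateLeftUp p ∈ C (k + 1) l
  rotateRightDown_mem : ∀ {k l : ℕ} (p : TwoRowPartition (k + 1) l),
    p ∈ C (k + 1) l → rotateRightDown p ∈ C k (l + 1)
  rotateRightUp_mem : ∀ {k l : ℕ} (p : TwoRowPartition k (l + 1)),
    p ∈ C k (l + 1) → rotateRightUp p ∈ C (k + 1) l
  unit_mem : TwoRowPartition.unit ∈ C 1 1
  pair_mem : TwoRowPartition.pair ∈ C 0 2

/-- `⟨p₁, …, p_m⟩`: the smallest full category of partitions that contains the given
partitions. -/
def generatedCategory (S : Set (Σ k : ℕ, Σ l : ℕ, TwoRowPartition k l)) : PartitionFamily :=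
  fun k l => {p | ∀ C : PartitionFamily, IsFullCategory C →
    (∀ g ∈ S, g.2.2 ∈ C g.1 g.2.1) → p ∈ C k l}

/-! ## `*`-algebras with a matrix of elements, intertwiners -/

/-- A unital complex `*`-algebra `A` together with an `n × n` matrix `u = (u_ij)` over `A`. -/
structure MatrixStarAlgebra (n : ℕ) where
  /-- the algebra `A` -/
  carrier : Type u
  [ring : Ring carrier]
  [starRing : StarRing carrier]
  [algebra : Algebra ℂ carrier]
  [starModule : StarModule ℂ carrier]
  /-- the matrix `u` -/
  u : Matrix (Fin n) (Fin n) carrier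

attribute [instance] MatrixStarAlgebra.ring MatrixStarAlgebra.starRing
  MatrixStarAlgebra.algebra MatrixStarAlgebra.starModule

open Classical in
/-- The matrix, in the canonical bases of tensor powers of `ℂⁿ`, of the linear map
`T_p : (ℂⁿ)^{⊗k} → (ℂⁿ)^{⊗l}`,
`T_p (e_{i₁} ⊗ ⋯ ⊗ e_{i_k}) = ∑_j δ_p(i,j) e_{j₁} ⊗ ⋯ ⊗ e_{j_l}`. -/
noncomputable def partitionMap (n : ℕ) {k l : ℕ} (p : TwoRowPartition k l) :
    Matrix (Fin l → Fin n) (Fin k → Fin n) ℂ :=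
  Matrix.of fun j i => if ∀ x y, p x y → Sum.elim i j x = Sum.elim i j y then 1 else 0

/-- The matrix `u^{⊗k} = (u_{i₁j₁} ⋯ u_{i_kj_k})`. -/
def matrixTensorPower {A : Type u} [Monoid A] {n : ℕ} (u : Matrix (Fin n) (Fin n) A) (k : ℕ) :
    Matrix (Fin k → Fin n) (Fin k → Fin n) A :=
  Matrix.of fun i j => (List.ofFn fun t => u (i t) (j t)).prod

namespace MatrixStarAlgebra

/-- The intertwiner space `C(k,l)` of all linear maps `T : (ℂⁿ)^{⊗k} → (ℂⁿ)^{⊗l}` (written as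
matrices) with `T u^{⊗k} = u^{⊗l} T`. -/
def intertwiners {n : ℕ} (G : MatrixStarAlgebra.{u} n) (k l : ℕ) :
    Set (Matrix (Fin l → Fin n) (Fin k → Fin n) ℂ) :=
  {T | T.map (algebraMap ℂ G.carrier) * matrixTensorPower G.u k =
    matrixTensorPower G.u l * T.map (algebraMap ℂ G.carrier)}

open scoped TensorProduct in
/-- `(A, u)` is (the `*`-algebra of polynomial functions of) an orthogonal quantum group: `A` is
generated by the self-adjoint entries of the orthogonal matrix `u`, and there are
`*`-homomorphisms `Δ`, `ε`, `S` which are given on the generators by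
`u_ij ↦ ∑ₖ u_ik ⊗ u_kj`, `u_ij ↦ δ_ij` and `u_ij ↦ u_ji`. -/
structure IsOrthogonalQuantumGroup {n : ℕ} (G : MatrixStarAlgebra.{u} n) : Prop where
  selfAdjoint : ∀ i j, star (G.u i j) = G.u i j
  row_orthogonal : ∀ i j, ∑ k, G.u i k * G.u j k = if i = j then 1 else 0
  col_orthogonal : ∀ i j, ∑ k, G.u k i * G.u k j = if i = j then 1 else 0
  generates : StarAlgebra.adjoin ℂ {a | ∃ i j, a = G.u i j} = ⊤
  comultiplication : ∃ Δ : G.carrier →⋆ₐ[ℂ] G.carrier ⊗[ℂ] G.carrier,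
    ∀ i j, Δ (G.u i j) = ∑ k, G.u i k ⊗ₜ[ℂ] G.u k j
  counit : ∃ ε : G.carrier →⋆ₐ[ℂ] ℂ, ∀ i j, ε (G.u i j) = if i = j then 1 else 0
  antipode : ∃ S : G.carrier →⋆ₐ[ℂ] G.carrierᵐᵒᵖ,
    ∀ i j, S (G.u i j) = MulOpposite.op (G.u j i)

/-- `G ⊂ H`: there is a surjective `*`-homomorphism `A_H → A_G` that maps the generators `u_ij` of
`A_H` to the generators `u_ij` of `A_G`. -/
def IsQuantumSubgroup {n : ℕ} (G : MatrixStarAlgebra.{u} n) (H : MatrixStarAlgebra.{v} n) :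
    Prop :=
  ∃ φ : H.carrier →⋆ₐ[ℂ] G.carrier, Function.Surjective φ ∧ ∀ i j, φ (H.u i j) = G.u i j

/-- `G = H` as quantum groups: there is a `*`-isomorphism `A_G ≅ A_H` that maps generators to
generators. -/
def IsSameQuantumGroup {n : ℕ} (G : MatrixStarAlgebra.{u} n) (H : MatrixStarAlgebra.{v} n) :
    Prop :=
  ∃ φ : G.carrier ≃⋆ₐ[ℂ] H.carrier, ∀ i j, φ (G.u i j) = H.u i j

/-- `G ⊊ H`. -/
def IsProperQuantumSubgroup {n : ℕ} (G : MatrixStarAlgebra.{u} n)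
    (H : MatrixStarAlgebra.{v} n) : Prop :=
  IsQuantumSubgroup G H ∧ ¬ IsSameQuantumGroup G H

end MatrixStarAlgebra

/-! ## The free `*`-algebra and algebras given by generators and relations -/

/-- The free unital complex `*`-algebra on self-adjoint generators `x_ij`, `i, j = 1, …, n`. -/
def FreeStarAlgebra (n : ℕ) : Type := FreeAlgebra ℂ (Fin n × Fin n)

namespace FreeStarAlgebra

noncomputable instance (n : ℕ) : Ring (FreeStarAlgebra n) :=
  inferInstanceAs (Ring (FreeAlgebra ℂ (Fin n × Fin n)))

noncomputable instance (n : ℕ) : Algebra ℂ (FreeStarAlgebra n) :=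
  inferInstanceAs (Algebra ℂ (FreeAlgebra ℂ (Fin n × Fin n)))

/-- The matrix of generators. -/
noncomputable def x (n : ℕ) : Matrix (Fin n) (Fin n) (FreeStarAlgebra n) :=
  Matrix.of fun i j => FreeAlgebra.ι ℂ (i, j)

theorem induction {n : ℕ} {motive : FreeStarAlgebra n → Prop}
    (scalar : ∀ c : ℂ, motive (algebraMap ℂ _ c)) (gen : ∀ i j, motive (x n i j))
    (mul : ∀ a b, motive a → motive b → motive (a * b))
    (add : ∀ a b, motive a → motive b → motive (a + b)) (a : FreeStarAlgebra n) : motive a :=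
  FreeAlgebra.induction (R := ℂ) (X := Fin n × Fin n) (motive := motive) scalar
    (fun y => gen y.1 y.2) mul add a

/-- The ring of the free `*`-algebra, with the conjugate scalar action `(c, a) ↦ c̄ a`. -/
def Conjugate (n : ℕ) : Type := FreeStarAlgebra n

noncomputable instance (n : ℕ) : Ring (Conjugate n) :=
  inferInstanceAs (Ring (FreeStarAlgebra n))

noncomputable instance (n : ℕ) : Algebra ℂ (Conjugate n) :=
  Algebra.compHom (FreeStarAlgebra n) (starRingEnd ℂ)

/-- Complex conjugation of all coefficients of a noncommutative polynomial. -/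
noncomputable def conjCoeff (n : ℕ) : FreeStarAlgebra n →+* FreeStarAlgebra n :=
  (FreeAlgebra.lift (A := Conjugate n) ℂ (fun y : Fin n × Fin n => x n y.1 y.2)).toRingHom

theorem conjCoeff_algebraMap (n : ℕ) (c : ℂ) :
    conjCoeff n (algebraMap ℂ _ c) = algebraMap ℂ _ (starRingEnd ℂ c) :=
  (FreeAlgebra.lift (A := Conjugate n) ℂ (fun y : Fin n × Fin n => x n y.1 y.2)).commutes c

theorem conjCoeff_x (n : ℕ) (i j : Fin n) : conjCoeff n (x n i j) = x n i j :=
  FreeAlgebra.lift_ι_apply (A := Conjugate n) (R := ℂ)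
    (fun y : Fin n × Fin n => x n y.1 y.2) (i, j)

/-- The order of the letters in all words is reversed; coefficients are kept. -/
noncomputable def reverse (n : ℕ) : FreeStarAlgebra n →+* (FreeStarAlgebra n)ᵐᵒᵖ :=
  (FreeAlgebra.lift ℂ
    (fun y : Fin n × Fin n => MulOpposite.op (x n y.1 y.2))).toRingHom

theorem reverse_algebraMap (n : ℕ) (c : ℂ) :
    reverse n (algebraMap ℂ _ c) = MulOpposite.op (algebraMap ℂ _ c) :=
  (FreeAlgebra.lift ℂ (fun y : Fin n × Fin n => MulOpposite.op (x n y.1 y.2))).commutes c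

theorem reverse_x (n : ℕ) (i j : Fin n) : reverse n (x n i j) = MulOpposite.op (x n i j) :=
  FreeAlgebra.lift_ι_apply (R := ℂ) (fun y : Fin n × Fin n => MulOpposite.op (x n y.1 y.2)) (i, j)

/-- The involution: antilinear, antimultiplicative, `x_ij* = x_ij`. -/
noncomputable instance (n : ℕ) : StarRing (FreeStarAlgebra n) where
  star a := conjCoeff n (reverse n a).unop
  star_involutive a := by
    induction a using FreeStarAlgebra.induction with
    | scalar c => simp [reverse_algebraMap, conjCoeff_algebraMap]
    | gen i j => simp [reverse_x, conjCoeff_x]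
    | mul a b ha hb => simp only [map_mul, MulOpposite.unop_mul, ha, hb]
    | add a b ha hb => simp only [map_add, MulOpposite.unop_add, ha, hb]
  star_mul a b := by simp only [map_mul, MulOpposite.unop_mul]
  star_add a b := by simp only [map_add, MulOpposite.unop_add]

theorem star_x (n : ℕ) (i j : Fin n) : star (x n i j) = x n i j := by
  change conjCoeff n (reverse n (x n i j)).unop = x n i j
  rw [reverse_x, MulOpposite.unop_op, conjCoeff_x]

theorem star_algebraMap (n : ℕ) (c : ℂ) :
    star (algebraMap ℂ (FreeStarAlgebra n) c) = algebraMap ℂ _ (star c) := by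
  change conjCoeff n (reverse n _).unop = _
  rw [reverse_algebraMap, MulOpposite.unop_op, conjCoeff_algebraMap]
  rfl

end FreeStarAlgebra

/-- The congruence on the free `*`-algebra generated by the relations `a = b` with `r a b` and
their adjoint relations `a* = b*`. -/
noncomputable def starRingCon {n : ℕ} (r : FreeStarAlgebra n → FreeStarAlgebra n → Prop) :
    RingCon (FreeStarAlgebra n) :=
  ringConGen fun a b => r a b ∨ r (star a) (star b)

theorem starRingCon_star {n : ℕ} (r : FreeStarAlgebra n → FreeStarAlgebra n → Prop)
    {a b : FreeStarAlgebra n} (h : starRingCon r a b) : starRingCon r (star a) (star b) := by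
  induction h with
  | of a b h =>
    refine RingConGen.Rel.of _ _ ?_
    rw [star_star, star_star]
    exact h.symm
  | refl a => exact RingConGen.Rel.refl _
  | symm _ ih => exact RingConGen.Rel.symm ih
  | trans _ _ ih ih' => exact RingConGen.Rel.trans ih ih'
  | add _ _ ih ih' =>
    rw [star_add, star_add]
    exact RingConGen.Rel.add ih ih'
  | mul _ _ ih ih' =>
    rw [star_mul, star_mul]
    exact RingConGen.Rel.mul ih' ih

noncomputable instance {n : ℕ} (r : FreeStarAlgebra n → FreeStarAlgebra n → Prop) :
    StarRing (starRingCon r).Quotient where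
  star := Quotient.map' star fun _ _ h => starRingCon_star r h
  star_involutive := by
    rintro ⟨a⟩
    exact congrArg (fun b : FreeStarAlgebra n => (b : (starRingCon r).Quotient)) (star_star a)
  star_mul := by
    rintro ⟨a⟩ ⟨b⟩
    exact congrArg (fun b : FreeStarAlgebra n => (b : (starRingCon r).Quotient)) (star_mul a b)
  star_add := by
    rintro ⟨a⟩ ⟨b⟩
    exact congrArg (fun b : FreeStarAlgebra n => (b : (starRingCon r).Quotient)) (star_add a b)

instance {n : ℕ} (r : FreeStarAlgebra n → FreeStarAlgebra n → Prop) :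
    StarModule ℂ (starRingCon r).Quotient where
  star_smul := by
    rintro c ⟨a⟩
    refine congrArg (fun b : FreeStarAlgebra n => (b : (starRingCon r).Quotient))
      (?_ : star (c • a) = star c • star a)
    rw [Algebra.smul_def, Algebra.smul_def, star_mul, FreeStarAlgebra.star_algebraMap]
    exact (Algebra.commutes _ _).symm

/-- The universal unital `*`-algebra generated by self-adjoint elements `u_ij`,
`i, j = 1, …, n`, subject to the relations `r`. -/
noncomputable def presentedAlgebra {n : ℕ}
    (r : FreeStarAlgebra n → FreeStarAlgebra n → Prop) : MatrixStarAlgebra.{0} n where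
  carrier := (starRingCon r).Quotient
  u := Matrix.of fun i j => (FreeStarAlgebra.x n i j : (starRingCon r).Quotient)

/-! ## Relations -/

namespace QuantumRelation

open FreeStarAlgebra

/-- `(u_ij)` is orthogonal. -/
inductive Orthogonal (n : ℕ) : FreeStarAlgebra n → FreeStarAlgebra n → Prop
  | row (i j : Fin n) : Orthogonal n (∑ k, x n i k * x n j k) (if i = j then 1 else 0)
  | col (i j : Fin n) : Orthogonal n (∑ k, x n k i * x n k j) (if i = j then 1 else 0)

/-- `u_ik u_jk = u_ki u_kj = 0` whenever `i ≠ j`. -/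
inductive Cubic (n : ℕ) : FreeStarAlgebra n → FreeStarAlgebra n → Prop
  | row (i j k : Fin n) (h : i ≠ j) : Cubic n (x n i k * x n j k) 0
  | col (i j k : Fin n) (h : i ≠ j) : Cubic n (x n k i * x n k j) 0

/-- `∑ₖ u_ik = ∑ₖ u_kj` for all `i, j`. -/
inductive EqualSums (n : ℕ) : FreeStarAlgebra n → FreeStarAlgebra n → Prop
  | mk (i j : Fin n) : EqualSums n (∑ k, x n i k) (∑ k, x n k j)

/-- `abc = cba` for all generators `a, b, c`. -/
inductive HalfCommuting (n : ℕ) : FreeStarAlgebra n → FreeStarAlgebra n → Prop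
  | mk (i j k l p q : Fin n) :
      HalfCommuting n (x n i j * x n k l * x n p q) (x n p q * x n k l * x n i j)

/-- `ab = ba` for all generators `a, b`. -/
inductive Commuting (n : ℕ) : FreeStarAlgebra n → FreeStarAlgebra n → Prop
  | mk (i j k l : Fin n) : Commuting n (x n i j * x n k l) (x n k l * x n i j)

/-- `T_p u^{⊗k} = u^{⊗l} T_p`, entry by entry. -/
inductive Intertwining (n : ℕ) {k l : ℕ} (p : TwoRowPartition k l) :
    FreeStarAlgebra n → FreeStarAlgebra n → Prop
  | mk (j : Fin l → Fin n) (i : Fin k → Fin n) : Intertwining n p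
      (((partitionMap n p).map (algebraMap ℂ (FreeStarAlgebra n)) *
        matrixTensorPower (x n) k : Matrix _ _ (FreeStarAlgebra n)) j i)
      ((matrixTensorPower (x n) l *
        (partitionMap n p).map (algebraMap ℂ (FreeStarAlgebra n)) :
          Matrix _ _ (FreeStarAlgebra n)) j i)

end QuantumRelation

/-! ## The quantum groups -/

/-- The free orthogonal quantum group `O_n⁺`. -/
noncomputable def OPlus (n : ℕ) : MatrixStarAlgebra.{0} n :=
  presentedAlgebra (QuantumRelation.Orthogonal n)

/-- The half-liberated quantum group `O_n^*`. -/
noncomputable def OStar (n : ℕ) : MatrixStarAlgebra.{0} n :=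
  presentedAlgebra (QuantumRelation.Orthogonal n ⊔ QuantumRelation.HalfCommuting n)

/-- The half-liberated quantum group `B_n^{#*}`. -/
noncomputable def BSharpStar (n : ℕ) : MatrixStarAlgebra.{0} n :=
  presentedAlgebra (QuantumRelation.Orthogonal n ⊔ QuantumRelation.EqualSums n ⊔
    QuantumRelation.HalfCommuting n)

/-- The half-liberated quantum group `H_n^*`. -/
noncomputable def HStar (n : ℕ) : MatrixStarAlgebra.{0} n :=
  presentedAlgebra (QuantumRelation.Orthogonal n ⊔ QuantumRelation.Cubic n ⊔
    QuantumRelation.HalfCommuting n)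

/-- The hyperoctahedral series `H_n^{(s)}`: the quantum subgroup of `H_n^*` given by the relations
that say that `T_p`, for `p = h_s`, is an intertwiner. -/
noncomputable def HSeries (n s : ℕ) : MatrixStarAlgebra.{0} n :=
  presentedAlgebra (QuantumRelation.Orthogonal n ⊔ QuantumRelation.Cubic n ⊔
    QuantumRelation.HalfCommuting n ⊔ QuantumRelation.Intertwining n (TwoRowPartition.hPartition s))

/-- The hyperoctahedral group `H_n`: the relations of `H_n⁺` (orthogonal and cubic), with mutually
commuting generators. -/
noncomputable def HGroup (n : ℕ) : MatrixStarAlgebra.{0} n :=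
  presentedAlgebra (QuantumRelation.Orthogonal n ⊔ QuantumRelation.Cubic n ⊔
    QuantumRelation.Commuting n)

/-- The symmetric group `S_n`: the functions on `S_n`, with the coordinate functions `u_ij`, where
`u_ij(g) = 1` if `g` maps `i` to `j`, and `u_ij(g) = 0` otherwise. -/
noncomputable def SGroup (n : ℕ) : MatrixStarAlgebra.{0} n where
  carrier := Equiv.Perm (Fin n) → ℂ
  u := Matrix.of fun i j g => if g i = j then 1 else 0

/-! ## Easy quantum groups -/

namespace MatrixStarAlgebra

/-- `G` is a compact quantum group with `S_n ⊂ G ⊂ O_n⁺` whose intertwiner spaces are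
`C_G(k,l) = span {T_p | p ∈ P(k,l)}`. -/
structure CorrespondsTo {n : ℕ} (G : MatrixStarAlgebra.{u} n) (P : PartitionFamily) : Prop where
  isOrthogonalQuantumGroup : IsOrthogonalQuantumGroup G
  symmetricGroup_sub : IsQuantumSubgroup (SGroup n) G
  sub_freeOrthogonal : IsQuantumSubgroup G (OPlus n)
  intertwiners_eq : ∀ k l : ℕ,
    G.intertwiners k l = (Submodule.span ℂ (partitionMap n '' P k l) : Set _)

/-- `G` is an easy quantum group: it corresponds to some family `P` with `NC₂ ⊆ P`. -/
def IsEasy {n : ℕ} (G : MatrixStarAlgebra.{u} n) : Prop :=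
  ∃ P : PartitionFamily, (∀ k l, noncrossingPairs k l ⊆ P k l) ∧ G.CorrespondsTo P

end MatrixStarAlgebra

/-! Combinatorics. Rotation turns a partition into one row of points, that is, into a word of block
labels. On such words a full category is closed under cyclic rotation, concatenation of words
without common letters, and contraction: two adjacent letters are identified everywhere and that
pair of positions is deleted (`hasWord_contract`). With the half-liberating partition, letters at
distance two can be exchanged (`hasWord_exchange`); without the crossing all words have even length
(`even_length`). Hence a word amounts to two multisets `s`, `t` of equal size, the letters at odd
and at even positions (`HasColors`). Rotation by one step swaps `s` and `t`, and any letter of `s`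
may be contracted with any letter of `t`.

Without the four block no letter is repeated in `s` or in `t`, since contracting everything else
would leave the four block or the crossing. Every block is then a singleton or a pair of opposite
colours. If there are no singletons, the half-liberating partition generates the category; otherwise
contraction yields two singletons, and these generate the rest.

With the four block any blocks may be merged (`hasColors_map`). Identify all letters other than `a`
and cancel common letters: if `a` occurs `m` times more often in `s` than in `t`, what remains is
`h_m`. The set of all such `m` is closed under truncated subtraction, so all its elements are
divisible by one of them, `d`. Conversely, words whose differences of multiplicities are divisible
by `d` are generated by `h_d`, the four block and the half-liberating partition
(`hasColors_of_dvd`). The values `d = 1, 2` would produce the crossing; `d = 0` and `d ≥ 3` are the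
last two cases.

Quantum groups. For an orthogonal matrix with self-adjoint entries and `n ≥ 1`, the partitions whose
maps are intertwiners form a full category, so relations need to be checked on generators only. The
entries of the intertwining relations of a full category span, already linearly, a two-sided
`*`-ideal of the free algebra. Tannaka–Krein duality is then the double commutant theorem, applied
to matrices on finite sums of tensor powers, in two forms. A map whose relations lie in this ideal
is a combination of the `T_p` (`mem_partitionSpan_of_defect_mem`), which computes the intertwiner
spaces of the presented algebras. All relations of a quantum group follow from its intertwiners
(`mem_relationSpan_of_lift_eq_zero`), so the intertwiners determine it.

For the corollary the classification is applied to the category of all partitions whose maps are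
intertwiners of `G`. It contains the half-liberating partition and the four block because `G ⊂
H_n^*`, it omits the crossing because `G ≠ H_n`, and `G ≠ H_n^*` leaves only the series. -/

namespace TwoRowPartition

/-- The partition whose blocks are the sets of points with the same label. -/
abbrev ofLabels {α : Type*} {k l : ℕ} (f : Fin k → α) (g : Fin l → α) : TwoRowPartition k l :=
  Setoid.ker (Sum.elim f g)

/-- The finitely many blocks are numbered, and each point is labelled by the number of its block. -/
theorem exists_eq_ofLabels {k l : ℕ} (p : TwoRowPartition k l) :
    ∃ (f : Fin k → ℕ) (g : Fin l → ℕ), p = ofLabels f g := by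
  classical
  let e := Fintype.equivFin (Quotient p)
  refine ⟨fun i => e (Quotient.mk p (Sum.inl i)), fun j => e (Quotient.mk p (Sum.inr j)), ?_⟩
  have h : (Sum.elim (fun i => ((e (Quotient.mk p (Sum.inl i)) : Fin _) : ℕ))
      (fun j => ((e (Quotient.mk p (Sum.inr j)) : Fin _) : ℕ))) =
      fun x => ((e (Quotient.mk p x) : Fin _) : ℕ) := by
    funext x
    cases x <;> rfl
  rw [ofLabels, h]
  ext x y
  rw [Setoid.ker_def, Fin.val_inj, e.apply_eq_iff_eq]
  exact (Quotient.eq (r := p)).symm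

end TwoRowPartition

open TwoRowPartition

/-! ### Partitions as words of labels -/

namespace PartitionFamily

theorem mem_of_rel {C : PartitionFamily} {k l : ℕ} {p q : TwoRowPartition k l} (hp : p ∈ C k l)
    (h : ∀ x y, q x y ↔ p x y) : q ∈ C k l :=
  (Setoid.ext h : q = p) ▸ hp

/-- The partition given by two rows of labels belongs to the family. -/
def HasWord (C : PartitionFamily) (U V : List ℕ) : Prop :=
  ofLabels U.get V.get ∈ C U.length V.length

/-- The lengths enter through equations, so that words whose length is only provably equal to `k` or
`l` need no casts between types of partitions. -/
theorem hasWord_iff {C : PartitionFamily} {U V : List ℕ} {k l : ℕ} (hk : U.length = k)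
    (hl : V.length = l) (f : Fin k → ℕ) (g : Fin l → ℕ)
    (hf : ∀ i (h : i < U.length), U[i] = f ⟨i, hk ▸ h⟩)
    (hg : ∀ i (h : i < V.length), V[i] = g ⟨i, hl ▸ h⟩) :
    HasWord C U V ↔ ofLabels f g ∈ C k l := by
  subst hk hl
  have hf' : U.get = f := funext fun i => hf i i.2
  have hg' : V.get = g := funext fun i => hg i i.2
  rw [HasWord, hf', hg']

theorem hasWord_ofFn {C : PartitionFamily} {k l : ℕ} (f : Fin k → ℕ) (g : Fin l → ℕ) :
    HasWord C (List.ofFn f) (List.ofFn g) ↔ ofLabels f g ∈ C k l :=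
  hasWord_iff (by simp) (by simp) f g (by simp) (by simp)

theorem le_of_hasWord {C D : PartitionFamily} (h : ∀ U V, HasWord C U V → HasWord D U V)
    (k l : ℕ) : C k l ⊆ D k l := by
  intro p hp
  obtain ⟨f, g, rfl⟩ := exists_eq_ofLabels p
  exact (hasWord_ofFn f g).1 (h _ _ ((hasWord_ofFn f g).2 hp))

/-- Only the kernel of a labelling matters, so injectivity is needed just on the letters that occur.
-/
theorem HasWord.map {C : PartitionFamily} {U V : List ℕ} (h : HasWord C U V) (φ : ℕ → ℕ)
    (hφ : Set.InjOn φ {x | x ∈ U ∨ x ∈ V}) : HasWord C (U.map φ) (V.map φ) := by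
  rw [hasWord_iff (k := U.length) (l := V.length) (by simp) (by simp) (fun i => φ (U.get i))
    (fun i => φ (V.get i)) (by simp) (by simp)]
  refine mem_of_rel h fun x y => ?_
  have mem : ∀ x, Sum.elim U.get V.get x ∈ {x | x ∈ U ∨ x ∈ V} := by
    rintro (x | x) <;> simp
  have e : Sum.elim (fun i => φ (U.get i)) (fun i => φ (V.get i)) =
    φ ∘ Sum.elim U.get V.get := by
    funext x; cases x <;> rfl
  rw [Setoid.ker_def, Setoid.ker_def, e]
  exact hφ.eq_iff (mem x) (mem y)

end PartitionFamily

open PartitionFamily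

/-! ### The category operations on words -/

namespace IsFullCategory

variable {C : PartitionFamily}

theorem hasWord_cons (hC : IsFullCategory C) (a : ℕ) (U V : List ℕ) :
    HasWord C (a :: U) V ↔ HasWord C U (a :: V) := by
  constructor
  · intro h
    have := hC.rotateLeftDown_mem _ h
    refine mem_of_rel this fun x y => ?_
    have e : ∀ x, Sum.elim U.get (a :: V).get x = Sum.elim (a :: U).get V.get
        (Sum.elim (fun i => Sum.inl i.succ) (Fin.cases (Sum.inl 0) Sum.inr) x) := by
      rintro (x | x)
      · rfl
      · refine Fin.cases ?_ (fun i => ?_) x <;> rfl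
    rw [Setoid.ker_def, e x, e y]
    rfl
  · intro h
    have := hC.rotateLeftUp_mem _ h
    refine mem_of_rel this fun x y => ?_
    have e : ∀ x, Sum.elim (a :: U).get V.get x = Sum.elim U.get (a :: V).get
        (Sum.elim (Fin.cases (Sum.inr 0) Sum.inl) (fun j => Sum.inr j.succ) x) := by
      rintro (x | x)
      · refine Fin.cases ?_ (fun i => ?_) x <;> rfl
      · rfl
    rw [Setoid.ker_def, e x, e y]
    rfl

theorem hasWord_iff_nil (hC : IsFullCategory C) (U V : List ℕ) :
    HasWord C U V ↔ HasWord C [] (U.reverse ++ V) := by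
  induction U generalizing V with
  | nil => rfl
  | cons a U ih => rw [hC.hasWord_cons, ih]; simp

/-- The last letter is moved up on the right. It is then the only upper point, hence also the
leftmost one, and comes down on the left. -/
theorem hasWord_concat (hC : IsFullCategory C) (a : ℕ) (V : List ℕ) :
    HasWord C [] (V ++ [a]) → HasWord C [] (a :: V) := by
  intro h
  rw [← hC.hasWord_cons]
  rw [hasWord_iff (k := 0) (l := V.length + 1) (by simp) (by simp) Fin.elim0
    (Fin.snoc (α := fun _ => ℕ) V.get a) (by simp) (by
      intro i hi
      simp only [Fin.snoc]
      split_ifs with h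
      · simp [h]
      · have : i = V.length := by simp at hi; lia
        subst this
        simp)] at h
  have := hC.rotateRightUp_mem _ h
  rw [hasWord_iff (k := 1) (l := V.length) (by simp) (by simp) (fun _ => a) V.get (by simp)
    (by simp)]
  refine mem_of_rel this fun x y => ?_
  have e : ∀ x : Fin 1 ⊕ Fin V.length, Sum.elim (fun _ => a) V.get x =
      Sum.elim Fin.elim0 (Fin.snoc (α := fun _ => ℕ) V.get a)
      (Sum.elim (Fin.lastCases (Sum.inr (Fin.last V.length)) Sum.inl)
    (fun j => Sum.inr j.castSucc) x) := by
    rintro (x | x)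
    · obtain rfl : x = Fin.last 0 := Subsingleton.elim _ _
      rw [Sum.elim_inl, Sum.elim_inl, Fin.lastCases_last, Sum.elim_inr, Fin.snoc_last]
    · simp
  rw [Setoid.ker_def, e x, e y]
  rfl

theorem hasWord_rotate (hC : IsFullCategory C) (V W : List ℕ) :
    HasWord C [] (V ++ W) → HasWord C [] (W ++ V) := by
  induction W using List.reverseRecOn generalizing V with
  | nil => simp
  | append_singleton W a ih =>
    intro h
    rw [← List.append_assoc] at h
    have := ih (a :: V) (hC.hasWord_concat _ _ h)
    simpa using this

theorem hasWord_append (hC : IsFullCategory C) {V W : List ℕ} (hV : HasWord C [] V)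
    (hW : HasWord C [] W) (h : ∀ x ∈ V, x ∉ W) : HasWord C [] (V ++ W) := by
  have := hC.tensor_mem _ _ hV hW
  rw [hasWord_iff (k := 0) (l := V.length + W.length) (by simp) (by simp) Fin.elim0
    (Fin.append V.get W.get) (by simp) (by
      intro i hi
      simp only [Fin.append, Fin.addCases]
      split_ifs with h
      · simp [h]
      · simp [List.getElem_append_right (not_lt.1 h)])]
  refine mem_of_rel this fun x y => ?_
  rcases x with x | x
  · exact x.elim0
  rcases y with y | y
  · exact y.elim0
  have h1 : ∀ i j, V.get i ≠ W.get j := fun i j e => h _ (V.get_mem i) (e ▸ W.get_mem j)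
  rw [Setoid.ker_def]
  refine Fin.addCases (fun i => ?_) (fun i => ?_) x <;>
    refine Fin.addCases (fun j => ?_) (fun j => ?_) y
  all_goals
    change _ ↔ Sum.LiftRel _ _ _ _
    simp [splitPoints, Setoid.ker_def]
    try first
    | exact h1 _ _
    | exact (h1 _ _).symm

theorem hasWord_pair (hC : IsFullCategory C) (a : ℕ) : HasWord C [] [a, a] := by
  refine mem_of_rel hC.pair_mem fun x y => ?_
  have e : ∀ x : Fin 0 ⊕ Fin 2, Sum.elim (List.get []) (List.get [a, a]) x = a := by
    rintro (x | x)
    · exact x.elim0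
    · fin_cases x <;> rfl
  rw [Setoid.ker_def]
  exact ⟨fun _ => trivial, fun _ => (e x).trans (e y).symm⟩

/-- Nested pairs. Each new pair is inserted at the centre, which after a rotation is an ordinary
concatenation. -/
theorem hasWord_reverse_append_self (hC : IsFullCategory C) {L : List ℕ} (hL : L.Nodup)
    (hne : L ≠ []) : HasWord C [] (L.reverse ++ L) := by
  induction L with
  | nil => exact absurd rfl hne
  | cons a L ih =>
    rcases eq_or_ne L [] with rfl | h
    · exact hC.hasWord_pair a
    · have h1 := hC.hasWord_rotate _ _ (ih hL.of_cons h)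
      have h2 := hC.hasWord_append (hC.hasWord_pair a) h1 (by
        have := (List.nodup_cons.1 hL).1
        simp [this])
      rw [← List.append_assoc] at h2
      have := hC.hasWord_rotate _ _ h2
      simpa using this

/-- The label `min i m` gives the last two upper points the common label `m`, which no lower point
carries, and joins every other upper point to the one below it. Composition with this partition
contracts the last two letters of a word. -/
theorem capLast_mem (hC : IsFullCategory C) (m : ℕ) :
    ofLabels (fun i : Fin (m + 2) => min (i : ℕ) m) (fun j : Fin m => (j : ℕ)) ∈ C (m + 2) m := by
  have h : HasWord C [] ((List.range m ++ [m, m]).reverse ++ List.range m) := by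
    have h1 : HasWord C [] [m, m] := hC.hasWord_pair m
    rcases Nat.eq_zero_or_pos m with rfl | hm
    · simpa using h1
    · have := hC.hasWord_append h1
        (hC.hasWord_reverse_append_self (L := List.range m) List.nodup_range (by simp; lia))
        (by simp)
      simpa using this
  rw [← hC.hasWord_iff_nil, hasWord_iff (k := m + 2) (l := m) (by simp) (by simp)
    (fun i => min (i : ℕ) m) (fun j => (j : ℕ))] at h
  · exact h
  · intro i hi
    simp only [List.length_append, List.length_range, List.length_cons, List.length_nil] at hi
    rcases lt_or_ge i m with h | h
    · rw [List.getElem_append_left (by simpa using h)]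
      simp [h.le]
    · rw [List.getElem_append_right (by simpa using h)]
      obtain rfl | rfl : i = m ∨ i = m + 1 := by lia
      all_goals simp
  · simp

/-- Under the cap the blocks of the last two points are joined and these points disappear. Equal new
labels give an explicit chain in the stack; conversely, a labelling of the whole stack that no step
changes shows that connected points have equal labels. -/
theorem contractLast_mem (hC : IsFullCategory C) {m : ℕ} (g : Fin (m + 2) → ℕ)
    (hg : ofLabels Fin.elim0 g ∈ C 0 (m + 2)) (x y : ℕ)
    (hx : g (Fin.natAdd m 0) = x) (hy : g (Fin.natAdd m 1) = y) :
    ofLabels Fin.elim0 (fun i : Fin m => if g (Fin.castAdd 2 i) = y then x else g (Fin.castAdd 2 i))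
      ∈ C 0 m := by
  refine mem_of_rel (hC.compose_mem _ _ hg (hC.capLast_mem m)) ?_
  rintro (i | i) (j | j)
  · exact i.elim0
  · exact i.elim0
  · exact j.elim0
  set μ : ℕ → ℕ := fun t => if t = y then x else t with hμ
  set p : TwoRowPartition 0 (m + 2) := ofLabels Fin.elim0 g
  set q : TwoRowPartition (m + 2) m :=
    ofLabels (fun i : Fin (m + 2) => min (i : ℕ) m) (fun j : Fin m => (j : ℕ))
  change μ (g (Fin.castAdd 2 i)) = μ (g (Fin.castAdd 2 j)) ↔
    Relation.EqvGen (StackStep p q) (Sum.inr (Sum.inr i)) (Sum.inr (Sum.inr j))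
  have low : ∀ i : Fin m, Relation.EqvGen (StackStep p q) (Sum.inr (Sum.inr i))
      (Sum.inr (Sum.inl (Fin.castAdd 2 i))) := fun i =>
    .rel _ _ (.bottom (Sum.inr i) (Sum.inl (Fin.castAdd 2 i)) (by
      change (i : ℕ) = min (i : ℕ) m
      rw [min_eq_left i.2.le]))
  have mid : ∀ a b : Fin (m + 2), g a = g b → Relation.EqvGen (StackStep p q)
      (Sum.inr (Sum.inl a)) (Sum.inr (Sum.inl b)) := fun a b h =>
    .rel _ _ (.top (Sum.inr a) (Sum.inr b) h)
  have cap : Relation.EqvGen (StackStep p q) (Sum.inr (Sum.inl (Fin.natAdd m 0)))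
      (Sum.inr (Sum.inl (Fin.natAdd m 1))) :=
    .rel _ _ (.bottom (Sum.inl _) (Sum.inl _) (by
      change min _ _ = min _ _
      simp))
  constructor
  · intro h
    refine .trans _ _ _ (low i) (.trans _ _ _ ?_ (.symm _ _ (low j)))
    simp only [hμ] at h
    split_ifs at h with h1 h2 h2
    · exact mid _ _ (h1.trans h2.symm)
    · exact .trans _ _ _ (mid _ _ (h1.trans hy.symm)) (.trans _ _ _ (.symm _ _ cap)
        (mid _ _ (hx.trans h)))
    · exact .trans _ _ _ (mid _ _ (h.trans hx.symm)) (.trans _ _ _ cap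
        (mid _ _ (hy.trans h2.symm)))
    · exact mid _ _ h
  · intro h
    -- The invariant: each middle point gets its merged label, each lower point that of the middle
    -- point above it.
    let lab : Fin 0 ⊕ (Fin (m + 2) ⊕ Fin m) → ℕ := Sum.elim Fin.elim0
      (Sum.elim (fun a => μ (g a)) (fun a => μ (g (Fin.castAdd 2 a))))
    have key : ∀ a b, StackStep p q a b → lab a = lab b := by
      intro a b hab
      cases hab with
      | top a b h =>
        rcases a with a | a
        · exact a.elim0
        rcases b with b | b
        · exact b.elim0
        exact congrArg μ h
      | bottom a b h =>
        -- A middle point lies above a lower point or is one of the two capped points, whose labels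
        -- `x` and `y` both merge to `x`.
        have cases2 : ∀ a : Fin (m + 2), (∃ i : Fin m, a = Fin.castAdd 2 i) ∨
            (μ (g a) = x ∧ min (a : ℕ) m = m) := by
          intro a
          refine Fin.addCases (fun i => Or.inl ⟨i, rfl⟩) (fun i => Or.inr ?_) a
          fin_cases i
          · simp only [Fin.zero_eta, hx]
            simp [hμ]
          · simp only [Fin.mk_one, hy]
            simp [hμ]
        have val : ∀ i : Fin m, min ((Fin.castAdd 2 i : Fin (m + 2)) : ℕ) m = i := fun i => by
          simp [i.2.le]
        rcases a with a | a <;> rcases b with b | b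
        · change min (a : ℕ) m = min (b : ℕ) m at h
          change μ (g a) = μ (g b)
          rcases cases2 a with ⟨i, rfl⟩ | ⟨h1, h2⟩ <;> rcases cases2 b with ⟨j, rfl⟩ | ⟨h3, h4⟩
          · rw [val, val, Fin.val_inj] at h
            rw [h]
          · rw [val, h4] at h
            exact absurd h i.2.ne
          · rw [val, h2] at h
            exact absurd h.symm j.2.ne
          · rw [h1, h3]
        · change min (a : ℕ) m = (b : ℕ) at h
          change μ (g a) = μ (g _)
          rcases cases2 a with ⟨i, rfl⟩ | ⟨h1, h2⟩
          · rw [val, Fin.val_inj] at h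
            rw [h]
          · exact absurd (h2.symm.trans h).symm b.2.ne
        · change (a : ℕ) = min (b : ℕ) m at h
          change μ (g _) = μ (g b)
          rcases cases2 b with ⟨i, rfl⟩ | ⟨h1, h2⟩
          · rw [val, Fin.val_inj] at h
            rw [h]
          · exact absurd (h.trans h2) a.2.ne
        · change (a : ℕ) = (b : ℕ) at h
          rw [Fin.val_inj] at h
          rw [h]
    have : ∀ a b, Relation.EqvGen (StackStep p q) a b → lab a = lab b := by
      intro a b hab
      induction hab with
      | rel a b h => exact key a b h
      | refl a => rfl
      | symm a b _ ih => exact ih.symm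
      | trans a b c _ _ ih ih' => exact ih.trans ih'
    exact this _ _ h

/-- Rotation brings any two adjacent letters to the end of the word. This is the form in which
composition is used in the classification. -/
theorem hasWord_contract (hC : IsFullCategory C) (V W : List ℕ) (x y : ℕ)
    (h : HasWord C [] (V ++ [x, y] ++ W)) :
    HasWord C [] ((V ++ W).map fun t => if t = y then x else t) := by
  rw [List.append_assoc] at h
  replace h := hC.hasWord_rotate _ _ h
  rw [List.append_assoc] at h
  replace h := hC.hasWord_rotate _ _ h
  suffices HasWord C [] ((W ++ V).map fun t => if t = y then x else t) by
    rw [List.map_append] at this ⊢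
    exact hC.hasWord_rotate _ _ this
  generalize W ++ V = L at h ⊢
  rw [hasWord_iff (k := 0) (l := L.length + 2) (by simp) (by simp) Fin.elim0
    (fun i => (L ++ [x, y]).get (i.cast (by simp))) (by simp) (by simp)] at h
  have := hC.contractLast_mem _ h x y (by simp) (by simp)
  rw [hasWord_iff (k := 0) (l := L.length) (by simp) (by simp) Fin.elim0
    (fun i => if L.get i = y then x else L.get i) (by simp) (by simp)]
  convert this using 3 with i
  simp

end IsFullCategory

/-! ### Words as pairs of multisets of labels -/

namespace PartitionFamily

/-- The letters of the two lists in turn. -/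
def interleave : List ℕ → List ℕ → List ℕ
  | a :: A, b :: B => a :: b :: interleave A B
  | _, _ => []

/-- The family contains the one-row partition with the labels `s` at the odd positions and the
labels `t` at the even positions, in some order. -/
def HasColors (C : PartitionFamily) (s t : Multiset ℕ) : Prop :=
  ∃ A B : List ℕ, A.length = B.length ∧ (A : Multiset ℕ) = s ∧ (B : Multiset ℕ) = t ∧
    HasWord C [] (interleave A B)

theorem interleave_append {A B A' B' : List ℕ} (h : A.length = B.length) :
    interleave (A ++ A') (B ++ B') = interleave A B ++ interleave A' B' := by
  induction A generalizing B with
  | nil => obtain rfl := List.length_eq_zero_iff.1 h.symm; rfl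
  | cons a A ih =>
    cases B with
    | nil => simp at h
    | cons b B => simp [interleave, ih (Nat.succ.inj h)]

theorem map_interleave (φ : ℕ → ℕ) (A B : List ℕ) :
    (interleave A B).map φ = interleave (A.map φ) (B.map φ) := by
  induction A generalizing B with
  | nil => rfl
  | cons a A ih =>
    cases B with
    | nil => rfl
    | cons b B => simp [interleave, ih]

theorem mem_interleave {x : ℕ} {A B : List ℕ} (h : x ∈ interleave A B) : x ∈ A ∨ x ∈ B := by
  induction A generalizing B with
  | nil => simp [interleave] at h
  | cons a A ih =>
    cases B with
    | nil => simp [interleave] at h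
    | cons b B =>
      simp only [interleave, List.mem_cons] at h ⊢
      rcases h with h | h | h
      · exact Or.inl (Or.inl h)
      · exact Or.inr (Or.inl h)
      · exact (ih h).imp Or.inr Or.inr

theorem exists_eq_interleave {L : List ℕ} (h : Even L.length) :
    ∃ A B, A.length = B.length ∧ L = interleave A B := by
  match L with
  | [] => exact ⟨[], [], rfl, rfl⟩
  | [a] => simp at h
  | a :: b :: L =>
    obtain ⟨A, B, h1, h2⟩ := exists_eq_interleave (L := L) (by
      simpa [parity_simps] using h)
    exact ⟨a :: A, b :: B, by simpa using h1, by rw [h2]; rfl⟩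

theorem HasColors.card_eq {C : PartitionFamily} {s t : Multiset ℕ} (h : HasColors C s t) :
    s.card = t.card := by
  obtain ⟨A, B, h, rfl, rfl, _⟩ := h
  simpa using h

theorem HasColors.map {C : PartitionFamily} {s t : Multiset ℕ} (h : HasColors C s t) (φ : ℕ → ℕ)
    (hφ : Set.InjOn φ {x | x ∈ s ∨ x ∈ t}) : HasColors C (s.map φ) (t.map φ) := by
  obtain ⟨A, B, h, rfl, rfl, hw⟩ := h
  refine ⟨A.map φ, B.map φ, by simpa using h, rfl, rfl, ?_⟩
  rw [← map_interleave]
  exact hw.map φ (hφ.mono fun x hx => by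
    rcases hx with hx | hx
    · simp at hx
    · exact mem_interleave hx)

/-- Supplies letters that do not occur yet. -/
theorem exists_bound (s : Multiset ℕ) : ∃ N, ∀ x ∈ s, x < N :=
  ⟨s.sup + 1, fun _ hx => Nat.lt_succ_of_le (Multiset.le_sup hx)⟩

end PartitionFamily

theorem isFullCategory_generatedCategory (S : Set (Σ k : ℕ, Σ l : ℕ, TwoRowPartition k l)) :
    IsFullCategory (generatedCategory S) where
  tensor_mem p q hp hq _ hC h := hC.tensor_mem p q (hp _ hC h) (hq _ hC h)
  compose_mem p q hp hq _ hC h := hC.compose_mem p q (hp _ hC h) (hq _ hC h)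
  involution_mem p hp _ hC h := hC.involution_mem p (hp _ hC h)
  rotateLeftDown_mem p hp _ hC h := hC.rotateLeftDown_mem p (hp _ hC h)
  rotateLeftUp_mem p hp _ hC h := hC.rotateLeftUp_mem p (hp _ hC h)
  rotateRightDown_mem p hp _ hC h := hC.rotateRightDown_mem p (hp _ hC h)
  rotateRightUp_mem p hp _ hC h := hC.rotateRightUp_mem p (hp _ hC h)
  unit_mem _ hC _ := hC.unit_mem
  pair_mem _ hC _ := hC.pair_mem

theorem mem_generatedCategory {S : Set (Σ k : ℕ, Σ l : ℕ, TwoRowPartition k l)} {k l : ℕ}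
    {p : TwoRowPartition k l} (h : ⟨k, l, p⟩ ∈ S) : p ∈ generatedCategory S k l :=
  fun _ _ hS => hS _ h

theorem generatedCategory_subset {S : Set (Σ k : ℕ, Σ l : ℕ, TwoRowPartition k l)}
    {C : PartitionFamily} (hC : IsFullCategory C) (hS : ∀ g ∈ S, g.2.2 ∈ C g.1 g.2.1) (k l : ℕ) :
    generatedCategory S k l ⊆ C k l :=
  fun _ hp => hp C hC hS

/-! ### Half-liberation: exchanging letters of the same colour -/

namespace IsFullCategory

variable {C : PartitionFamily}

theorem halfLiberating_mem_iff (hC : IsFullCategory C) :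
    halfLiberating ∈ C 3 3 ↔ HasWord C [] [0, 1, 2, 0, 1, 2] := by
  -- Rotating the upper row down reverses it, so the three strings that reverse the order become the
  -- word `0 1 2 0 1 2`.
  have h1 : HasWord C [2, 1, 0] [0, 1, 2] ↔ HasWord C [] [0, 1, 2, 0, 1, 2] :=
    hC.hasWord_iff_nil _ _
  rw [← h1, HasWord]
  have : halfLiberating = ofLabels (List.get [2, 1, 0]) (List.get [0, 1, 2]) := by
    ext x y
    rw [Setoid.ker_def]
    change Sum.elim id Fin.rev x = Sum.elim id Fin.rev y ↔ _
    revert x y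
    decide
  rw [this]
  rfl

theorem crossing_mem_iff (hC : IsFullCategory C) :
    crossing ∈ C 2 2 ↔ HasWord C [] [0, 1, 0, 1] := by
  have h1 : HasWord C [1, 0] [0, 1] ↔ HasWord C [] [0, 1, 0, 1] :=
    hC.hasWord_iff_nil _ _
  rw [← h1, HasWord]
  have : crossing = ofLabels (List.get [1, 0]) (List.get [0, 1]) := by
    ext x y
    rw [Setoid.ker_def]
    change Sum.elim id Fin.rev x = Sum.elim id Fin.rev y ↔ _
    revert x y
    decide
  rw [this]
  rfl

theorem fourBlock_mem_iff : fourBlock ∈ C 0 4 ↔ HasWord C [] [0, 0, 0, 0] := by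
  rw [HasWord]
  have : fourBlock = ofLabels (List.get []) (List.get [0, 0, 0, 0]) := by
    ext x y
    rw [Setoid.ker_def]
    change True ↔ _
    revert x y
    decide
  rw [this]
  rfl

theorem doubleSingleton_mem_iff : doubleSingleton ∈ C 0 2 ↔ HasWord C [] [0, 1] := by
  rw [HasWord]
  have : doubleSingleton = ofLabels (List.get []) (List.get [0, 1]) := by
    ext x y
    rw [Setoid.ker_def]
    change x = y ↔ _
    revert x y
    decide
  rw [this]
  rfl

theorem getElem_interleave_replicate (s : ℕ) (i : ℕ)
    (h : i < (interleave (List.replicate s 0) (List.replicate s 1)).length) :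
    (interleave (List.replicate s 0) (List.replicate s 1))[i] = i % 2 := by
  induction s generalizing i with
  | zero => simp [interleave] at h
  | succ s ih =>
    match i with
    | 0 => rfl
    | 1 => rfl
    | i + 2 =>
      simp only [List.replicate_succ, interleave, List.getElem_cons_succ]
      rw [ih]
      lia

theorem length_interleave_replicate (s : ℕ) :
    (interleave (List.replicate s 0) (List.replicate s 1)).length = 2 * s := by
  induction s with
  | zero => rfl
  | succ s ih => simp only [List.replicate_succ, interleave, List.length_cons, ih]; lia

theorem hPartition_mem_iff (s : ℕ) : hPartition s ∈ C 0 (2 * s) ↔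
    HasWord C [] (interleave (List.replicate s 0) (List.replicate s 1)) := by
  rw [hasWord_iff (k := 0) (l := 2 * s) rfl (length_interleave_replicate s) Fin.elim0
    (fun j => (j : ℕ) % 2) (by simp) (fun i hi => getElem_interleave_replicate s i hi)]
  rfl

theorem hasWord_halfLiberating (hC : IsFullCategory C) (hh : halfLiberating ∈ C 3 3) (N : ℕ) :
    HasWord C [] [N, N + 1, N + 2, N, N + 1, N + 2] := by
  have := (hC.halfLiberating_mem_iff.1 hh).map (fun x => N + x) (by
    intro x _ y _ h
    simpa using h)
  simpa using this

/-- Append the word `N, N+1, N+2, N, N+1, N+2` in fresh letters after `x, b, y` and contract from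
the inside: `y` with `N`, `b` with `N+1`, `x` with `N+2`. The second half of the appended word then
reads `y, b, x`. -/
theorem hasWord_exchange (hC : IsFullCategory C) (hh : halfLiberating ∈ C 3 3) (V W : List ℕ)
    (x b y : ℕ) (h : HasWord C [] (V ++ [x, b, y] ++ W)) : HasWord C [] (V ++ [y, b, x] ++ W) := by
  rw [List.append_assoc] at h
  replace h := hC.hasWord_rotate _ _ h
  rw [List.append_assoc] at h
  replace h := hC.hasWord_rotate _ _ h
  suffices HasWord C [] (W ++ V ++ [y, b, x]) by
    rw [List.append_assoc] at this
    replace this := hC.hasWord_rotate _ _ this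
    simpa using this
  generalize W ++ V = L at h ⊢
  obtain ⟨N, hN⟩ := exists_bound (x ::ₘ b ::ₘ y ::ₘ (L : Multiset ℕ))
  simp only [Multiset.mem_cons, Multiset.mem_coe] at hN
  have hx := hN x (by simp)
  have hb := hN b (by simp)
  have hy := hN y (by simp)
  have hL : ∀ c r, N ≤ c → L.map (fun t => if t = c then r else t) = L := by
    intro c r hc
    refine (List.map_congr_left fun t ht => ?_).trans (List.map_id L)
    rw [if_neg (by have := hN t (by simp [ht]); lia), id]
  have h0 := hC.hasWord_append h (hC.hasWord_halfLiberating hh N) (by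
    intro t ht ht'
    have : t < N := hN t (by simp at ht; tauto)
    simp at ht'
    lia)
  have h1 := hC.hasWord_contract (L ++ [x, b]) [N + 1, N + 2, N, N + 1, N + 2] y N
    (by simpa using h0)
  have e1 : ((L ++ [x, b]) ++ [N + 1, N + 2, N, N + 1, N + 2]).map
      (fun t => if t = N then y else t) = L ++ [x] ++ [b, N + 1] ++ [N + 2, y, N + 1, N + 2] := by
    simp [hL, hx.ne, hb.ne]
  rw [e1] at h1
  have h2 := hC.hasWord_contract (L ++ [x]) [N + 2, y, N + 1, N + 2] b (N + 1) h1
  have e2 : ((L ++ [x]) ++ [N + 2, y, N + 1, N + 2]).map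
      (fun t => if t = N + 1 then b else t) = L ++ [x, N + 2] ++ [y, b, N + 2] := by
    simp [hL, (show x ≠ N + 1 by lia), (show y ≠ N + 1 by lia)]
  rw [e2] at h2
  have h3 := hC.hasWord_contract L [y, b, N + 2] x (N + 2) h2
  have e3 : (L ++ [y, b, N + 2]).map
      (fun t => if t = N + 2 then x else t) = L ++ [y, b, x] := by
    simp [hL, (show b ≠ N + 2 by lia), (show y ≠ N + 2 by lia)]
  rwa [e3] at h3

/-- Neighbouring letters of `A` stand at distance two in the word, and such swaps generate all
permutations. The prefix `V` absorbs the letters already passed. -/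
theorem hasWord_perm_left (hC : IsFullCategory C) (hh : halfLiberating ∈ C 3 3) {A A' : List ℕ}
    (hA : A.Perm A') : ∀ (V B : List ℕ), A.length = B.length →
    HasWord C [] (V ++ interleave A B) → HasWord C [] (V ++ interleave A' B) := by
  induction hA with
  | nil => exact fun _ _ _ h => h
  | cons a _ ih =>
    intro V B hl h
    cases B with
    | nil => simp at hl
    | cons b B =>
      have := ih (V ++ [a, b]) B (by simpa using hl) (by simpa [interleave] using h)
      simpa [interleave] using this
  | swap a a' l =>
    intro V B hl h
    match B with
    | [] => simp at hl
    | [b] => simp at hl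
    | b :: b' :: B =>
      have := hC.hasWord_exchange hh V (b' :: interleave l B) a' b a
        (by simpa [interleave] using h)
      simpa [interleave] using this
  | trans h1 _ ih ih' =>
    intro V B hl h
    exact ih' V B (h1.length_eq ▸ hl) (ih V B hl h)

theorem hasWord_perm_right (hC : IsFullCategory C) (hh : halfLiberating ∈ C 3 3) {B B' : List ℕ}
    (hB : B.Perm B') : ∀ (V A : List ℕ), A.length = B.length →
    HasWord C [] (V ++ interleave A B) → HasWord C [] (V ++ interleave A B') := by
  induction hB with
  | nil => exact fun _ _ _ h => h
  | cons b _ ih =>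
    intro V A hl h
    cases A with
    | nil => simp at hl
    | cons a A =>
      have := ih (V ++ [a, b]) A (by simpa using hl) (by simpa [interleave] using h)
      simpa [interleave] using this
  | swap b b' l =>
    intro V A hl h
    match A with
    | [] => simp at hl
    | [a] => simp at hl
    | a :: a' :: A =>
      have := hC.hasWord_exchange hh (V ++ [a]) (interleave A l) b' a' b
        (by simpa [interleave] using h)
      simpa [interleave] using this
  | trans h1 _ ih ih' =>
    intro V A hl h
    exact ih' V A (h1.length_eq ▸ hl) (ih V A hl h)

/-- The order chosen in `HasColors` is immaterial: every arrangement of the two multisets belongs to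
the category. -/
theorem hasColors_coe (hC : IsFullCategory C) (hh : halfLiberating ∈ C 3 3) {A B : List ℕ}
    (h : HasColors C A B) : HasWord C [] (interleave A B) := by
  obtain ⟨A', B', hl, hA, hB, hw⟩ := h
  rw [Multiset.coe_eq_coe] at hA hB
  have h1 := hC.hasWord_perm_left hh hA [] B' hl hw
  exact hC.hasWord_perm_right hh hB [] A (by rw [← hA.length_eq, hl]) h1

theorem hasWord_nil (hC : IsFullCategory C) : HasWord C [] [] :=
  hC.hasWord_contract [] [] 0 0 (hC.hasWord_pair 0)

theorem hasColors_zero (hC : IsFullCategory C) : HasColors C 0 0 :=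
  ⟨[], [], rfl, rfl, rfl, hC.hasWord_nil⟩

theorem hasColors_pair (hC : IsFullCategory C) (a : ℕ) : HasColors C {a} {a} :=
  ⟨[a], [a], rfl, rfl, rfl, hC.hasWord_pair a⟩

theorem hasColors_add_of_disjoint (hC : IsFullCategory C) {s t s' t' : Multiset ℕ}
    (h : HasColors C s t) (h' : HasColors C s' t') (hd : ∀ x ∈ s + t, x ∉ s' + t') :
    HasColors C (s + s') (t + t') := by
  obtain ⟨A, B, hl, rfl, rfl, hw⟩ := h
  obtain ⟨A', B', hl', rfl, rfl, hw'⟩ := h'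
  refine ⟨A ++ A', B ++ B', by simp [hl, hl'], rfl, rfl, ?_⟩
  rw [interleave_append hl]
  refine hC.hasWord_append hw hw' fun x hx hx' => hd x ?_ ?_
  · simpa using mem_interleave hx
  · simpa using mem_interleave hx'

/-- A cyclic rotation by one letter exchanges odd and even positions. -/
theorem hasColors_symm (hC : IsFullCategory C) {s t : Multiset ℕ}
    (h : HasColors C s t) : HasColors C t s := by
  obtain ⟨A, B, hl, rfl, rfl, hw⟩ := h
  cases A with
  | nil =>
    obtain rfl := List.length_eq_zero_iff.1 hl.symm
    exact hC.hasColors_zero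
  | cons a A =>
    refine ⟨B, A ++ [a], by simpa using hl.symm, rfl, ?_, ?_⟩
    · rw [Multiset.coe_eq_coe]
      exact List.perm_append_singleton a A
    have key : ∀ (A B : List ℕ) (a c : ℕ), A.length + 1 = B.length →
        interleave (a :: A) B ++ [c] = a :: interleave B (A ++ [c]) := by
      intro A
      induction A with
      | nil =>
        intro B a c hB
        match B with
        | [] => simp at hB
        | [b] => rfl
        | b :: b' :: B => simp at hB
      | cons a' A ih =>
        intro B a c hB
        cases B with
        | nil => simp at hB
        | cons b B =>
          have := ih B a' c (by simpa using hB)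
          simpa [interleave] using this
    cases B with
    | nil => simp at hl
    | cons b B =>
      have h1 := key A (b :: B) a a (by simpa using hl)
      have h2 := hC.hasWord_rotate [a] (b :: interleave A B) hw
      simp only [interleave, List.cons_append, List.cons.injEq, true_and] at h1
      rwa [List.cons_append, h1] at h2

/-- Since the order within each colour is free, any odd letter can be placed next to any even letter
and contracted with it. -/
theorem hasColors_contract (hC : IsFullCategory C) (hh : halfLiberating ∈ C 3 3)
    {s t : Multiset ℕ} {a b : ℕ} (h : HasColors C (a ::ₘ s) (b ::ₘ t)) :
    HasColors C (s.map fun x => if x = b then a else x)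
      (t.map fun x => if x = b then a else x) := by
  have hl : s.card = t.card := by simpa using h.card_eq
  induction s using Quotient.inductionOn with | _ A
  induction t using Quotient.inductionOn with | _ B
  have h1 : HasWord C [] (interleave (a :: A) (b :: B)) := hC.hasColors_coe hh h
  have h2 := hC.hasWord_contract [] (interleave A B) a b h1
  refine ⟨A.map _, B.map _, by simpa using hl, rfl, rfl, ?_⟩
  rw [← map_interleave]
  exact h2

end IsFullCategory

theorem Multiset.exists_eq_cons_of_card {s : Multiset ℕ} {n : ℕ} (h : s.card = n + 1) :
    ∃ a t, s = a ::ₘ t := by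
  obtain ⟨a, ha⟩ := Multiset.card_pos_iff_exists_mem.1 (by lia : 0 < s.card)
  exact ⟨a, Multiset.exists_cons_of_mem ha⟩

/-! ### Categories without the four block -/

namespace IsFullCategory

variable {C : PartitionFamily}

theorem crossing_mem_iff_hasColors (hC : IsFullCategory C) (hh : halfLiberating ∈ C 3 3) :
    crossing ∈ C 2 2 ↔ HasColors C {0, 0} {1, 1} := by
  rw [hC.crossing_mem_iff]
  exact ⟨fun h => ⟨[0, 0], [1, 1], rfl, rfl, rfl, h⟩,
    fun h => hC.hasColors_coe hh (A := [0, 0]) (B := [1, 1]) h⟩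

theorem fourBlock_mem_iff_hasColors (hC : IsFullCategory C) (hh : halfLiberating ∈ C 3 3) :
    fourBlock ∈ C 0 4 ↔ HasColors C {0, 0} {0, 0} := by
  rw [fourBlock_mem_iff]
  exact ⟨fun h => ⟨[0, 0], [0, 0], rfl, rfl, rfl, h⟩,
    fun h => hC.hasColors_coe hh (A := [0, 0]) (B := [0, 0]) h⟩

theorem doubleSingleton_mem_iff_hasColors (hC : IsFullCategory C)
    (hh : halfLiberating ∈ C 3 3) : doubleSingleton ∈ C 0 2 ↔ HasColors C {0} {1} := by
  rw [doubleSingleton_mem_iff]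
  exact ⟨fun h => ⟨[0], [1], rfl, rfl, rfl, h⟩,
    fun h => hC.hasColors_coe hh (A := [0]) (B := [1]) h⟩

theorem hPartition_mem_iff_hasColors (hC : IsFullCategory C) (hh : halfLiberating ∈ C 3 3)
    (s : ℕ) : hPartition s ∈ C 0 (2 * s) ↔
      HasColors C (Multiset.replicate s 0) (Multiset.replicate s 1) := by
  rw [hPartition_mem_iff]
  exact ⟨fun h => ⟨_, _, by simp, rfl, rfl, h⟩,
    fun h => hC.hasColors_coe hh (A := List.replicate s 0) (B := List.replicate s 1) h⟩

theorem hasColors_shift (hC : IsFullCategory C) {s t s' t' : Multiset ℕ}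
    (h : HasColors C s t) (h' : HasColors C s' t') :
    ∃ N, (∀ x, x ∈ s ∨ x ∈ t → x < N) ∧
      HasColors C (s + s'.map (fun x => N + x)) (t + t'.map (fun x => N + x)) := by
  obtain ⟨N, hN⟩ := exists_bound (s + t)
  refine ⟨N, by simpa using hN, hC.hasColors_add_of_disjoint h (h'.map _ ?_) ?_⟩
  · intro x _ y _ h
    simpa using h
  · intro x hx hx'
    have := hN x hx
    simp only [Multiset.mem_add, Multiset.mem_map] at hx'
    rcases hx' with ⟨y, _, rfl⟩ | ⟨y, _, rfl⟩ <;> lia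

/-- Two equal letters at odd positions survive the contraction of all other pairs. -/
theorem exists_hasColors_two (hC : IsFullCategory C) (hh : halfLiberating ∈ C 3 3) (n : ℕ) :
    ∀ (s t : Multiset ℕ) (c : ℕ), s.card = n → HasColors C (c ::ₘ c ::ₘ s) t →
      ∃ c x y, HasColors C {c, c} {x, y} := by
  induction n with
  | zero =>
    intro s t c hs h
    obtain rfl := Multiset.card_eq_zero.1 hs
    obtain ⟨x, y, rfl⟩ := Multiset.card_eq_two.1 h.card_eq.symm
    exact ⟨c, x, y, h⟩
  | succ n ih =>
    intro s t c hs h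
    obtain ⟨a, s, rfl⟩ := Multiset.exists_eq_cons_of_card hs
    have ht := h.card_eq
    obtain ⟨b, t, rfl⟩ := Multiset.exists_eq_cons_of_card (s := t) (n := n + 2)
      (by simp at ht hs; lia)
    -- A third odd letter is contracted with some even one. The contraction renames both copies of
    -- `c` in the same way, so they stay equal.
    rw [Multiset.cons_swap c a, Multiset.cons_swap c a] at h
    have := hC.hasColors_contract hh h
    rw [Multiset.map_cons, Multiset.map_cons] at this
    exact ih _ _ _ (by simpa using hs) this

/-- Put `{c, c}` over `{x, y}` next to a fresh copy with the colours exchanged and contract `x` and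
`y` with their copies. What remains are two equal odd letters and two equal even letters. -/
theorem exists_hasColors_two_two (hC : IsFullCategory C) (hh : halfLiberating ∈ C 3 3)
    {s t : Multiset ℕ} {c : ℕ} (h : HasColors C (c ::ₘ c ::ₘ s) t) :
    ∃ c d, HasColors C {c, c} {d, d} := by
  obtain ⟨c, x, y, h⟩ := hC.exists_hasColors_two hh _ _ _ _ rfl h
  obtain ⟨N, -, h1⟩ := hC.hasColors_shift h (hC.hasColors_symm h)
  have e1 : ({c, c} + ({x, y} : Multiset ℕ).map (fun x => N + x)) =
      (N + x) ::ₘ (N + y) ::ₘ {c, c} := by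
    simp only [Multiset.insert_eq_cons, ← Multiset.singleton_add, Multiset.map_add,
      Multiset.map_singleton]
    abel
  have e2 : ({x, y} + ({c, c} : Multiset ℕ).map (fun x => N + x)) =
      x ::ₘ y ::ₘ {N + c, N + c} := by
    simp only [Multiset.insert_eq_cons, ← Multiset.singleton_add, Multiset.map_add,
      Multiset.map_singleton]
    abel
  rw [e1, e2] at h1
  have h2 := hC.hasColors_contract hh h1
  rw [Multiset.map_cons, Multiset.map_cons] at h2
  have h3 := hC.hasColors_contract hh h2
  simp only [Multiset.insert_eq_cons, Multiset.map_cons, Multiset.map_singleton] at h3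
  exact ⟨_, _, h3⟩

/-- A letter repeated within one colour contracts to `{c, c}` over `{d, d}`. This is the four block
if `c = d`, and otherwise a rotated crossing. -/
theorem fourBlock_mem_of_two (hC : IsFullCategory C) (hh : halfLiberating ∈ C 3 3)
    (hc : crossing ∉ C 2 2) {s t : Multiset ℕ} {c : ℕ} (h : HasColors C (c ::ₘ c ::ₘ s) t) :
    fourBlock ∈ C 0 4 := by
  obtain ⟨c, d, h⟩ := hC.exists_hasColors_two_two hh h
  by_cases hcd : c = d
  · subst hcd
    rw [hC.fourBlock_mem_iff_hasColors hh]
    simpa using h.map (fun _ => 0) (by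
      rintro x hx y hy -
      simp only [Multiset.insert_eq_cons, Multiset.mem_cons, Multiset.mem_singleton, or_self,
        Set.mem_ofPred_eq] at hx hy
      rw [hx, hy])
  · refine absurd ?_ hc
    rw [hC.crossing_mem_iff_hasColors hh]
    simpa [Ne.symm hcd] using h.map (fun x => if x = c then 0 else 1) (by
      rintro x hx y hy hxy
      simp only [Multiset.insert_eq_cons, Multiset.mem_cons, Multiset.mem_singleton, or_self,
        Set.mem_ofPred_eq] at hx hy
      rcases hx with rfl | rfl <;> rcases hy with rfl | rfl <;> simp_all)

theorem nodup_of_fourBlock_notMem (hC : IsFullCategory C) (hh : halfLiberating ∈ C 3 3)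
    (hc : crossing ∉ C 2 2) (hf : fourBlock ∉ C 0 4) {s t : Multiset ℕ} (h : HasColors C s t) :
    s.Nodup ∧ t.Nodup := by
  have : ∀ s t, HasColors C s t → s.Nodup := by
    intro s t h
    rw [Multiset.nodup_iff_ne_cons_cons]
    rintro a s' rfl
    exact hf (hC.fourBlock_mem_of_two hh hc h)
  exact ⟨this s t h, this t s (hC.hasColors_symm h)⟩

/-- A letter that occurs only once is not affected when the other letters are contracted in pairs: a
contraction renames some `y ≠ a` to some `x ≠ a`. At the end `a` faces a single different letter. -/
theorem exists_hasColors_singletons (hC : IsFullCategory C) (hh : halfLiberating ∈ C 3 3) (n : ℕ) :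
    ∀ (s t : Multiset ℕ) (a : ℕ), s.card = n → a ∉ s → a ∉ t → HasColors C (a ::ₘ s) t →
      ∃ b, a ≠ b ∧ HasColors C {a} {b} := by
  induction n with
  | zero =>
    intro s t a hs _ hat h
    obtain rfl := Multiset.card_eq_zero.1 hs
    obtain ⟨b, rfl⟩ := Multiset.card_eq_one.1 h.card_eq.symm
    exact ⟨b, by simpa using hat, h⟩
  | succ n ih =>
    intro s t a hs has hat h
    obtain ⟨x, s, rfl⟩ := Multiset.exists_eq_cons_of_card hs
    have ht := h.card_eq
    obtain ⟨y, t, rfl⟩ := Multiset.exists_eq_cons_of_card (s := t) (n := n + 1)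
      (by simp at ht hs; lia)
    rw [Multiset.cons_swap a x] at h
    have := hC.hasColors_contract hh h
    simp only [Multiset.mem_cons, not_or] at has hat
    rw [Multiset.map_cons, if_neg hat.1] at this
    refine ih _ _ _ (by simpa using hs) ?_ ?_ this
    all_goals
      simp only [Multiset.mem_map, not_exists, not_and]
      intro z hz
      split_ifs
      · exact Ne.symm has.1
      · rintro rfl
        tauto

theorem doubleSingleton_mem_of_hasColors (hC : IsFullCategory C) (hh : halfLiberating ∈ C 3 3)
    {a b : ℕ} (hab : a ≠ b) (h : HasColors C {a} {b}) : doubleSingleton ∈ C 0 2 := by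
  rw [hC.doubleSingleton_mem_iff_hasColors hh]
  simpa [Ne.symm hab] using h.map (fun x => if x = a then 0 else 1) (by
      rintro x hx y hy hxy
      simp only [Multiset.mem_singleton, Set.mem_ofPred_eq] at hx hy
      rcases hx with rfl | rfl <;> rcases hy with rfl | rfl <;> simp_all)

theorem hasColors_singletons (hC : IsFullCategory C) (hh : halfLiberating ∈ C 3 3)
    (hd : doubleSingleton ∈ C 0 2) {a b : ℕ} (hab : a ≠ b) : HasColors C {a} {b} := by
  rw [hC.doubleSingleton_mem_iff_hasColors hh] at hd
  simpa using hd.map (fun x => if x = 0 then a else b) (by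
      rintro x hx y hy hxy
      simp only [Multiset.mem_singleton, Set.mem_ofPred_eq] at hx hy
      rcases hx with rfl | rfl <;> rcases hy with rfl | rfl <;> simp_all)

/-- A letter of `s` missing in `t` would be a singleton block and would contract to a pair of
singletons. So `s` is contained in `t`, and the sizes agree. -/
theorem eq_of_doubleSingleton_notMem (hC : IsFullCategory C) (hh : halfLiberating ∈ C 3 3)
    (hd : doubleSingleton ∉ C 0 2) {s t : Multiset ℕ} (hs : s.Nodup)
    (h : HasColors C s t) : s = t := by
  refine Multiset.eq_of_le_of_card_le ((Multiset.le_iff_subset hs).2 fun a ha => ?_)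
    h.card_eq.ge
  by_contra hat
  obtain ⟨s, rfl⟩ := Multiset.exists_cons_of_mem ha
  obtain ⟨b, hab, h1⟩ := hC.exists_hasColors_singletons hh _ _ _ _ rfl
    (Multiset.nodup_cons.1 hs).1 hat h
  exact hd (hC.doubleSingleton_mem_of_hasColors hh hab h1)

theorem hasColors_self_of_nodup (hC : IsFullCategory C) {s : Multiset ℕ} (hs : s.Nodup) :
    HasColors C s s := by
  induction s using Multiset.induction_on with
  | empty => exact hC.hasColors_zero
  | cons a s ih =>
    rw [Multiset.nodup_cons] at hs
    exact hC.hasColors_add_of_disjoint (hC.hasColors_pair a) (ih hs.2) (by simpa using hs.1)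

/-- Common letters are split off as pairs; letters of disjoint rows are split off two at a time as
pairs of singletons. -/
theorem hasColors_of_nodup (hC : IsFullCategory C) (hh : halfLiberating ∈ C 3 3)
    (hd : doubleSingleton ∈ C 0 2) (n : ℕ) : ∀ (s t : Multiset ℕ), s.card = n → t.card = n →
      s.Nodup → t.Nodup → HasColors C s t := by
  induction n with
  | zero =>
    intro s t hs ht _ _
    obtain rfl := Multiset.card_eq_zero.1 hs
    obtain rfl := Multiset.card_eq_zero.1 ht
    exact hC.hasColors_zero
  | succ n ih =>
    intro s t hs ht hs' ht'
    by_cases hdis : ∃ a, a ∈ s ∧ a ∈ t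
    · obtain ⟨a, has, hat⟩ := hdis
      obtain ⟨s, rfl⟩ := Multiset.exists_cons_of_mem has
      obtain ⟨t, rfl⟩ := Multiset.exists_cons_of_mem hat
      rw [Multiset.nodup_cons] at hs' ht'
      exact hC.hasColors_add_of_disjoint (hC.hasColors_pair a)
        (ih s t (by simpa using hs) (by simpa using ht) hs'.2 ht'.2)
        (by simpa using ⟨hs'.1, ht'.1⟩)
    · obtain ⟨a, has⟩ := Multiset.card_pos_iff_exists_mem.1 (by lia : 0 < s.card)
      obtain ⟨b, hbt⟩ := Multiset.card_pos_iff_exists_mem.1 (by lia : 0 < t.card)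
      push Not at hdis
      have hat := hdis a has
      have hbs : b ∉ s := fun h => hdis b h hbt
      obtain ⟨s, rfl⟩ := Multiset.exists_cons_of_mem has
      obtain ⟨t, rfl⟩ := Multiset.exists_cons_of_mem hbt
      rw [Multiset.nodup_cons] at hs' ht'
      simp only [Multiset.mem_cons, not_or] at hat hbs
      exact hC.hasColors_add_of_disjoint (hC.hasColors_singletons hh hd hat.1)
        (ih s t (by simpa using hs) (by simpa using ht) hs'.2 ht'.2)
        (by simp; tauto)

/-! ### Categories with the four block -/

theorem hasColors_four (hC : IsFullCategory C) (hh : halfLiberating ∈ C 3 3)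
    (hf : fourBlock ∈ C 0 4) (c : ℕ) : HasColors C {c, c} {c, c} := by
  rw [hC.fourBlock_mem_iff_hasColors hh] at hf
  simpa using hf.map (fun _ => c) (by
      rintro x hx y hy -
      simp only [Multiset.insert_eq_cons, Multiset.mem_cons, Multiset.mem_singleton, or_self,
        Set.mem_ofPred_eq] at hx hy
      rw [hx, hy])

/-- Contracting a letter with itself renames nothing, so common letters can be cancelled. -/
theorem hasColors_of_cons_cons (hC : IsFullCategory C) (hh : halfLiberating ∈ C 3 3) {a : ℕ}
    {s t : Multiset ℕ} (h : HasColors C (a ::ₘ s) (a ::ₘ t)) : HasColors C s t := by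
  have := hC.hasColors_contract hh h
  have e : (fun x => if x = a then a else x) = id := by
    funext x
    split_ifs with h
    · exact h.symm
    · rfl
  simpa [e] using this

theorem hasColors_of_add_add (hC : IsFullCategory C) (hh : halfLiberating ∈ C 3 3)
    {u s t : Multiset ℕ} (h : HasColors C (u + s) (u + t)) : HasColors C s t := by
  induction u using Multiset.induction_on with
  | empty => simpa using h
  | cons a u ih =>
    rw [Multiset.cons_add, Multiset.cons_add] at h
    exact ih (hC.hasColors_of_cons_cons hh h)

/-- Two four blocks with different letters are joined by one contraction, which uses up one point of
each. -/
theorem hasColors_six (hC : IsFullCategory C) (hh : halfLiberating ∈ C 3 3)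
    (hf : fourBlock ∈ C 0 4) (c : ℕ) : HasColors C {c, c, c} {c, c, c} := by
  have h1 := hC.hasColors_add_of_disjoint (hC.hasColors_four hh hf c)
    (hC.hasColors_four hh hf (c + 1)) (by simp)
  have h2 : HasColors C (c ::ₘ {c, c + 1, c + 1}) ((c + 1) ::ₘ {c + 1, c, c}) := by
    convert h1 using 1 <;>
    · simp only [Multiset.insert_eq_cons, ← Multiset.singleton_add]
      abel
  simpa using hC.hasColors_contract hh h2

theorem map_ite_of_notMem {s : Multiset ℕ} {a b : ℕ} (h : b ∉ s) :
    s.map (fun x => if x = b then a else x) = s := by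
  refine (Multiset.map_congr rfl fun x hx => ?_).trans (Multiset.map_id s)
  rw [if_neg (by rintro rfl; exact h hx), id]

/-- A fresh six block serves as glue. Contract `a` with one of its even points, then `b` with
another one: all blocks involved become one. Two odd copies of the merged letter replace `a` and
`b`, and one surplus copy in each colour is cancelled. -/
theorem hasColors_merge_same (hC : IsFullCategory C) (hh : halfLiberating ∈ C 3 3)
    (hf : fourBlock ∈ C 0 4) {a b : ℕ} {s t : Multiset ℕ}
    (h : HasColors C (a ::ₘ b ::ₘ s) t) :
    HasColors C ((a ::ₘ b ::ₘ s).map fun x => if x = a then b else x)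
      (t.map fun x => if x = a then b else x) := by
  obtain ⟨c, hc⟩ := exists_bound ((a ::ₘ b ::ₘ s) + t)
  have hac := hc a (by simp)
  have hbc := hc b (by simp)
  have hcs : c ∉ s := fun h => (hc c (by simp [h])).ne rfl
  have hct : c ∉ t := fun h => (hc c (by simp [h])).ne rfl
  have h1 := hC.hasColors_add_of_disjoint h (hC.hasColors_six hh hf c) (by
    intro x hx hx'
    have := hc x hx
    simp at hx'
    lia)
  have h2 : HasColors C (a ::ₘ ((b ::ₘ s) + {c, c, c})) (c ::ₘ ({c, c} + t)) := by
    convert h1 using 1 <;>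
    · simp only [Multiset.insert_eq_cons, ← Multiset.singleton_add]
      abel
  have h3 := hC.hasColors_contract hh h2
  have h4 : HasColors C (b ::ₘ (s + {a, a, a})) (a ::ₘ (a ::ₘ t)) := by
    convert h3 using 1
    · simp [hbc.ne, map_ite_of_notMem hcs, ← Multiset.singleton_add]
      abel
    · simp [map_ite_of_notMem hct]
  have h5 := hC.hasColors_contract hh h4
  refine hC.hasColors_of_cons_cons hh (a := b) ?_
  convert h5 using 1
  · by_cases hab : b = a <;>
    · simp [hab, ← Multiset.singleton_add]
      abel
  · by_cases hab : b = a <;> simp [hab]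

/-- For letters of opposite colours a four block suffices. Contracting `a` with one of its even
points yields `a, a` in the odd row and one `a` in the even row; then one odd `a` is contracted with
`b`. -/
theorem hasColors_merge_opposite (hC : IsFullCategory C) (hh : halfLiberating ∈ C 3 3)
    (hf : fourBlock ∈ C 0 4) {a b : ℕ} {s t : Multiset ℕ}
    (h : HasColors C (a ::ₘ s) (b ::ₘ t)) :
    HasColors C ((a ::ₘ s).map fun x => if x = b then a else x)
      ((b ::ₘ t).map fun x => if x = b then a else x) := by
  obtain ⟨c, hc⟩ := exists_bound ((a ::ₘ s) + (b ::ₘ t))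
  have hac := hc a (by simp)
  have hbc := hc b (by simp)
  have hcs : c ∉ s := fun h => (hc c (by simp [h])).ne rfl
  have hct : c ∉ t := fun h => (hc c (by simp [h])).ne rfl
  have h1 := hC.hasColors_add_of_disjoint h (hC.hasColors_four hh hf c) (by
    intro x hx hx'
    have := hc x hx
    simp at hx'
    lia)
  have h2 : HasColors C (a ::ₘ (s + {c, c})) (c ::ₘ ({c} + (b ::ₘ t))) := by
    convert h1 using 1 <;>
    · simp only [Multiset.insert_eq_cons, ← Multiset.singleton_add]
      abel
  have h3 := hC.hasColors_contract hh h2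
  have h4 : HasColors C (a ::ₘ (a ::ₘ s)) (b ::ₘ (a ::ₘ t)) := by
    convert h3 using 1
    · simp [map_ite_of_notMem hcs, ← Multiset.singleton_add]
      abel
    · simp [hbc.ne, map_ite_of_notMem hct, ← Multiset.singleton_add]
      abel
  have h5 := hC.hasColors_contract hh h4
  simpa using h5

/-- As long as `φ` identifies two of the letters present, these are merged, which lowers the number
of distinct letters. Once `φ` is injective on the remaining letters it is a mere renaming. -/
theorem hasColors_map (hC : IsFullCategory C) (hh : halfLiberating ∈ C 3 3)
    (hf : fourBlock ∈ C 0 4) (φ : ℕ → ℕ) (n : ℕ) : ∀ {s t : Multiset ℕ},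
    (s + t).toFinset.card = n → HasColors C s t → HasColors C (s.map φ) (t.map φ) := by
  induction n using Nat.strong_induction_on with
  | _ n ih =>
    intro s t hn h
    by_cases hφ : Set.InjOn φ {x | x ∈ s ∨ x ∈ t}
    · exact h.map φ hφ
    -- By colour symmetry one of the two identified letters may be taken at an odd position.
    have main : ∀ {s t : Multiset ℕ} {a b : ℕ}, (s + t).toFinset.card = n → a ≠ b →
        φ a = φ b → a ∈ s → (b ∈ s ∨ b ∈ t) → HasColors C s t →
        HasColors C (s.map φ) (t.map φ) := by
      intro s t a b hn hab hφab ha hb h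
      -- Replacing `c` by `d` removes the letter `c` altogether and does not change the image under
      -- `φ`.
      have step : ∀ {c d : ℕ}, c ≠ d → φ c = φ d → (c ∈ s ∨ c ∈ t) → (d ∈ s ∨ d ∈ t) →
          HasColors C (s.map fun x => if x = c then d else x)
            (t.map fun x => if x = c then d else x) → HasColors C (s.map φ) (t.map φ) := by
        intro c d hcd hφcd hc hd h
        have hlt : ((s.map fun x => if x = c then d else x) +
            (t.map fun x => if x = c then d else x)).toFinset.card < n := by
          rw [← hn]
          refine Finset.card_lt_card (Finset.ssubset_iff_of_subset ?_ |>.2 ⟨c, ?_, ?_⟩)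
          · intro x hx
            simp only [Multiset.mem_toFinset, Multiset.mem_add, Multiset.mem_map] at hx ⊢
            rcases hx with ⟨y, hy, rfl⟩ | ⟨y, hy, rfl⟩ <;> split_ifs <;> tauto
          · simpa using hc
          · simp only [Multiset.mem_toFinset, Multiset.mem_add, Multiset.mem_map]
            rintro (⟨y, hy, h⟩ | ⟨y, hy, h⟩) <;> split_ifs at h <;> first | exact hcd h.symm | tauto
        have h1 := ih _ hlt rfl h
        have e : φ ∘ (fun x => if x = c then d else x) = φ := by
          funext x
          by_cases hx : x = c <;> simp [hx, hφcd]
        rwa [Multiset.map_map, Multiset.map_map, e] at h1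
      by_cases hbs : b ∈ s
      · refine step hab hφab (Or.inl ha) hb ?_
        obtain ⟨s', rfl⟩ := Multiset.exists_cons_of_mem ha
        obtain ⟨s', rfl⟩ := Multiset.exists_cons_of_mem
          ((Multiset.mem_cons.1 hbs).resolve_left (Ne.symm hab))
        exact hC.hasColors_merge_same hh hf h
      · have hbt := hb.resolve_left hbs
        refine step hab.symm hφab.symm hb (Or.inl ha) ?_
        obtain ⟨s', rfl⟩ := Multiset.exists_cons_of_mem ha
        obtain ⟨t', rfl⟩ := Multiset.exists_cons_of_mem hbt
        exact hC.hasColors_merge_opposite hh hf h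
    simp only [Set.InjOn, not_forall] at hφ
    obtain ⟨a, ha, b, hb, hφab, hab⟩ := hφ
    rcases ha with ha | ha
    · exact main hn hab hφab ha hb h
    · exact hC.hasColors_symm (main (by rwa [add_comm]) hab hφab ha (Or.symm hb)
        (hC.hasColors_symm h))

/-- The second word is shifted to fresh letters and concatenated; undoing the shift is a relabelling
that need not be injective. -/
theorem hasColors_add (hC : IsFullCategory C) (hh : halfLiberating ∈ C 3 3)
    (hf : fourBlock ∈ C 0 4) {s t s' t' : Multiset ℕ} (h : HasColors C s t)
    (h' : HasColors C s' t') : HasColors C (s + s') (t + t') := by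
  obtain ⟨N, hN, h1⟩ := hC.hasColors_shift h h'
  have := hC.hasColors_map hh hf (fun x => if x < N then x else x - N) _ rfl h1
  have e : ∀ s : Multiset ℕ, (∀ x ∈ s, x < N) →
      s.map (fun x => if x < N then x else x - N) = s := fun s hs =>
    (Multiset.map_congr rfl fun x hx => by rw [if_pos (hs x hx), id]).trans (Multiset.map_id s)
  rw [Multiset.map_add, Multiset.map_add, e s fun x hx => hN x (Or.inl hx),
    e t fun x hx => hN x (Or.inr hx)] at this
  simpa using this

open Multiset in
-- Label `a` by `0` and all other letters by `1`. If `a` occurs `d` more times in `s` than in `t`,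
-- then, the sizes being equal, cancellation leaves `d` zeros over `d` ones. A negative difference
-- is truncated to the empty word.
theorem hasColors_replicate_count_sub (hC : IsFullCategory C) (hh : halfLiberating ∈ C 3 3)
    (hf : fourBlock ∈ C 0 4) {s t : Multiset ℕ} (h : HasColors C s t) (a : ℕ) :
    HasColors C (replicate (s.count a - t.count a) 0) (replicate (s.count a - t.count a) 1) := by
  rcases le_total (s.count a) (t.count a) with hle | hle
  · rw [Nat.sub_eq_zero_of_le hle]
    exact hC.hasColors_zero
  have e : ∀ s : Multiset ℕ, s.map (fun x => if x = a then 0 else 1) =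
      replicate (s.count a) 0 + replicate (s.card - s.count a) 1 := by
    intro s
    induction s using Multiset.induction_on with
    | empty => simp
    | cons b s ih =>
      rw [map_cons, ih, card_cons]
      have := count_le_card a s
      by_cases hb : b = a
      · subst hb
        simp [replicate_succ]
      · rw [if_neg hb, count_cons_of_ne (Ne.symm hb), Nat.succ_sub this, replicate_succ, add_cons]
  have h1 := hC.hasColors_map hh hf (fun x => if x = a then 0 else 1) _ rfl h
  rw [e, e] at h1
  have hs := count_le_card a s
  have ht := count_le_card a t
  have hst := h.card_eq
  obtain ⟨d, hd⟩ := Nat.exists_eq_add_of_le hle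
  rw [show t.card - t.count a = d + (s.card - s.count a) by lia, hd] at h1
  rw [show s.count a - t.count a = d by lia]
  refine hC.hasColors_of_add_add hh (u := replicate (t.count a) 0 +
    replicate (s.card - s.count a) 1) ?_
  rw [replicate_add, replicate_add] at h1
  convert h1 using 1
  · rw [hd]
    abel
  · rw [hd]
    abel

open Multiset in
-- Common letters are split off as pairs. When the rows are disjoint every multiplicity is a
-- multiple of `d`, so `d` copies of an odd letter and `d` copies of an even letter can be split off
-- together, as a relabelled `h_d`.
theorem hasColors_of_dvd (hC : IsFullCategory C) (hh : halfLiberating ∈ C 3 3)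
    (hf : fourBlock ∈ C 0 4) {d : ℕ} (hd : HasColors C (replicate d 0) (replicate d 1)) (n : ℕ) :
    ∀ {s t : Multiset ℕ}, s.card = n → t.card = n →
      (∀ a, d ∣ s.count a - t.count a) → (∀ a, d ∣ t.count a - s.count a) → HasColors C s t := by
  induction n using Nat.strong_induction_on with
  | _ n ih =>
    intro s t hs ht h1 h2
    rcases Nat.eq_zero_or_pos n with rfl | hn
    · obtain rfl := Multiset.card_eq_zero.1 hs
      obtain rfl := Multiset.card_eq_zero.1 ht
      exact hC.hasColors_zero
    by_cases hdis : ∃ a, a ∈ s ∧ a ∈ t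
    · obtain ⟨a, has, hat⟩ := hdis
      obtain ⟨s, rfl⟩ := Multiset.exists_cons_of_mem has
      obtain ⟨t, rfl⟩ := Multiset.exists_cons_of_mem hat
      rw [card_cons] at hs ht
      refine hC.hasColors_add hh hf (hC.hasColors_pair a)
        (ih (n - 1) (by lia) (by lia) (by lia) (fun b => ?_) (fun b => ?_))
      · have := h1 b
        rwa [count_cons, count_cons, Nat.add_sub_add_right] at this
      · have := h2 b
        rwa [count_cons, count_cons, Nat.add_sub_add_right] at this
    · push Not at hdis
      have hrem : ∀ {s t : Multiset ℕ}, s.card = n → (∀ a ∈ s, a ∉ t) →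
          (∀ a, d ∣ s.count a - t.count a) → ∃ a ∈ s, ∃ s', s = replicate d a + s' := by
        intro s t hs hdis h1
        obtain ⟨a, ha⟩ := Multiset.card_pos_iff_exists_mem.1 (hs ▸ hn)
        have := h1 a
        rw [count_eq_zero_of_notMem (hdis a ha), Nat.sub_zero] at this
        have := Nat.le_of_dvd (count_pos.2 ha) this
        obtain ⟨s', hs'⟩ := Multiset.le_iff_exists_add.1 (le_count_iff_replicate_le.1 this)
        exact ⟨a, ha, s', hs'⟩
      obtain ⟨a, ha, s, rfl⟩ := hrem hs hdis h1
      obtain ⟨b, hb, t, rfl⟩ := hrem ht (fun b hb hb' => hdis b hb' hb) h2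
      -- Zero divides only zero, so for `d = 0` disjoint rows could not be nonempty.
      rcases Nat.eq_zero_or_pos d with rfl | hdpos
      · exfalso
        have := h1 a
        rw [count_eq_zero_of_notMem (hdis a ha), Nat.sub_zero, zero_dvd_iff] at this
        exact (count_pos.2 ha).ne' this
      have hab : HasColors C (replicate d a) (replicate d b) := by
        have := hC.hasColors_map hh hf (fun x => if x = 0 then a else b) _ rfl hd
        simpa using this
      rw [card_add, card_replicate] at hs ht
      refine hC.hasColors_add hh hf hab
        (ih (n - d) (by lia) (by lia) (by lia) (fun c => ?_) (fun c => ?_))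
      · have h3 := h1 c
        have hc := hdis c
        by_cases hcs : c ∈ s
        · have hct := hc (by simp [hcs])
          rw [count_eq_zero_of_notMem hct, Nat.sub_zero, count_add, count_replicate] at h3
          simp only [mem_add, not_or] at hct
          rw [count_eq_zero_of_notMem hct.2, Nat.sub_zero]
          split_ifs at h3
          · exact (Nat.dvd_add_right (dvd_refl d)).1 h3
          · simpa using h3
        · rw [count_eq_zero_of_notMem hcs, Nat.zero_sub]
          exact dvd_zero d
      · have h3 := h2 c
        have hc := hdis c
        by_cases hct : c ∈ t
        · have hcs : c ∉ replicate d a + s := fun h => hc h (by simp [hct])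
          rw [count_eq_zero_of_notMem hcs, Nat.sub_zero, count_add, count_replicate] at h3
          simp only [mem_add, not_or] at hcs
          rw [count_eq_zero_of_notMem hcs.2, Nat.sub_zero]
          split_ifs at h3
          · exact (Nat.dvd_add_right (dvd_refl d)).1 h3
          · simpa using h3
        · rw [count_eq_zero_of_notMem hct, Nat.zero_sub]
          exact dvd_zero d

end IsFullCategory

/-! ### Parity and the classification -/

namespace IsFullCategory

variable {C : PartitionFamily}

/-- A word of odd length contracts to one singleton. With singletons both letters `2` can be removed
from `0 1 2 0 1 2`, and the crossing `0 1 0 1` remains. -/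
theorem even_length (hC : IsFullCategory C) (hh : halfLiberating ∈ C 3 3) (hc : crossing ∉ C 2 2)
    {L : List ℕ} (hL : HasWord C [] L) : Even L.length := by
  have single : ∀ n (L : List ℕ), L.length = n → Odd n → HasWord C [] L → HasWord C [] [3] := by
    intro n
    induction n using Nat.strong_induction_on with
    | _ n ih =>
      intro L hn hodd hL
      match L with
      | [] => subst hn; simp at hodd
      | [a] => simpa using hL.map (fun _ => 3) (by
          rintro x hx y hy -
          simp at hx hy
          rw [hx, hy])
      | a :: b :: L =>
        subst hn
        have := hC.hasWord_contract [] L a b hL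
        refine ih L.length (by simp) _ (by simp) ?_ this
        simpa [parity_simps] using hodd
  by_contra hodd
  -- The label `3` is disjoint from the letters of the half-liberating word.
  have h3 := single _ L rfl (Nat.not_even_iff_odd.1 hodd) hL
  have h0 := hC.halfLiberating_mem_iff.1 hh
  have h1 := hC.hasWord_contract [0, 1, 2, 0, 1] [] 2 3
    (by simpa using hC.hasWord_append h0 h3 (by simp))
  have h2 := hC.hasWord_rotate [0, 1] [2, 0, 1] (by simpa using h1)
  have h4 := hC.hasWord_rotate [2] [0, 1, 0, 1] (by simpa using h2)
  have h5 := hC.hasWord_contract [0, 1, 0, 1] [] 2 3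
    (by simpa using hC.hasWord_append h4 h3 (by simp))
  exact hc (hC.crossing_mem_iff.2 (by simpa using h5))

theorem exists_hasColors_of_hasWord (hC : IsFullCategory C) (hh : halfLiberating ∈ C 3 3)
    (hc : crossing ∉ C 2 2) {L : List ℕ} (hL : HasWord C [] L) :
    ∃ A B : List ℕ, L = interleave A B ∧ HasColors C A B := by
  obtain ⟨A, B, h, rfl⟩ := exists_eq_interleave (hC.even_length hh hc hL)
  exact ⟨A, B, rfl, A, B, h, rfl, rfl, hL⟩

theorem subset_of_hasColors {D : PartitionFamily} (hC : IsFullCategory C)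
    (hD : IsFullCategory D) (hh : halfLiberating ∈ C 3 3) (hhD : halfLiberating ∈ D 3 3)
    (hc : crossing ∉ C 2 2) (h : ∀ s t, HasColors C s t → HasColors D s t) (k l : ℕ) :
    C k l ⊆ D k l := by
  refine le_of_hasWord (fun U V hw => ?_) k l
  rw [hC.hasWord_iff_nil] at hw
  rw [hD.hasWord_iff_nil]
  obtain ⟨A, B, e, hAB⟩ := hC.exists_hasColors_of_hasWord hh hc hw
  rw [e]
  exact hD.hasColors_coe hhD (h _ _ hAB)

theorem eq_generatedCategory (hC : IsFullCategory C) (hh : halfLiberating ∈ C 3 3)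
    (hc : crossing ∉ C 2 2) {S : Set (Σ k : ℕ, Σ l : ℕ, TwoRowPartition k l)}
    (hS : ∀ g ∈ S, g.2.2 ∈ C g.1 g.2.1) (hhS : ⟨3, 3, halfLiberating⟩ ∈ S)
    (h : ∀ s t, HasColors C s t → HasColors (generatedCategory S) s t) :
    C = generatedCategory S := by
  funext k l
  exact Set.Subset.antisymm
    (hC.subset_of_hasColors (isFullCategory_generatedCategory S) hh (mem_generatedCategory hhS)
      hc h k l)
    (generatedCategory_subset hC hS k l)

end IsFullCategory

/-- The least positive element can be subtracted from every positive element until zero is reached.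
If no positive element exists, `d = 0` serves. -/
theorem Nat.exists_forall_dvd_of_sub_mem {E : Set ℕ} (h0 : 0 ∈ E)
    (hE : ∀ a ∈ E, ∀ b ∈ E, a - b ∈ E) : ∃ d ∈ E, ∀ a ∈ E, d ∣ a := by
  classical
  by_cases h : ∃ d, d ∈ E ∧ 0 < d
  · refine ⟨Nat.find h, (Nat.find_spec h).1, fun a => ?_⟩
    induction a using Nat.strong_induction_on with
    | _ a ih =>
      intro ha
      rcases Nat.eq_zero_or_pos a with rfl | hpos
      · exact dvd_zero _
      · have hle : Nat.find h ≤ a := Nat.find_min' h ⟨ha, hpos⟩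
        have hp := (Nat.find_spec h).2
        have := ih (a - Nat.find h) (by lia) (hE a ha _ (Nat.find_spec h).1)
        exact (Nat.dvd_sub_iff_left hle (dvd_refl _)).1 this
  · push Not at h
    exact ⟨0, h0, fun a ha => by rw [Nat.le_zero.1 (h a ha)]⟩

/-- The classification of the full categories that contain the half-liberating partition but not
the crossing partition. -/
theorem IsFullCategory.classification {C : PartitionFamily} (hC : IsFullCategory C)
    (hh : halfLiberating ∈ C 3 3) (hc : crossing ∉ C 2 2) :
    (fourBlock ∉ C 0 4 ∧ C = generatedCategory {⟨3, 3, halfLiberating⟩}) ∨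
    (fourBlock ∉ C 0 4 ∧
      C = generatedCategory {⟨3, 3, halfLiberating⟩, ⟨0, 2, doubleSingleton⟩}) ∨
    C = generatedCategory {⟨3, 3, halfLiberating⟩, ⟨0, 4, fourBlock⟩} ∨
    ∃ s : ℕ, 3 ≤ s ∧ C = generatedCategory
      {⟨3, 3, halfLiberating⟩, ⟨0, 4, fourBlock⟩, ⟨0, 2 * s, hPartition s⟩} := by
  by_cases hf : fourBlock ∈ C 0 4
  · right; right
    -- The set of all `d` with `h_d` in the category is closed under truncated subtraction: add to
    -- `h_a` the partition `h_b` with its colours exchanged and compare the multiplicities of `0`.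
    obtain ⟨d, hdE, hd⟩ := Nat.exists_forall_dvd_of_sub_mem
      (E := {d | HasColors C (Multiset.replicate d 0) (Multiset.replicate d 1)})
      hC.hasColors_zero (by
        intro a ha b hb
        have := hC.hasColors_replicate_count_sub hh hf
          (hC.hasColors_add hh hf ha (hC.hasColors_symm hb)) 0
        simpa [Multiset.count_replicate] using this)
    have hdvd : ∀ s t, HasColors C s t → ∀ a, d ∣ s.count a - t.count a := fun s t h a =>
      hd _ (hC.hasColors_replicate_count_sub hh hf h a)
    have main : ∀ D, IsFullCategory D → halfLiberating ∈ D 3 3 → fourBlock ∈ D 0 4 →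
        HasColors D (Multiset.replicate d 0) (Multiset.replicate d 1) →
        ∀ s t, HasColors C s t → HasColors D s t := fun D hD hhD hfD hdD s t h =>
      hD.hasColors_of_dvd hhD hfD hdD _ rfl h.card_eq.symm (hdvd s t h)
        (hdvd t s (hC.hasColors_symm h))
    have hcross : d = 2 → False := by
      rintro rfl
      exact hc ((hC.crossing_mem_iff_hasColors hh).2 hdE)
    rcases Nat.eq_zero_or_pos d with rfl | hpos
    · left
      refine hC.eq_generatedCategory hh hc (by simp [hh, hf]) (by simp) (main _
        (isFullCategory_generatedCategory _) (mem_generatedCategory (by simp))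
        (mem_generatedCategory (by simp))
        (isFullCategory_generatedCategory _).hasColors_zero)
    · right
      refine ⟨d, ?_, ?_⟩
      · by_contra hlt
        -- Up to rotation `h_2` is the crossing, and adding `h_1` to itself gives `h_2`.
        obtain rfl | h2 : d = 1 ∨ d = 2 := by lia
        · exact hc ((hC.crossing_mem_iff_hasColors hh).2 (hC.hasColors_add hh hf hdE hdE))
        · exact hcross h2
      · have hhp := (hC.hPartition_mem_iff_hasColors hh d).2 hdE
        have hg : halfLiberating ∈ generatedCategory
            {⟨3, 3, halfLiberating⟩, ⟨0, 4, fourBlock⟩, ⟨0, 2 * d, hPartition d⟩} 3 3 :=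
          mem_generatedCategory (by simp)
        refine hC.eq_generatedCategory hh hc (by simp [hh, hf, hhp]) (by simp) (main _
          (isFullCategory_generatedCategory _) hg (mem_generatedCategory (by simp)) ?_)
        rw [← (isFullCategory_generatedCategory _).hPartition_mem_iff_hasColors hg]
        exact mem_generatedCategory (by simp)
  · by_cases hd : doubleSingleton ∈ C 0 2
    · right; left
      refine ⟨hf, hC.eq_generatedCategory hh hc (by simp [hh, hd]) (by simp) fun s t h => ?_⟩
      have := hC.nodup_of_fourBlock_notMem hh hc hf h
      exact (isFullCategory_generatedCategory _).hasColors_of_nodup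
        (mem_generatedCategory (by simp)) (mem_generatedCategory (by simp)) _ _ _ rfl
        h.card_eq.symm this.1 this.2
    · left
      refine ⟨hf, hC.eq_generatedCategory hh hc (by simp [hh]) (by simp) fun s t h => ?_⟩
      have hs := (hC.nodup_of_fourBlock_notMem hh hc hf h).1
      obtain rfl := hC.eq_of_doubleSingleton_notMem hh hd hs h
      exact (isFullCategory_generatedCategory _).hasColors_self_of_nodup hs

/-! ### The linear maps of partitions -/

section partitionMap

variable {n k l m k' l' : ℕ}

open Classical in
theorem partitionMap_apply (p : TwoRowPartition k l) (j : Fin l → Fin n) (i : Fin k → Fin n) :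
    partitionMap n p j i = if p ≤ Setoid.ker (Sum.elim i j) then 1 else 0 :=
  if_congr ⟨fun h x y => h x y, fun h x y => @h x y⟩ rfl rfl

theorem partitionMap_eq_of_iff {p : TwoRowPartition k l} {q : TwoRowPartition k' l'}
    {j : Fin l → Fin n} {i : Fin k → Fin n} {j' : Fin l' → Fin n} {i' : Fin k' → Fin n}
    (h : p ≤ Setoid.ker (Sum.elim i j) ↔ q ≤ Setoid.ker (Sum.elim i' j')) :
    partitionMap n p j i = partitionMap n q j' i' := by
  classical
  rw [partitionMap_apply, partitionMap_apply]
  exact if_congr h rfl rfl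

theorem star_partitionMap (p : TwoRowPartition k l) (j : Fin l → Fin n) (i : Fin k → Fin n) :
    star (partitionMap n p j i) = partitionMap n p j i := by
  classical
  rw [partitionMap_apply]
  split_ifs <;> simp

/-- Bijective relabelling of the points of a partition. -/
theorem comap_le_ker_iff {α β γ : Type*} (p : Setoid β) (e : α ≃ β) (f : α → γ) (g : β → γ)
    (h : ∀ x, f x = g (e x)) : Setoid.comap e p ≤ Setoid.ker f ↔ p ≤ Setoid.ker g := by
  constructor
  · intro H x y hxy
    have := @H (e.symm x) (e.symm y) (by simpa [Setoid.comap_rel] using hxy)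
    rw [Setoid.ker_def, h, h] at this
    simpa using this
  · intro H x y hxy
    have := H hxy
    rw [Setoid.ker_def, h, h]
    exact this

theorem partitionMap_involution (p : TwoRowPartition k l) (j : Fin k → Fin n)
    (i : Fin l → Fin n) : partitionMap n (involution p) j i = partitionMap n p i j :=
  partitionMap_eq_of_iff (comap_le_ker_iff p (Equiv.sumComm _ _) _ _ (by rintro (x | x) <;> rfl))

theorem partitionMap_rotate_aux {p : TwoRowPartition k l}
    {j : Fin l → Fin n} {i : Fin k → Fin n} {j' : Fin l' → Fin n} {i' : Fin k' → Fin n}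
    (e : Fin k' ⊕ Fin l' → Fin k ⊕ Fin l) (e' : Fin k ⊕ Fin l → Fin k' ⊕ Fin l')
    (he : ∀ x, e (e' x) = x) (he' : ∀ x, e' (e x) = x)
    (h : ∀ x, Sum.elim i' j' x = Sum.elim i j (e x)) :
    partitionMap n (Setoid.comap e p) j' i' = partitionMap n p j i :=
  partitionMap_eq_of_iff (comap_le_ker_iff p ⟨e, e', he', he⟩ _ _ h)

theorem partitionMap_rotateLeftDown (p : TwoRowPartition (k + 1) l) (a : Fin n)
    (j : Fin l → Fin n) (i : Fin k → Fin n) :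
    partitionMap n (rotateLeftDown p) (Fin.cons a j) i = partitionMap n p j (Fin.cons a i) := by
  refine partitionMap_rotate_aux _
    (Sum.elim (Fin.cases (Sum.inr 0) Sum.inl) (fun j => Sum.inr j.succ)) ?_ ?_ ?_ <;>
  · rintro (x | x)
    all_goals try induction x using Fin.cases
    all_goals rfl

theorem partitionMap_rotateLeftUp (p : TwoRowPartition k (l + 1)) (a : Fin n)
    (j : Fin l → Fin n) (i : Fin k → Fin n) :
    partitionMap n (rotateLeftUp p) j (Fin.cons a i) = partitionMap n p (Fin.cons a j) i := by
  refine partitionMap_rotate_aux _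
    (Sum.elim (fun i => Sum.inl i.succ) (Fin.cases (Sum.inl 0) Sum.inr)) ?_ ?_ ?_ <;>
  · rintro (x | x)
    all_goals try induction x using Fin.cases
    all_goals rfl

theorem partitionMap_rotateRightDown (p : TwoRowPartition (k + 1) l) (a : Fin n)
    (j : Fin l → Fin n) (i : Fin k → Fin n) :
    partitionMap n (rotateRightDown p) (Fin.snoc (α := fun _ => Fin n) j a) i =
      partitionMap n p j (Fin.snoc (α := fun _ => Fin n) i a) := by
  refine partitionMap_rotate_aux _
    (Sum.elim (Fin.lastCases (Sum.inr (Fin.last _)) Sum.inl) (fun j => Sum.inr j.castSucc))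
      ?_ ?_ ?_ <;>
  · rintro (x | x)
    all_goals try induction x using Fin.lastCases
    all_goals simp

theorem partitionMap_rotateRightUp (p : TwoRowPartition k (l + 1)) (a : Fin n)
    (j : Fin l → Fin n) (i : Fin k → Fin n) :
    partitionMap n (rotateRightUp p) j (Fin.snoc (α := fun _ => Fin n) i a) =
      partitionMap n p (Fin.snoc (α := fun _ => Fin n) j a) i := by
  refine partitionMap_rotate_aux _
    (Sum.elim (fun i => Sum.inl i.castSucc) (Fin.lastCases (Sum.inl (Fin.last _)) Sum.inr))
      ?_ ?_ ?_ <;>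
  · rintro (x | x)
    all_goals try induction x using Fin.lastCases
    all_goals simp

theorem partitionMap_tensor (p : TwoRowPartition k l) (q : TwoRowPartition k' l')
    (j : Fin l → Fin n) (j' : Fin l' → Fin n) (i : Fin k → Fin n) (i' : Fin k' → Fin n) :
    partitionMap n (tensor p q) (Fin.append j j') (Fin.append i i') =
      partitionMap n p j i * partitionMap n q j' i' := by
  classical
  have e : ∀ x, Sum.elim (Fin.append i i') (Fin.append j j') x =
      Sum.elim (Sum.elim i j) (Sum.elim i' j') (splitPoints k l k' l' x) := by
    rintro (x | x) <;> induction x using Fin.addCases <;> simp [splitPoints]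
  have key : tensor p q ≤ Setoid.ker (Sum.elim (Fin.append i i') (Fin.append j j')) ↔
      p ≤ Setoid.ker (Sum.elim i j) ∧ q ≤ Setoid.ker (Sum.elim i' j') := by
    constructor
    · intro H
      have H' : ∀ a b, Sum.LiftRel (fun a b => p a b) (fun a b => q a b) a b →
          Sum.elim (Sum.elim i j) (Sum.elim i' j') a =
            Sum.elim (Sum.elim i j) (Sum.elim i' j') b := by
        intro a b hab
        have := @H ((splitPoints k l k' l').symm a) ((splitPoints k l k' l').symm b) (by
          change Sum.LiftRel _ _ (splitPoints k l k' l' _) (splitPoints k l k' l' _)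
          simpa using hab)
        rw [Setoid.ker_def, e, e] at this
        simpa using this
      exact ⟨fun x y h => H' _ _ (Sum.LiftRel.inl h), fun x y h => H' _ _ (Sum.LiftRel.inr h)⟩
    · rintro ⟨h1, h2⟩ x y hxy
      rw [Setoid.ker_def, e, e]
      change Sum.LiftRel _ _ (splitPoints k l k' l' x) (splitPoints k l k' l' y) at hxy
      generalize splitPoints k l k' l' x = a at hxy ⊢
      generalize splitPoints k l k' l' y = b at hxy ⊢
      cases hxy with
      | inl h => exact h1 h
      | inr h => exact h2 h
  rw [partitionMap_apply, partitionMap_apply, partitionMap_apply, if_congr key rfl rfl]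
  split_ifs <;> simp_all

theorem partitionMap_unit : partitionMap n unit = 1 := by
  classical
  ext j i
  rw [partitionMap_apply, Matrix.one_apply]
  refine if_congr ?_ rfl rfl
  constructor
  · intro h
    funext x
    obtain rfl := Subsingleton.elim x 0
    exact (@h (Sum.inl 0) (Sum.inr 0) trivial).symm
  · rintro rfl x y _
    rcases x with x | x <;> rcases y with y | y <;>
    · obtain rfl := Subsingleton.elim x y
      rfl

open Classical in
-- Both sides count labellings of the stack of `p` and `q` that are constant on components and
-- prescribed on the outer points. Components meeting an outer point are determined, if the
-- prescription is consistent at all; every other component is free. So `c` is the number of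
-- labellings of the inner components, and it can vanish only for `n = 0`.
theorem sum_partitionMap_mul (p : TwoRowPartition k l) (q : TwoRowPartition l m) :
    ∃ c : ℕ, (1 ≤ n → c ≠ 0) ∧ ∀ (j : Fin m → Fin n) (i : Fin k → Fin n),
      ∑ t, partitionMap n q j t * partitionMap n p t i = c * partitionMap n (compose p q) j i := by
  let s : Setoid (Fin k ⊕ (Fin l ⊕ Fin m)) := Relation.EqvGen.setoid (StackStep p q)
  -- The components of the stack that contain an outer point.
  let O : Quotient s → Prop := fun x => ∃ a : Fin k ⊕ Fin m,
    Quotient.mk s (Sum.map id Sum.inr a) = x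
  refine ⟨Fintype.card ({x // ¬ O x} → Fin n), ?_, fun j i => ?_⟩
  · intro hn
    have : Nonempty (Fin n) := ⟨⟨0, hn⟩⟩
    exact Fintype.card_ne_zero
  have split : ∀ t : Fin l → Fin n, s ≤ Setoid.ker (Sum.elim i (Sum.elim t j)) ↔
      q ≤ Setoid.ker (Sum.elim t j) ∧ p ≤ Setoid.ker (Sum.elim i t) := by
    intro t
    have e1 : ∀ a : Fin k ⊕ Fin l,
        Sum.elim i (Sum.elim t j) (Sum.map id Sum.inl a) = Sum.elim i t a := by
      rintro (a | a) <;> rfl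
    constructor
    · intro H
      refine ⟨fun a b h => ?_, fun a b h => ?_⟩
      · exact @H (Sum.inr a) (Sum.inr b) (.rel _ _ (.bottom a b h))
      · have := @H (Sum.map id Sum.inl a) (Sum.map id Sum.inl b) (.rel _ _ (.top a b h))
        rwa [Setoid.ker_def, e1, e1] at this
    · rintro ⟨h1, h2⟩ a b hab
      induction hab with
      | rel a b h =>
        cases h with
        | top a b h =>
          rw [Setoid.ker_def, e1, e1]
          exact h2 h
        | bottom a b h => exact h1 h
      | refl a => rfl
      | symm a b _ ih => exact ih.symm
      | trans a b c _ _ ih ih' => exact ih.trans ih'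
  have e2 : ∀ (t : Fin l → Fin n) (a : Fin k ⊕ Fin m),
      Sum.elim i (Sum.elim t j) (Sum.map id Sum.inr a) = Sum.elim i j a := by
    rintro t (a | a) <;> rfl
  have lhs : ∑ t, partitionMap n q j t * partitionMap n p t i =
      (Fintype.card {t : Fin l → Fin n // s ≤ Setoid.ker (Sum.elim i (Sum.elim t j))} : ℂ) := by
    rw [Fintype.card_subtype, Finset.card_filter, Nat.cast_sum]
    refine Finset.sum_congr rfl fun t _ => ?_
    rw [partitionMap_apply, partitionMap_apply, if_congr (split t) rfl rfl]
    split_ifs <;> simp_all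
  rw [lhs, partitionMap_apply]
  split_ifs with h
  · rw [mul_one]
    congr 1
    have hx : ∀ x : {x // O x}, ∃ a : Fin k ⊕ Fin m, Quotient.mk s (Sum.map id Sum.inr a) = x :=
      fun x => x.2
    choose r hr using hx
    let x₀ : {x // O x} → Fin n := fun x => Sum.elim i j (r x)
    -- Compatible labellings of the middle points are functions on the components with given values
    -- `x₀` on those in `O`, hence arbitrary functions on the others.
    refine Fintype.card_congr (Equiv.trans ?_ (Equiv.subtypePreimage O x₀))
    have hx0 : ∀ a : Fin k ⊕ Fin m, ∀ ha, x₀ ⟨Quotient.mk s (Sum.map id Sum.inr a), ha⟩ =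
        Sum.elim i j a := fun a ha => by
      have : compose p q (r ⟨_, ha⟩) a := Quotient.exact (s := s) (hr ⟨_, ha⟩)
      exact h this
    refine ⟨fun t => ⟨Quotient.lift (Sum.elim i (Sum.elim t.1 j)) fun a b hab => t.2 hab, ?_⟩,
      fun f => ⟨fun a => f.1 (Quotient.mk s (Sum.inr (Sum.inl a))), ?_⟩, ?_, ?_⟩
    · funext x
      rw [Function.comp_apply, ← hr x, Quotient.lift_mk, e2]
    · have : Sum.elim i (Sum.elim (fun a => f.1 (Quotient.mk s (Sum.inr (Sum.inl a)))) j) =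
          fun x => f.1 (Quotient.mk s x) := by
        have hf : ∀ a : Fin k ⊕ Fin m,
            f.1 (Quotient.mk s (Sum.map id Sum.inr a)) = Sum.elim i j a := fun a => by
          rw [← hx0 a ⟨a, rfl⟩]
          exact congrFun f.2 ⟨_, a, rfl⟩
        funext x
        rcases x with x | x | x
        · exact (hf (Sum.inl x)).symm
        · rfl
        · exact (hf (Sum.inr x)).symm
      rw [this]
      intro x y hxy
      rw [Setoid.ker_def]
      exact congrArg f.1 (Quotient.sound hxy)
    · intro t
      rfl
    · intro f
      apply Subtype.ext
      funext x
      have hf : ∀ a : Fin k ⊕ Fin m,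
          f.1 (Quotient.mk s (Sum.map id Sum.inr a)) = Sum.elim i j a := fun a => by
        rw [← hx0 a ⟨a, rfl⟩]
        exact congrFun f.2 ⟨_, a, rfl⟩
      induction x using Quotient.inductionOn with | _ x
      rcases x with x | x | x
      · exact (hf (Sum.inl x)).symm
      · rfl
      · exact (hf (Sum.inr x)).symm
  · rw [mul_zero, Nat.cast_eq_zero, Fintype.card_eq_zero_iff]
    refine ⟨fun ⟨t, ht⟩ => h fun a b hab => ?_⟩
    have := ht hab
    rwa [Setoid.ker_def, e2, e2] at this

end partitionMap

/-! ### Multi-indices and tensor powers of a matrix -/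

section sums

variable {n k k' : ℕ} {M : Type*} [AddCommMonoid M]

theorem sum_cons (F : (Fin (k + 1) → Fin n) → M) :
    ∑ f, F f = ∑ a, ∑ i : Fin k → Fin n, F (Fin.cons a i) := by
  rw [← (Fin.consEquiv fun _ : Fin (k + 1) => Fin n).sum_comp, Fintype.sum_prod_type]
  rfl

theorem sum_snoc (F : (Fin (k + 1) → Fin n) → M) :
    ∑ f, F f = ∑ i : Fin k → Fin n, ∑ a, F (Fin.snoc (α := fun _ => Fin n) i a) := by
  rw [← (Fin.snocEquiv fun _ : Fin (k + 1) => Fin n).sum_comp, Fintype.sum_prod_type,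
    Finset.sum_comm]
  rfl

theorem sum_append (F : (Fin (k + k') → Fin n) → M) :
    ∑ f, F f = ∑ i : Fin k → Fin n, ∑ i' : Fin k' → Fin n, F (Fin.append i i') := by
  rw [← (Fin.appendEquiv k k').sum_comp, Fintype.sum_prod_type]
  rfl

end sums

section decompositions

variable {n k k' : ℕ}

theorem exists_eq_append (f : Fin (k + k') → Fin n) :
    ∃ (i : Fin k → Fin n) (i' : Fin k' → Fin n), f = Fin.append i i' :=
  ⟨_, _, (Fin.append_castAdd_natAdd (f := f)).symm⟩

theorem exists_eq_cons (f : Fin (k + 1) → Fin n) :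
    ∃ (a : Fin n) (i : Fin k → Fin n), f = Fin.cons a i :=
  ⟨_, _, (Fin.cons_self_tail f).symm⟩

theorem exists_eq_snoc (f : Fin (k + 1) → Fin n) :
    ∃ (i : Fin k → Fin n) (a : Fin n), f = Fin.snoc (α := fun _ => Fin n) i a :=
  ⟨_, _, (Fin.snoc_init_self f).symm⟩

end decompositions

section tensorPower

variable {A : Type*} [Monoid A] {n k k' : ℕ}

theorem matrixTensorPower_apply (M : Matrix (Fin n) (Fin n) A) (i j : Fin k → Fin n) :
    matrixTensorPower M k i j = (List.ofFn fun t => M (i t) (j t)).prod := rfl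

theorem matrixTensorPower_zero (M : Matrix (Fin n) (Fin n) A) (i j : Fin 0 → Fin n) :
    matrixTensorPower M 0 i j = 1 := by
  simp [matrixTensorPower_apply]

theorem matrixTensorPower_one (M : Matrix (Fin n) (Fin n) A) (i j : Fin 1 → Fin n) :
    matrixTensorPower M 1 i j = M (i 0) (j 0) := by
  simp [matrixTensorPower_apply]

theorem matrixTensorPower_cons (M : Matrix (Fin n) (Fin n) A) (a b : Fin n) (i j : Fin k → Fin n) :
    matrixTensorPower M (k + 1) (Fin.cons a i) (Fin.cons b j) =
      M a b * matrixTensorPower M k i j := by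
  simp [matrixTensorPower_apply, List.ofFn_succ]

theorem matrixTensorPower_snoc (M : Matrix (Fin n) (Fin n) A) (a b : Fin n) (i j : Fin k → Fin n) :
    matrixTensorPower M (k + 1) (Fin.snoc (α := fun _ => Fin n) i a)
      (Fin.snoc (α := fun _ => Fin n) j b) = matrixTensorPower M k i j * M a b := by
  rw [matrixTensorPower_apply, List.ofFn_succ', List.concat_eq_append, List.prod_append]
  simp [matrixTensorPower_apply]

theorem matrixTensorPower_append (M : Matrix (Fin n) (Fin n) A) (i j : Fin k → Fin n)
    (i' j' : Fin k' → Fin n) :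
    matrixTensorPower M (k + k') (Fin.append i i') (Fin.append j j') =
      matrixTensorPower M k i j * matrixTensorPower M k' i' j' := by
  simp [matrixTensorPower_apply, List.ofFn_add]

theorem map_matrixTensorPower {B F : Type*} [Monoid B] [FunLike F A B] [MonoidHomClass F A B]
    (φ : F) (M : Matrix (Fin n) (Fin n) A) (i j : Fin k → Fin n) :
    φ (matrixTensorPower M k i j) = matrixTensorPower (M.map φ) k i j := by
  rw [matrixTensorPower_apply, matrixTensorPower_apply, map_list_prod, List.map_ofFn]
  rfl

theorem matrixTensorPower_id {A : Type*} [Semiring A] (i j : Fin k → Fin n) :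
    matrixTensorPower (1 : Matrix (Fin n) (Fin n) A) k i j = if i = j then 1 else 0 := by
  induction k with
  | zero => simp [matrixTensorPower_zero, Subsingleton.elim i j]
  | succ k ih =>
    obtain ⟨a, i, rfl⟩ := exists_eq_cons i
    obtain ⟨b, j, rfl⟩ := exists_eq_cons j
    rw [matrixTensorPower_cons, ih, Matrix.one_apply]
    simp only [Fin.cons_inj]
    split_ifs <;> simp_all

end tensorPower

/-! ### Partitions that give intertwiners form a full category -/

section IsIntertwiner

variable {A : Type*} [Ring A] [Algebra ℂ A] {n k l m k' l' : ℕ}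

/-- `T M^{⊗k} = M^{⊗l} T`. -/
def IsIntertwiner (M : Matrix (Fin n) (Fin n) A) (T : Matrix (Fin l → Fin n) (Fin k → Fin n) ℂ) :
    Prop :=
  ∀ j i, ∑ a, T j a • matrixTensorPower M k a i = ∑ b, T b i • matrixTensorPower M l j b

theorem map_algebraMap_mul_apply (M : Matrix (Fin n) (Fin n) A)
    (T : Matrix (Fin l → Fin n) (Fin k → Fin n) ℂ) (j : Fin l → Fin n) (i : Fin k → Fin n) :
    (T.map (algebraMap ℂ A) * matrixTensorPower M k) j i =
      ∑ a, T j a • matrixTensorPower M k a i := by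
  simp [Matrix.mul_apply, Algebra.smul_def]

theorem mul_map_algebraMap_apply (M : Matrix (Fin n) (Fin n) A)
    (T : Matrix (Fin l → Fin n) (Fin k → Fin n) ℂ) (j : Fin l → Fin n) (i : Fin k → Fin n) :
    (matrixTensorPower M l * T.map (algebraMap ℂ A)) j i =
      ∑ b, T b i • matrixTensorPower M l j b := by
  simp [Matrix.mul_apply, Algebra.smul_def, Algebra.commutes]

theorem MatrixStarAlgebra.mem_intertwiners_iff (G : MatrixStarAlgebra.{u} n)
    (T : Matrix (Fin l → Fin n) (Fin k → Fin n) ℂ) :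
    T ∈ G.intertwiners k l ↔ IsIntertwiner G.u T := by
  change _ * _ = _ * _ ↔ _
  rw [← Matrix.ext_iff]
  exact forall_congr' fun j => forall_congr' fun i => by
    rw [map_algebraMap_mul_apply, mul_map_algebraMap_apply]

variable {M : Matrix (Fin n) (Fin n) A}

theorem IsIntertwiner.add {T S : Matrix (Fin l → Fin n) (Fin k → Fin n) ℂ}
    (hT : IsIntertwiner M T) (hS : IsIntertwiner M S) : IsIntertwiner M (T + S) := by
  intro j i
  simp [add_smul, Finset.sum_add_distrib, hT j i, hS j i]

theorem IsIntertwiner.smul {T : Matrix (Fin l → Fin n) (Fin k → Fin n) ℂ}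
    (hT : IsIntertwiner M T) (c : ℂ) : IsIntertwiner M (c • T) := by
  intro j i
  simp [mul_smul, ← Finset.smul_sum, hT j i]

theorem IsIntertwiner.zero : IsIntertwiner M (0 : Matrix (Fin l → Fin n) (Fin k → Fin n) ℂ) := by
  intro j i
  simp

theorem IsIntertwiner.comp {T : Matrix (Fin l → Fin n) (Fin k → Fin n) ℂ}
    {S : Matrix (Fin m → Fin n) (Fin l → Fin n) ℂ} (hS : IsIntertwiner M S)
    (hT : IsIntertwiner M T) : IsIntertwiner M (S * T) := by
  intro j i
  simp only [Matrix.mul_apply, Finset.sum_smul]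
  rw [Finset.sum_comm]
  simp only [mul_smul, ← Finset.smul_sum, hT _ i]
  simp only [Finset.smul_sum]
  rw [Finset.sum_comm]
  simp only [smul_comm (S j _), ← Finset.smul_sum, hS j]
  simp only [Finset.smul_sum]
  rw [Finset.sum_comm]
  exact Finset.sum_congr rfl fun b _ => Finset.sum_congr rfl fun c _ => smul_comm _ _ _

theorem sum_tensor_left (M : Matrix (Fin n) (Fin n) A) (p : TwoRowPartition k l)
    (q : TwoRowPartition k' l') (j : Fin l → Fin n) (j' : Fin l' → Fin n) (i : Fin k → Fin n)
    (i' : Fin k' → Fin n) :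
    ∑ a, partitionMap n (tensor p q) (Fin.append j j') a •
        matrixTensorPower M (k + k') a (Fin.append i i') =
      (∑ a, partitionMap n p j a • matrixTensorPower M k a i) *
        ∑ a, partitionMap n q j' a • matrixTensorPower M k' a i' := by
  rw [sum_append, Finset.sum_mul_sum]
  refine Finset.sum_congr rfl fun a _ => Finset.sum_congr rfl fun a' _ => ?_
  rw [partitionMap_tensor, matrixTensorPower_append, smul_mul_smul_comm]

theorem sum_tensor_right (M : Matrix (Fin n) (Fin n) A) (p : TwoRowPartition k l)
    (q : TwoRowPartition k' l') (j : Fin l → Fin n) (j' : Fin l' → Fin n) (i : Fin k → Fin n)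
    (i' : Fin k' → Fin n) :
    ∑ b, partitionMap n (tensor p q) b (Fin.append i i') •
        matrixTensorPower M (l + l') (Fin.append j j') b =
      (∑ b, partitionMap n p b i • matrixTensorPower M l j b) *
        ∑ b, partitionMap n q b i' • matrixTensorPower M l' j' b := by
  rw [sum_append, Finset.sum_mul_sum]
  refine Finset.sum_congr rfl fun a _ => Finset.sum_congr rfl fun a' _ => ?_
  rw [partitionMap_tensor, matrixTensorPower_append, smul_mul_smul_comm]

theorem IsIntertwiner.tensor {p : TwoRowPartition k l} {q : TwoRowPartition k' l'}
    (hp : IsIntertwiner M (partitionMap n p)) (hq : IsIntertwiner M (partitionMap n q)) :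
    IsIntertwiner M (partitionMap n (TwoRowPartition.tensor p q)) := by
  intro f g
  obtain ⟨j, j', rfl⟩ := exists_eq_append f
  obtain ⟨i, i', rfl⟩ := exists_eq_append g
  rw [sum_tensor_left, sum_tensor_right, hp, hq]

theorem isIntertwiner_unit : IsIntertwiner M (partitionMap n unit) := by
  intro j i
  simp [partitionMap_unit, Matrix.one_apply]

/-- The product of the two maps is a multiple of the map of the composition, and `n ≥ 1` allows
division by the factor. -/
theorem IsIntertwiner.compose (hn : 1 ≤ n) {p : TwoRowPartition k l} {q : TwoRowPartition l m}
    (hp : IsIntertwiner M (partitionMap n p)) (hq : IsIntertwiner M (partitionMap n q)) :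
    IsIntertwiner M (partitionMap n (TwoRowPartition.compose p q)) := by
  obtain ⟨c, hc, h⟩ := sum_partitionMap_mul (n := n) p q
  have hc' : (c : ℂ) ≠ 0 := Nat.cast_ne_zero.2 (hc hn)
  have e : partitionMap n (TwoRowPartition.compose p q) =
      (c : ℂ)⁻¹ • (partitionMap n q * partitionMap n p) := by
    ext j i
    rw [Matrix.smul_apply, Matrix.mul_apply, h, smul_eq_mul, inv_mul_cancel_left₀ hc']
  rw [e]
  exact (hq.comp hp).smul _

/-- The relation for `p` is multiplied from the left by an entry in row `a` of `M` and summed;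
orthogonality of the rows then removes the factor that belonged to the moved point. The other
rotations are analogous, with columns for points moved upwards and multiplication from the right for
the last point. -/
theorem IsIntertwiner.rotateLeftDown {p : TwoRowPartition (k + 1) l}
    (hrow : ∀ i j, ∑ k, M i k * M j k = if i = j then 1 else 0)
    (hp : IsIntertwiner M (partitionMap n p)) :
    IsIntertwiner M (partitionMap n (TwoRowPartition.rotateLeftDown p)) := by
  intro f i
  obtain ⟨a, j, rfl⟩ := exists_eq_cons f
  rw [sum_cons]
  simp only [partitionMap_rotateLeftDown, matrixTensorPower_cons, ← mul_smul_comm,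
    ← Finset.mul_sum, ← hp j]
  simp only [sum_cons, matrixTensorPower_cons, Finset.mul_sum, mul_smul_comm, ← mul_assoc]
  rw [Finset.sum_comm]
  refine ((Fintype.sum_eq_single a fun c hc => ?_).trans ?_).symm
  · rw [Finset.sum_comm]
    simp [← Finset.smul_sum, ← Finset.sum_mul, hrow, hc.symm]
  · rw [Finset.sum_comm]
    simp [← Finset.smul_sum, ← Finset.sum_mul, hrow]

theorem IsIntertwiner.rotateLeftUp {p : TwoRowPartition k (l + 1)}
    (hcol : ∀ i j, ∑ k, M k i * M k j = if i = j then 1 else 0)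
    (hp : IsIntertwiner M (partitionMap n p)) :
    IsIntertwiner M (partitionMap n (TwoRowPartition.rotateLeftUp p)) := by
  intro j f
  obtain ⟨a, i, rfl⟩ := exists_eq_cons f
  rw [sum_cons]
  simp only [partitionMap_rotateLeftUp, matrixTensorPower_cons, ← mul_smul_comm,
    ← Finset.mul_sum, hp _ i]
  simp only [sum_cons, matrixTensorPower_cons, Finset.mul_sum, mul_smul_comm, ← mul_assoc]
  rw [Finset.sum_comm]
  refine (Fintype.sum_eq_single a fun c hc => ?_).trans ?_
  · rw [Finset.sum_comm]
    simp [← Finset.smul_sum, ← Finset.sum_mul, hcol, hc.symm]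
  · rw [Finset.sum_comm]
    simp [← Finset.smul_sum, ← Finset.sum_mul, hcol]

theorem IsIntertwiner.rotateRightDown {p : TwoRowPartition (k + 1) l}
    (hrow : ∀ i j, ∑ k, M i k * M j k = if i = j then 1 else 0)
    (hp : IsIntertwiner M (partitionMap n p)) :
    IsIntertwiner M (partitionMap n (TwoRowPartition.rotateRightDown p)) := by
  intro f i
  obtain ⟨j, a, rfl⟩ := exists_eq_snoc f
  rw [sum_snoc, Finset.sum_comm]
  simp only [partitionMap_rotateRightDown, matrixTensorPower_snoc, ← smul_mul_assoc,
    ← Finset.sum_mul, ← hp j]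
  simp only [sum_snoc, matrixTensorPower_snoc, Finset.sum_mul, smul_mul_assoc, mul_assoc]
  rw [Finset.sum_comm]
  refine (Finset.sum_congr rfl fun x _ => ?_).symm
  rw [Finset.sum_comm]
  simp [← Finset.smul_sum, ← Finset.mul_sum, hrow]

theorem IsIntertwiner.rotateRightUp {p : TwoRowPartition k (l + 1)}
    (hcol : ∀ i j, ∑ k, M k i * M k j = if i = j then 1 else 0)
    (hp : IsIntertwiner M (partitionMap n p)) :
    IsIntertwiner M (partitionMap n (TwoRowPartition.rotateRightUp p)) := by
  intro j f
  obtain ⟨i, a, rfl⟩ := exists_eq_snoc f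
  rw [sum_snoc, Finset.sum_comm]
  simp only [partitionMap_rotateRightUp, matrixTensorPower_snoc, ← smul_mul_assoc,
    ← Finset.sum_mul, hp _ i]
  simp only [sum_snoc, matrixTensorPower_snoc, Finset.sum_mul, smul_mul_assoc, mul_assoc]
  rw [Finset.sum_comm]
  refine Finset.sum_congr rfl fun x _ => ?_
  rw [Finset.sum_comm]
  simp [← Finset.smul_sum, ← Finset.mul_sum, hcol]

theorem partitionMap_pair (a b : Fin n) (i : Fin 0 → Fin n) :
    partitionMap n pair (Fin.cons a (Fin.cons b finZeroElim)) i = if a = b then 1 else 0 := by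
  classical
  rw [partitionMap_apply]
  refine if_congr ⟨fun h => @h (Sum.inr 0) (Sum.inr 1) trivial, ?_⟩ rfl rfl
  rintro rfl x y -
  rcases x with x | x
  · exact x.elim0
  rcases y with y | y
  · exact y.elim0
  rw [Setoid.ker_def]
  fin_cases x <;> fin_cases y <;> rfl

/-- The intertwiner condition for the pair partition. -/
theorem isIntertwiner_pair_iff : IsIntertwiner M (partitionMap n pair) ↔
    ∀ i j, ∑ k, M i k * M j k = if i = j then 1 else 0 := by
  have key : ∀ (a b : Fin n) (i : Fin 0 → Fin n),
      (∑ x, partitionMap n pair (Fin.cons a (Fin.cons b finZeroElim)) x •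
        matrixTensorPower M 0 x i = ∑ x, partitionMap n pair x i •
        matrixTensorPower M 2 (Fin.cons a (Fin.cons b finZeroElim)) x) ↔
      ∑ k, M a k * M b k = if a = b then 1 else 0 := by
    intro a b i
    rw [sum_cons (k := 1)]
    simp only [sum_cons (k := 0), Fintype.sum_unique, Unique.eq_default (α := Fin 0 → Fin n)]
    have : (default : Fin 0 → Fin n) = finZeroElim := Subsingleton.elim _ _
    simp only [this, partitionMap_pair, matrixTensorPower_cons, matrixTensorPower_zero, mul_one]
    rw [eq_comm]
    simp
  constructor
  · intro h a b
    exact (key a b finZeroElim).1 (h _ _)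
  · intro h j i
    obtain ⟨a, j, rfl⟩ := exists_eq_cons j
    obtain ⟨b, j, rfl⟩ := exists_eq_cons j
    obtain rfl := Subsingleton.elim j finZeroElim
    exact (key a b i).2 (h a b)

end IsIntertwiner

section star

variable {A : Type*} [Ring A] [StarRing A] {n k l : ℕ} {M : Matrix (Fin n) (Fin n) A}

/-- As `star` reverses products, the last factors meet in the middle and cancel first. Hence the
last index is split off here, and the first one in the statement for columns. -/
theorem sum_matrixTensorPower_mul_star (hs : ∀ i j, star (M i j) = M i j)
    (hrow : ∀ i j, ∑ k, M i k * M j k = if i = j then 1 else 0) (i i' : Fin k → Fin n) :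
    ∑ j, matrixTensorPower M k i j * star (matrixTensorPower M k i' j) =
      if i = i' then 1 else 0 := by
  induction k with
  | zero => simp [matrixTensorPower_zero, Subsingleton.elim i i']
  | succ k ih =>
    obtain ⟨i, a, rfl⟩ := exists_eq_snoc i
    obtain ⟨i', a', rfl⟩ := exists_eq_snoc i'
    rw [sum_snoc]
    simp only [matrixTensorPower_snoc, star_mul, hs, mul_assoc]
    have : ∀ x : Fin k → Fin n, ∑ b, matrixTensorPower M k i x *
        (M a b * (M a' b * star (matrixTensorPower M k i' x))) =
        if a = a' then matrixTensorPower M k i x * star (matrixTensorPower M k i' x) else 0 := by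
      intro x
      rw [← Finset.mul_sum]
      simp only [← mul_assoc (M a _), ← Finset.sum_mul, hrow]
      split_ifs <;> simp
    simp only [this, Fin.snoc_inj]
    by_cases h : a = a' <;> simp [h, ih]

theorem sum_star_matrixTensorPower_mul (hs : ∀ i j, star (M i j) = M i j)
    (hcol : ∀ i j, ∑ k, M k i * M k j = if i = j then 1 else 0) (i i' : Fin k → Fin n) :
    ∑ j, star (matrixTensorPower M k j i) * matrixTensorPower M k j i' =
      if i = i' then 1 else 0 := by
  induction k with
  | zero => simp [matrixTensorPower_zero, Subsingleton.elim i i']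
  | succ k ih =>
    obtain ⟨a, i, rfl⟩ := exists_eq_cons i
    obtain ⟨a', i', rfl⟩ := exists_eq_cons i'
    rw [sum_cons, Finset.sum_comm]
    simp only [matrixTensorPower_cons, star_mul, hs, mul_assoc]
    have : ∀ x : Fin k → Fin n, ∑ b, star (matrixTensorPower M k x i) *
        (M b a * (M b a' * matrixTensorPower M k x i')) =
        if a = a' then star (matrixTensorPower M k x i) * matrixTensorPower M k x i' else 0 := by
      intro x
      rw [← Finset.mul_sum]
      simp only [← mul_assoc (M _ a), ← Finset.sum_mul, hcol]
      split_ifs <;> simp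
    simp only [this, Fin.cons_inj]
    by_cases h : a = a' <;> simp [h, ih]

variable [Algebra ℂ A] [StarModule ℂ A]

/-- The tensor powers of `M` are unitary, so the adjoint of the intertwining relation can be
multiplied by them on both sides. -/
theorem IsIntertwiner.conjTranspose (hs : ∀ i j, star (M i j) = M i j)
    (hrow : ∀ i j, ∑ k, M i k * M j k = if i = j then 1 else 0)
    (hcol : ∀ i j, ∑ k, M k i * M k j = if i = j then 1 else 0)
    {T : Matrix (Fin l → Fin n) (Fin k → Fin n) ℂ} (h : IsIntertwiner M T) :
    IsIntertwiner M T.conjTranspose := by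
  classical
  let E : Matrix (Fin k → Fin n) (Fin l → Fin n) A := T.conjTranspose.map (algebraMap ℂ A)
  have hE : (T.map (algebraMap ℂ A)).conjTranspose = E := by
    ext i j
    simp [E, Algebra.algebraMap_eq_smul_one]
  have h1 : T.map (algebraMap ℂ A) * matrixTensorPower M k =
      matrixTensorPower M l * T.map (algebraMap ℂ A) := by
    ext j i
    rw [map_algebraMap_mul_apply, mul_map_algebraMap_apply, h]
  have h2 := congrArg Matrix.conjTranspose h1
  rw [Matrix.conjTranspose_mul, Matrix.conjTranspose_mul, hE] at h2
  have h3 : matrixTensorPower M k * (matrixTensorPower M k).conjTranspose = 1 := by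
    ext i j
    rw [Matrix.mul_apply, Matrix.one_apply, ← sum_matrixTensorPower_mul_star hs hrow]
    rfl
  have h4 : (matrixTensorPower M l).conjTranspose * matrixTensorPower M l = 1 := by
    ext i j
    rw [Matrix.mul_apply, Matrix.one_apply, ← sum_star_matrixTensorPower_mul hs hcol]
    rfl
  have h5 : E * matrixTensorPower M l = matrixTensorPower M k * E := by
    calc E * matrixTensorPower M l
        = matrixTensorPower M k * ((matrixTensorPower M k).conjTranspose * E) *
          matrixTensorPower M l := by rw [← Matrix.mul_assoc, h3, Matrix.one_mul]
      _ = matrixTensorPower M k * E := by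
        rw [h2, Matrix.mul_assoc, Matrix.mul_assoc, h4, Matrix.mul_one]
  intro i j
  rw [← map_algebraMap_mul_apply, ← mul_map_algebraMap_apply]
  exact congrFun (congrFun h5 i) j

theorem partitionMap_involution_eq (p : TwoRowPartition k l) :
    partitionMap n (involution p) = (partitionMap n p).conjTranspose := by
  ext i j
  rw [partitionMap_involution, Matrix.conjTranspose_apply, star_partitionMap]

/-- The partitions whose linear maps intertwine the tensor powers of `M`. -/
def intertwiningPartitions (M : Matrix (Fin n) (Fin n) A) : PartitionFamily :=
  fun _ _ => {p | IsIntertwiner M (partitionMap n p)}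

/-- Consequently the intertwining property passes from generators to the whole generated category.
-/
theorem isFullCategory_intertwiningPartitions (hn : 1 ≤ n) (hs : ∀ i j, star (M i j) = M i j)
    (hrow : ∀ i j, ∑ k, M i k * M j k = if i = j then 1 else 0)
    (hcol : ∀ i j, ∑ k, M k i * M k j = if i = j then 1 else 0) :
    IsFullCategory (intertwiningPartitions M) where
  tensor_mem _ _ hp hq := hp.tensor hq
  compose_mem _ _ hp hq := hp.compose hn hq
  involution_mem p hp := by
    change IsIntertwiner M _
    rw [partitionMap_involution_eq]
    exact hp.conjTranspose hs hrow hcol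
  rotateLeftDown_mem _ hp := hp.rotateLeftDown hrow
  rotateLeftUp_mem _ hp := hp.rotateLeftUp hcol
  rotateRightDown_mem _ hp := hp.rotateRightDown hrow
  rotateRightUp_mem _ hp := hp.rotateRightUp hcol
  unit_mem := isIntertwiner_unit
  pair_mem := isIntertwiner_pair_iff.2 hrow

end star

/-! ### The ideal of relations of a full category -/

namespace TwoRowPartition

/-- The mirror image of a partition: both rows are read from right to left. -/
def reflect {k l : ℕ} (p : TwoRowPartition k l) : TwoRowPartition k l :=
  Setoid.comap (Sum.map Fin.rev Fin.rev) p

end TwoRowPartition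

theorem IsFullCategory.hasWord_symm {C : PartitionFamily} (hC : IsFullCategory C) {U V : List ℕ}
    (h : HasWord C U V) : HasWord C V U := by
  refine mem_of_rel (hC.involution_mem _ h) fun x y => ?_
  rcases x with x | x <;> rcases y with y | y <;> exact Iff.rfl

/-- A reflection is a half turn, which is a cyclic rotation of the points, followed by turning the
diagram upside down. -/
theorem IsFullCategory.hasWord_reverse {C : PartitionFamily} (hC : IsFullCategory C)
    {U V : List ℕ} (h : HasWord C U V) : HasWord C U.reverse V.reverse := by
  refine hC.hasWord_symm ?_
  rw [hC.hasWord_iff_nil] at h ⊢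
  rw [List.reverse_reverse]
  exact hC.hasWord_rotate _ _ h

theorem List.reverse_ofFn_eq {α : Type*} {k : ℕ} (f : Fin k → α) :
    (List.ofFn f).reverse = List.ofFn (fun i => f i.rev) := by
  refine List.ext_getElem (by simp) fun i h1 h2 => ?_
  simp only [List.getElem_reverse, List.getElem_ofFn, List.length_ofFn]
  congr 1
  ext
  simp [Fin.val_rev]
  lia

theorem IsFullCategory.reflect_mem {C : PartitionFamily} (hC : IsFullCategory C) {k l : ℕ}
    {p : TwoRowPartition k l} (hp : p ∈ C k l) : reflect p ∈ C k l := by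
  obtain ⟨f, g, rfl⟩ := exists_eq_ofLabels p
  have h := hC.hasWord_reverse ((hasWord_ofFn f g).2 hp)
  rw [List.reverse_ofFn_eq, List.reverse_ofFn_eq, hasWord_ofFn] at h
  refine mem_of_rel h fun x y => ?_
  rcases x with x | x <;> rcases y with y | y <;> exact Iff.rfl

section defect

variable {A : Type*} [Ring A] [Algebra ℂ A] {n k l : ℕ}

/-- The entries of `T M^{⊗k} - M^{⊗l} T`. -/
def defect (M : Matrix (Fin n) (Fin n) A) (T : Matrix (Fin l → Fin n) (Fin k → Fin n) ℂ)
    (j : Fin l → Fin n) (i : Fin k → Fin n) : A :=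
  ∑ a, T j a • matrixTensorPower M k a i - ∑ b, T b i • matrixTensorPower M l j b

theorem isIntertwiner_iff_defect (M : Matrix (Fin n) (Fin n) A)
    (T : Matrix (Fin l → Fin n) (Fin k → Fin n) ℂ) :
    IsIntertwiner M T ↔ ∀ j i, defect M T j i = 0 :=
  forall_congr' fun _ => forall_congr' fun _ => sub_eq_zero.symm

theorem map_defect {B : Type*} [Ring B] [Algebra ℂ B] (φ : A →ₐ[ℂ] B)
    (M : Matrix (Fin n) (Fin n) A) (T : Matrix (Fin l → Fin n) (Fin k → Fin n) ℂ)
    (j : Fin l → Fin n) (i : Fin k → Fin n) : φ (defect M T j i) = defect (M.map φ) T j i := by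
  simp [defect, map_sum, map_smul, map_matrixTensorPower]

end defect

theorem partitionMap_reflect {n k l : ℕ} (p : TwoRowPartition k l) (j : Fin l → Fin n)
    (i : Fin k → Fin n) :
    partitionMap n (reflect p) (j ∘ Fin.rev) (i ∘ Fin.rev) = partitionMap n p j i := by
  refine partitionMap_rotate_aux _ (Sum.map Fin.rev Fin.rev) ?_ ?_ ?_ <;>
  · rintro (x | x) <;> simp

theorem star_matrixTensorPower {A : Type*} [Ring A] [StarRing A] {n k : ℕ}
    {M : Matrix (Fin n) (Fin n) A} (hs : ∀ i j, star (M i j) = M i j) (i j : Fin k → Fin n) :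
    star (matrixTensorPower M k i j) = matrixTensorPower M k (i ∘ Fin.rev) (j ∘ Fin.rev) := by
  induction k with
  | zero => simp [matrixTensorPower_zero]
  | succ k ih =>
    obtain ⟨a, i, rfl⟩ := exists_eq_cons i
    obtain ⟨b, j, rfl⟩ := exists_eq_cons j
    rw [matrixTensorPower_cons, star_mul, hs, ih, Fin.cons_comp_rev, Fin.cons_comp_rev,
      matrixTensorPower_snoc]

/-- As `star` reverses words in the generators, the adjoints of the relations of `p` are the
relations of its mirror image. -/
theorem star_defect_partitionMap {A : Type*} [Ring A] [StarRing A] [Algebra ℂ A] [StarModule ℂ A]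
    {n k l : ℕ} {M : Matrix (Fin n) (Fin n) A} (hs : ∀ i j, star (M i j) = M i j)
    (p : TwoRowPartition k l) (j : Fin l → Fin n) (i : Fin k → Fin n) :
    star (defect M (partitionMap n p) j i) =
      defect M (partitionMap n (reflect p)) (j ∘ Fin.rev) (i ∘ Fin.rev) := by
  let e : ∀ k, Equiv.Perm (Fin k → Fin n) := fun k => Equiv.arrowCongr Fin.revPerm (Equiv.refl _)
  have he : ∀ k (f : Fin k → Fin n), e k f = f ∘ Fin.rev := fun k f => rfl
  rw [defect, defect, star_sub, star_sum, star_sum]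
  simp only [star_smul, star_partitionMap, star_matrixTensorPower hs]
  congr 1
  · refine Fintype.sum_equiv (e k) _ _ fun a => ?_
    rw [he, partitionMap_reflect]
  · refine Fintype.sum_equiv (e l) _ _ fun a => ?_
    rw [he, partitionMap_reflect]

namespace FreeStarAlgebra

variable {n : ℕ}

instance : StarModule ℂ (FreeStarAlgebra n) where
  star_smul c a := by
    rw [Algebra.smul_def, Algebra.smul_def, star_mul, star_algebraMap]
    exact (Algebra.commutes _ _).symm

/-- The homomorphism given by the images of the generators. -/
noncomputable def lift {A : Type*} [Ring A] [Algebra ℂ A] (M : Matrix (Fin n) (Fin n) A) :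
    FreeStarAlgebra n →ₐ[ℂ] A :=
  FreeAlgebra.lift ℂ fun y : Fin n × Fin n => M y.1 y.2

theorem lift_x {A : Type*} [Ring A] [Algebra ℂ A] (M : Matrix (Fin n) (Fin n) A) (i j : Fin n) :
    lift M (x n i j) = M i j :=
  FreeAlgebra.lift_ι_apply (fun y : Fin n × Fin n => M y.1 y.2) (i, j)

theorem map_lift_x {A : Type*} [Ring A] [Algebra ℂ A] (M : Matrix (Fin n) (Fin n) A) :
    (x n).map (lift M) = M := by
  ext i j
  exact lift_x M i j

theorem lift_star {A : Type*} [Ring A] [StarRing A] [Algebra ℂ A] [StarModule ℂ A]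
    {M : Matrix (Fin n) (Fin n) A} (hs : ∀ i j, star (M i j) = M i j) (a : FreeStarAlgebra n) :
    lift M (star a) = star (lift M a) := by
  induction a using FreeStarAlgebra.induction with
  | scalar c => rw [star_algebraMap, AlgHom.commutes, AlgHom.commutes, algebraMap_star_comm]
  | gen i j => rw [star_x, lift_x, hs]
  | mul a b ha hb => rw [star_mul, map_mul, map_mul, star_mul, ha, hb]
  | add a b ha hb => rw [star_add, map_add, map_add, star_add, ha, hb]

/-- The span of the relations that say that the linear maps of the partitions of a family are
intertwiners. -/
noncomputable def relationSpan (P : PartitionFamily) (n : ℕ) : Submodule ℂ (FreeStarAlgebra n) :=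
  Submodule.span ℂ {a | ∃ (k l : ℕ) (p : TwoRowPartition k l) (j : Fin l → Fin n)
    (i : Fin k → Fin n), p ∈ P k l ∧ a = defect (x n) (partitionMap n p) j i}

variable {P : PartitionFamily}

theorem defect_mem_relationSpan {k l : ℕ} {p : TwoRowPartition k l} (hp : p ∈ P k l)
    (j : Fin l → Fin n) (i : Fin k → Fin n) :
    defect (x n) (partitionMap n p) j i ∈ relationSpan P n :=
  Submodule.subset_span ⟨k, l, p, j, i, hp, rfl⟩

/-- Multiplying a relation of `p` by a generator from the left gives an entry of the relation of
`unit ⊗ p`. So the linear span is a left ideal, and being closed under `star` it is two-sided. -/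
theorem mul_mem_relationSpan (hP : IsFullCategory P) (a b : FreeStarAlgebra n)
    (hb : b ∈ relationSpan P n) : a * b ∈ relationSpan P n := by
  induction a using FreeStarAlgebra.induction generalizing b with
  | scalar c =>
    rw [← Algebra.smul_def]
    exact Submodule.smul_mem _ _ hb
  | mul a a' ha ha' =>
    rw [mul_assoc]
    exact ha _ (ha' _ hb)
  | add a a' ha ha' =>
    rw [add_mul]
    exact Submodule.add_mem _ (ha _ hb) (ha' _ hb)
  | gen s t =>
    induction hb using Submodule.span_induction with
    | zero => simp
    | add b b' _ _ hb hb' =>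
      rw [mul_add]
      exact Submodule.add_mem _ hb hb'
    | smul c b _ hb =>
      rw [mul_smul_comm]
      exact Submodule.smul_mem _ _ hb
    | mem b hb =>
      obtain ⟨k, l, p, j, i, hp, rfl⟩ := hb
      have := defect_mem_relationSpan (n := n) (hP.tensor_mem _ _ hP.unit_mem hp)
        (Fin.append (fun _ => s) j) (Fin.append (fun _ => t) i)
      rw [defect, sum_tensor_left, sum_tensor_right] at this
      simp only [partitionMap_unit, Matrix.one_apply, ite_smul, zero_smul, one_smul,
        Finset.sum_ite_eq, Finset.sum_ite_eq', Finset.mem_univ, if_true,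
        matrixTensorPower_one] at this
      rwa [← mul_sub] at this

theorem star_mem_relationSpan (hP : IsFullCategory P) (a : FreeStarAlgebra n)
    (ha : a ∈ relationSpan P n) : star a ∈ relationSpan P n := by
  induction ha using Submodule.span_induction with
  | zero => simp
  | add b b' _ _ hb hb' =>
    rw [star_add]
    exact Submodule.add_mem _ hb hb'
  | smul c b _ hb =>
    rw [star_smul]
    exact Submodule.smul_mem _ _ hb
  | mem b hb =>
    obtain ⟨k, l, p, j, i, hp, rfl⟩ := hb
    rw [star_defect_partitionMap (star_x n)]
    exact defect_mem_relationSpan (hP.reflect_mem hp) _ _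

theorem mul_mem_relationSpan_right (hP : IsFullCategory P) (a b : FreeStarAlgebra n)
    (ha : a ∈ relationSpan P n) : a * b ∈ relationSpan P n := by
  have := star_mem_relationSpan hP _
    (mul_mem_relationSpan hP (star b) _ (star_mem_relationSpan hP _ ha))
  rwa [star_mul, star_star, star_star] at this

/-- The congruence whose quotient is the universal algebra in which the linear maps of the
partitions of a full category are intertwiners. -/
noncomputable def relationCon (hP : IsFullCategory P) (n : ℕ) : RingCon (FreeStarAlgebra n) :=
  (TwoSidedIdeal.mk' (relationSpan P n) (Submodule.zero_mem _) (Submodule.add_mem _)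
    (Submodule.neg_mem _) (mul_mem_relationSpan hP _ _)
    (mul_mem_relationSpan_right hP _ _)).ringCon

theorem relationCon_apply (hP : IsFullCategory P) (a b : FreeStarAlgebra n) :
    relationCon hP n a b ↔ a - b ∈ relationSpan P n :=
  Iff.rfl

/-- The generators in the universal algebra of a full category. -/
noncomputable def relationMatrix (hP : IsFullCategory P) (n : ℕ) :
    Matrix (Fin n) (Fin n) (relationCon hP n).Quotient :=
  (x n).map ((relationCon hP n).mkₐ (α := ℂ))

theorem mkₐ_eq_iff (hP : IsFullCategory P) (a b : FreeStarAlgebra n) :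
    (relationCon hP n).mkₐ (α := ℂ) a = (relationCon hP n).mkₐ (α := ℂ) b ↔
      a - b ∈ relationSpan P n :=
  (relationCon hP n).eq

theorem isIntertwiner_relationMatrix (hP : IsFullCategory P) (n : ℕ) {k l : ℕ}
    {p : TwoRowPartition k l} (hp : p ∈ P k l) :
    IsIntertwiner (relationMatrix hP n) (partitionMap n p) := by
  rw [isIntertwiner_iff_defect]
  intro j i
  rw [relationMatrix, ← map_defect, ← map_zero ((relationCon hP n).mkₐ (α := ℂ)), mkₐ_eq_iff,
    sub_zero]
  exact defect_mem_relationSpan hp j i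

theorem lift_eq_zero_of_mem_relationSpan {A : Type*} [Ring A] [Algebra ℂ A]
    {M : Matrix (Fin n) (Fin n) A}
    (h : ∀ k l, ∀ p ∈ P k l, IsIntertwiner M (partitionMap n p)) {a : FreeStarAlgebra n}
    (ha : a ∈ relationSpan P n) : lift M a = 0 := by
  have : relationSpan P n ≤ LinearMap.ker (lift M).toLinearMap := by
    rw [relationSpan, Submodule.span_le]
    rintro _ ⟨k, l, p, j, i, hp, rfl⟩
    change lift M _ = 0
    rw [map_defect, map_lift_x]
    exact (isIntertwiner_iff_defect _ _).1 (h k l p hp) j i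
  exact this ha

end FreeStarAlgebra

theorem StarAlgHom.surjective_of_generates {n : ℕ} {A B : Type*} [Ring A] [StarRing A]
    [Algebra ℂ A] [Ring B] [StarRing B] [Algebra ℂ B] [StarModule ℂ B]
    {u : Matrix (Fin n) (Fin n) A}
    {v : Matrix (Fin n) (Fin n) B} (hv : StarAlgebra.adjoin ℂ {a | ∃ i j, a = v i j} = ⊤)
    (φ : A →⋆ₐ[ℂ] B) (h : ∀ i j, φ (u i j) = v i j) : Function.Surjective φ := by
  have : StarAlgebra.adjoin ℂ {a | ∃ i j, a = v i j} ≤ φ.range := by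
    refine StarAlgebra.adjoin_le ?_
    rintro _ ⟨i, j, rfl⟩
    exact ⟨u i j, h i j⟩
  rw [hv] at this
  intro b
  have hb : b ∈ φ.range := this trivial
  exact hb

/-! ### Universal property of the presented algebras -/

section presented

open FreeStarAlgebra

variable {n : ℕ} {r : FreeStarAlgebra n → FreeStarAlgebra n → Prop}

theorem presentedAlgebra_star (i j : Fin n) :
    star ((presentedAlgebra r).u i j) = (presentedAlgebra r).u i j :=
  congrArg (fun b : FreeStarAlgebra n => (b : (starRingCon r).Quotient)) (star_x n i j)

theorem lift_presentedAlgebra (a : FreeStarAlgebra n) :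
    lift (presentedAlgebra r).u a = (a : (starRingCon r).Quotient) := by
  have : lift (presentedAlgebra r).u = (starRingCon r).mkₐ (α := ℂ) := by
    refine FreeAlgebra.hom_ext (funext fun y => ?_)
    exact lift_x (presentedAlgebra r).u y.1 y.2
  exact congrArg (fun f => f a) this

theorem lift_presentedAlgebra_eq {a b : FreeStarAlgebra n} (h : r a b) :
    lift (presentedAlgebra r).u a = lift (presentedAlgebra r).u b := by
  rw [lift_presentedAlgebra, lift_presentedAlgebra]
  exact (starRingCon r).eq.2 (RingConGen.Rel.of _ _ (Or.inl h))

theorem lift_presentedAlgebra_surjective :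
    Function.Surjective (lift (presentedAlgebra r).u) := fun a => by
  obtain ⟨b, rfl⟩ := (starRingCon r).mkₐ_surjective (α := ℂ) a
  exact ⟨b, lift_presentedAlgebra b⟩

theorem presentedAlgebra_generates :
    StarAlgebra.adjoin ℂ {a | ∃ i j, a = (presentedAlgebra r).u i j} = ⊤ := by
  rw [eq_top_iff]
  rintro a -
  obtain ⟨a, rfl⟩ := lift_presentedAlgebra_surjective a
  induction a using FreeStarAlgebra.induction with
  | scalar c =>
    rw [AlgHom.commutes]
    exact algebraMap_mem _ c
  | gen i j =>
    rw [lift_x]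
    exact StarAlgebra.subset_adjoin _ _ ⟨i, j, rfl⟩
  | mul a b ha hb =>
    rw [map_mul]
    exact mul_mem ha hb
  | add a b ha hb =>
    rw [map_add]
    exact add_mem ha hb

variable {A : Type*} [Ring A] [StarRing A] [Algebra ℂ A] [StarModule ℂ A]

theorem starRingCon_le_ker {M : Matrix (Fin n) (Fin n) A} (hs : ∀ i j, star (M i j) = M i j)
    (h : ∀ a b, r a b → lift M a = lift M b) :
    starRingCon r ≤ RingCon.ker (lift M).toRingHom := by
  rw [starRingCon, RingCon.ringConGen_le]
  rintro a b (hab | hab)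
  · exact h a b hab
  · have := h _ _ hab
    rw [lift_star hs, lift_star hs] at this
    exact star_injective this

theorem exists_starAlgHom {M : Matrix (Fin n) (Fin n) A} (hs : ∀ i j, star (M i j) = M i j)
    (h : ∀ a b, r a b → lift M a = lift M b) :
    ∃ φ : (presentedAlgebra r).carrier →⋆ₐ[ℂ] A,
      (∀ i j, φ ((presentedAlgebra r).u i j) = M i j) ∧
      ∀ a, φ (lift (presentedAlgebra r).u a) = lift M a := by
  let ψ := (starRingCon r).liftₐ (lift M) (starRingCon_le_ker hs h)
  have hψ : ∀ a : FreeStarAlgebra n, ψ (a : (starRingCon r).Quotient) = lift M a := fun a => rfl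
  refine ⟨{ ψ with
    map_star' := ?_ }, ?_, ?_⟩
  · rintro ⟨a⟩
    exact lift_star hs a
  · intro i j
    exact (hψ _).trans (lift_x M i j)
  · intro a
    rw [lift_presentedAlgebra]
    exact hψ a

end presented

/-! ### The double commutant theorem for matrices -/

theorem Matrix.mul_single_one_apply {ι : Type*} [Fintype ι] [DecidableEq ι] (X : Matrix ι ι ℂ)
    (k l : ι) : X * Matrix.single k l (1 : ℂ) = ∑ a, X a k • Matrix.single a l (1 : ℂ) := by
  ext i j
  rw [Matrix.mul_apply, Matrix.sum_apply]
  simp only [Matrix.smul_apply, Matrix.single_apply, smul_eq_mul]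
  by_cases h : l = j <;> simp [h]

/-- A linear map on matrices that commutes with left multiplication by the elements of a set also
commutes with left multiplication by the elements of its double commutant. -/
theorem Matrix.map_mul_of_commutant {ι : Type*} [Fintype ι] [DecidableEq ι]
    (S : Set (Matrix ι ι ℂ)) (P : Matrix ι ι ℂ →ₗ[ℂ] Matrix ι ι ℂ)
    (hP : ∀ s ∈ S, ∀ N, P (s * N) = s * P N) (X : Matrix ι ι ℂ)
    (hX : ∀ Y, (∀ s ∈ S, s * Y = Y * s) → X * Y = Y * X) (N : Matrix ι ι ℂ) :
    P (X * N) = X * P N := by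
  -- The coefficients of `P` are arranged so that `P` commutes with left multiplication by `X`
  -- exactly when `X` commutes with every `Q j l`.
  let Q : ι → ι → Matrix ι ι ℂ := fun j l => Matrix.of fun i k => P (Matrix.single k l 1) i j
  have eq_iff : ∀ X : Matrix ι ι ℂ,
      (∀ k l, P (X * Matrix.single k l 1) = X * P (Matrix.single k l 1))
      ↔ ∀ j l, X * Q j l = Q j l * X := by
    intro X
    have : ∀ i k j l, (P (X * Matrix.single k l 1) i j = (X * P (Matrix.single k l 1)) i j) ↔
        (X * Q j l) i k = (Q j l * X) i k := by
      intro i k j l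
      rw [Matrix.mul_single_one_apply, map_sum, Matrix.sum_apply, Matrix.mul_apply,
        Matrix.mul_apply, Matrix.mul_apply, eq_comm]
      simp only [Q, Matrix.of_apply, map_smul, Matrix.smul_apply, smul_eq_mul, mul_comm]
    constructor
    · intro h j l
      ext i k
      rw [← this, h]
    · intro h k l
      ext i j
      rw [this, h]
  have h1 := (eq_iff X).2 fun j l => hX _ fun s hs => (eq_iff s).1 (fun k l => hP s hs _) j l
  rw [Matrix.matrix_eq_sum_single N]
  simp only [Finset.mul_sum, map_sum]
  refine Finset.sum_congr rfl fun k _ => Finset.sum_congr rfl fun l _ => ?_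
  have : Matrix.single k l (N k l) = N k l • Matrix.single k l (1 : ℂ) := by
    rw [Matrix.smul_single, smul_eq_mul, mul_one]
  rw [this, mul_smul_comm, map_smul, map_smul, h1, mul_smul_comm]

/-- The double commutant theorem for algebras of matrices. -/
theorem Matrix.mem_of_double_commutant {ι : Type*} [Fintype ι] [DecidableEq ι]
    (S : StarSubalgebra ℂ (Matrix ι ι ℂ)) (X : Matrix ι ι ℂ)
    (hX : ∀ Y, (∀ s ∈ S, s * Y = Y * s) → X * Y = Y * X) : X ∈ S := by
  -- Matrices with the Hilbert–Schmidt inner product, for which left multiplication by `star s` is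
  -- adjoint to that by `s`.
  obtain ⟨e, he⟩ : ∃ e : Matrix ι ι ℂ ≃ₗ[ℂ] EuclideanSpace ℂ (ι × ι),
      ∀ N p, e N p = N p.1 p.2 := ⟨
    { toFun N := WithLp.toLp 2 fun p => N p.1 p.2
      invFun v := Matrix.of fun i j => v (i, j)
      map_add' _ _ := rfl
      map_smul' _ _ := rfl
      left_inv _ := rfl
      right_inv _ := rfl }, fun _ _ => rfl⟩
  let K : Submodule ℂ (EuclideanSpace ℂ (ι × ι)) := S.toSubalgebra.toSubmodule.map e.toLinearMap
  have hinner : ∀ s N N' : Matrix ι ι ℂ,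
      inner ℂ (e N) (e (s * N')) = inner ℂ (e (star s * N)) (e N') := by
    intro s N N'
    simp only [PiLp.inner_apply, he, Fintype.sum_prod_type, Matrix.mul_apply, RCLike.inner_apply,
      Matrix.star_apply, map_sum,
      Finset.sum_mul, Finset.mul_sum, map_mul, RCLike.star_def, Complex.conj_conj]
    rw [Finset.sum_comm]
    conv_rhs => rw [Finset.sum_comm]
    refine Finset.sum_congr rfl fun j _ => ?_
    rw [Finset.sum_comm]
    refine Finset.sum_congr rfl fun k _ => Finset.sum_congr rfl fun i _ => ?_
    ring
  -- The orthogonal projection onto `S`. As `S` is closed under `star`, it commutes with left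
  -- multiplication by `S`, hence by `X`; therefore `X = X * P 1 = P X` lies in `S`.
  let P : Matrix ι ι ℂ →ₗ[ℂ] Matrix ι ι ℂ :=
    e.symm.toLinearMap ∘ₗ K.starProjection.toLinearMap ∘ₗ e.toLinearMap
  have hPe : ∀ N, e (P N) = K.starProjection (e N) := fun N => e.apply_symm_apply _
  have hPmem : ∀ N, P N ∈ S := by
    intro N
    have : e (P N) ∈ K := by
      rw [hPe]
      exact K.starProjection_apply_mem _
    obtain ⟨N', hN', h⟩ := this
    rw [← e.injective h]
    exact hN'
  have hP1 : P 1 = 1 := by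
    apply e.injective
    rw [hPe, K.starProjection_eq_self_iff]
    exact ⟨1, one_mem S, rfl⟩
  have hP : ∀ s ∈ S, ∀ N, P (s * N) = s * P N := by
    intro s hs N
    apply e.injective
    rw [hPe]
    refine (K.eq_starProjection_of_mem_of_inner_eq_zero
      (⟨s * P N, (mul_mem hs (hPmem N) : s * P N ∈ S), rfl⟩ : e (s * P N) ∈ K) ?_)
    rintro _ ⟨N', hN', rfl⟩
    have h0 : e (s * N) - e (s * P N) = e (s * (N - P N)) := by
      rw [mul_sub, map_sub]
    rw [h0, ← inner_conj_symm, LinearEquiv.coe_coe, hinner, map_sub, hPe]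
    have := K.starProjection_inner_eq_zero (e N) (e (star s * N'))
      ⟨star s * N', (mul_mem (star_mem hs) hN' : star s * N' ∈ S), rfl⟩
    rw [← inner_conj_symm, map_eq_zero] at this
    rw [this, map_zero]
  have h := Matrix.map_mul_of_commutant (S : Set (Matrix ι ι ℂ)) P hP X hX 1
  rw [hP1, mul_one] at h
  exact h ▸ hPmem X

/-! ### Tannaka–Krein duality: from relations to intertwiners -/

namespace FreeStarAlgebra

variable {n : ℕ}

/-- Linear functionals on the free algebra can be prescribed on the words. -/
theorem exists_linearMap (G : ∀ k, (Fin k → Fin n) → (Fin k → Fin n) → ℂ) :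
    ∃ f : FreeStarAlgebra n →ₗ[ℂ] ℂ, ∀ k i j, f (matrixTensorPower (x n) k i j) = G k i j := by
  let X := Fin n × Fin n
  -- Each generator acts by prepending its letter, so a monomial applied to the empty word returns
  -- its own word. Distinct monomials are thus linearly independent.
  let ρ : FreeStarAlgebra n →ₐ[ℂ] Module.End ℂ (List X →₀ ℂ) :=
    lift (Matrix.of fun i j => Finsupp.lmapDomain ℂ ℂ (List.cons (i, j)))
  have hρ : ∀ k (i j : Fin k → Fin n), ρ (matrixTensorPower (x n) k i j) (Finsupp.single [] 1) =
      Finsupp.single (List.ofFn fun t => (i t, j t)) 1 := by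
    intro k
    induction k with
    | zero => intro i j; simp [matrixTensorPower_zero]
    | succ k ih =>
      intro i j
      obtain ⟨a, i, rfl⟩ := exists_eq_cons i
      obtain ⟨b, j, rfl⟩ := exists_eq_cons j
      rw [matrixTensorPower_cons, map_mul, Module.End.mul_apply, ih, lift_x, Matrix.of_apply,
        Finsupp.lmapDomain_apply, Finsupp.mapDomain_single, List.ofFn_succ]
      rfl
  let F : List X → ℂ := fun L =>
    G (List.equivSigmaTuple L).1 (fun t => ((List.equivSigmaTuple L).2 t).1)
      (fun t => ((List.equivSigmaTuple L).2 t).2)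
  refine ⟨Finsupp.linearCombination ℂ F ∘ₗ LinearMap.applyₗ (Finsupp.single [] 1) ∘ₗ
    ρ.toLinearMap, fun k i j => ?_⟩
  change Finsupp.linearCombination ℂ F (ρ (matrixTensorPower (x n) k i j) _) = _
  rw [hρ, Finsupp.linearCombination_single, one_smul]
  have : List.equivSigmaTuple (List.ofFn fun t => (i t, j t)) = ⟨k, fun t => (i t, j t)⟩ :=
    List.equivSigmaTuple.apply_symm_apply ⟨k, fun t => (i t, j t)⟩
  simp only [F]
  rw [this]

/-- The span of the words of length less than `N`. -/
noncomputable def wordSpan (n N : ℕ) : Submodule ℂ (FreeStarAlgebra n) :=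
  Submodule.span ℂ {a | ∃ k, k < N ∧ ∃ i j : Fin k → Fin n, a = matrixTensorPower (x n) k i j}

theorem wordSpan_mono {N N' : ℕ} (h : N ≤ N') : wordSpan n N ≤ wordSpan n N' :=
  Submodule.span_mono fun _ ⟨k, hk, h'⟩ => ⟨k, hk.trans_le h, h'⟩

theorem mul_mem_wordSpan {N N' : ℕ} {a b : FreeStarAlgebra n} (ha : a ∈ wordSpan n N)
    (hb : b ∈ wordSpan n N') : a * b ∈ wordSpan n (N + N') := by
  have : wordSpan n N * wordSpan n N' ≤ wordSpan n (N + N') := by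
    rw [wordSpan, wordSpan, Submodule.span_mul_span, Submodule.span_le]
    rintro _ ⟨_, ⟨k, hk, i, j, rfl⟩, _, ⟨k', hk', i', j', rfl⟩, rfl⟩
    exact Submodule.subset_span ⟨k + k', by lia, Fin.append i i', Fin.append j j',
      (matrixTensorPower_append _ _ _ _ _).symm⟩
  exact this (Submodule.mul_mem_mul ha hb)

theorem exists_mem_wordSpan (a : FreeStarAlgebra n) : ∃ N, a ∈ wordSpan n N := by
  induction a using FreeStarAlgebra.induction with
  | scalar c =>
    refine ⟨1, ?_⟩
    rw [Algebra.algebraMap_eq_smul_one]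
    exact Submodule.smul_mem _ _ (Submodule.subset_span ⟨0, one_pos, finZeroElim, finZeroElim,
      (matrixTensorPower_zero _ _ _).symm⟩)
  | gen i j =>
    exact ⟨2, Submodule.subset_span ⟨1, one_lt_two, fun _ => i, fun _ => j,
      (matrixTensorPower_one (x n) (fun _ => i) (fun _ => j)).symm⟩⟩
  | mul a b ha hb =>
    obtain ⟨N, hN⟩ := ha
    obtain ⟨N', hN'⟩ := hb
    exact ⟨N + N', mul_mem_wordSpan hN hN'⟩
  | add a b ha hb =>
    obtain ⟨N, hN⟩ := ha
    obtain ⟨N', hN'⟩ := hb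
    exact ⟨N + N', add_mem (wordSpan_mono (by lia) hN) (wordSpan_mono (by lia) hN')⟩

/-- The span of the relations of the partitions with fewer than `N` points in each row. -/
noncomputable def relationSpanLT (P : PartitionFamily) (n N : ℕ) :
    Submodule ℂ (FreeStarAlgebra n) :=
  Submodule.span ℂ {a | ∃ (k l : ℕ) (p : TwoRowPartition k l) (j : Fin l → Fin n)
    (i : Fin k → Fin n), k < N ∧ l < N ∧ p ∈ P k l ∧ a = defect (x n) (partitionMap n p) j i}

theorem relationSpanLT_mono {P : PartitionFamily} {N N' : ℕ} (h : N ≤ N') :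
    relationSpanLT P n N ≤ relationSpanLT P n N' :=
  Submodule.span_mono fun _ ⟨k, l, p, j, i, hk, hl, h'⟩ =>
    ⟨k, l, p, j, i, hk.trans_le h, hl.trans_le h, h'⟩

theorem exists_mem_relationSpanLT {P : PartitionFamily} {a : FreeStarAlgebra n}
    (ha : a ∈ relationSpan P n) : ∃ N, a ∈ relationSpanLT P n N := by
  induction ha using Submodule.span_induction with
  | zero => exact ⟨0, Submodule.zero_mem _⟩
  | add b b' _ _ hb hb' =>
    obtain ⟨N, hN⟩ := hb
    obtain ⟨N', hN'⟩ := hb'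
    exact ⟨N + N', add_mem (relationSpanLT_mono (by lia) hN) (relationSpanLT_mono (by lia) hN')⟩
  | smul c b _ hb =>
    obtain ⟨N, hN⟩ := hb
    exact ⟨N, Submodule.smul_mem _ _ hN⟩
  | mem b hb =>
    obtain ⟨k, l, p, j, i, hp, rfl⟩ := hb
    exact ⟨k + l + 1, Submodule.subset_span ⟨k, l, p, j, i, by lia, by lia, hp, rfl⟩⟩

end FreeStarAlgebra

section partitionSpan

variable {P : PartitionFamily} {n k l m : ℕ}

/-- The span of the linear maps of the partitions of a family. -/
def partitionSpan (P : PartitionFamily) (n k l : ℕ) :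
    Submodule ℂ (Matrix (Fin l → Fin n) (Fin k → Fin n) ℂ) :=
  Submodule.span ℂ (partitionMap n '' P k l)

theorem IsFullCategory.mul_mem_partitionSpan (hP : IsFullCategory P)
    {S : Matrix (Fin m → Fin n) (Fin l → Fin n) ℂ} {T : Matrix (Fin l → Fin n) (Fin k → Fin n) ℂ}
    (hS : S ∈ partitionSpan P n l m) (hT : T ∈ partitionSpan P n k l) :
    S * T ∈ partitionSpan P n k m := by
  induction hS using Submodule.span_induction with
  | zero => simp
  | add S S' _ _ hS hS' =>
    rw [Matrix.add_mul]
    exact add_mem hS hS'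
  | smul c S _ hS =>
    rw [Matrix.smul_mul]
    exact Submodule.smul_mem _ _ hS
  | mem S hS =>
    obtain ⟨q, hq, rfl⟩ := hS
    induction hT using Submodule.span_induction with
    | zero => simp
    | add T T' _ _ hT hT' =>
      rw [Matrix.mul_add]
      exact add_mem hT hT'
    | smul c T _ hT =>
      rw [Matrix.mul_smul]
      exact Submodule.smul_mem _ _ hT
    | mem T hT =>
      obtain ⟨p, hp, rfl⟩ := hT
      obtain ⟨c, -, hc⟩ := sum_partitionMap_mul (n := n) p q
      have : partitionMap n q * partitionMap n p = (c : ℂ) • partitionMap n (compose p q) := by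
        ext j i
        rw [Matrix.mul_apply, hc, Matrix.smul_apply, smul_eq_mul]
      rw [this]
      exact Submodule.smul_mem _ _ (Submodule.subset_span ⟨_, hP.compose_mem _ _ hp hq, rfl⟩)

theorem IsFullCategory.conjTranspose_mem_partitionSpan (hP : IsFullCategory P)
    {T : Matrix (Fin l → Fin n) (Fin k → Fin n) ℂ} (hT : T ∈ partitionSpan P n k l) :
    T.conjTranspose ∈ partitionSpan P n l k := by
  induction hT using Submodule.span_induction with
  | zero => simp
  | add T T' _ _ hT hT' =>
    rw [Matrix.conjTranspose_add]
    exact add_mem hT hT'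
  | smul c T _ hT =>
    rw [Matrix.conjTranspose_smul]
    exact Submodule.smul_mem _ _ hT
  | mem T hT =>
    obtain ⟨p, hp, rfl⟩ := hT
    rw [← partitionMap_involution_eq]
    exact Submodule.subset_span ⟨_, hP.involution_mem _ hp, rfl⟩

theorem IsFullCategory.exists_partitionMap_eq_one (hP : IsFullCategory P) (n k : ℕ) :
    ∃ p ∈ P k k, partitionMap n p = 1 := by
  induction k with
  | zero =>
    -- The empty partition arises by closing the pair partition to a loop.
    refine ⟨_, hP.compose_mem _ _ hP.pair_mem (hP.involution_mem _ hP.pair_mem), ?_⟩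
    ext j i
    rw [partitionMap_apply, if_pos, Subsingleton.elim j i, Matrix.one_apply_eq]
    rintro (x | x) <;> exact x.elim0
  | succ k ih =>
    obtain ⟨p, hp, h⟩ := ih
    refine ⟨_, hP.tensor_mem _ _ hp hP.unit_mem, ?_⟩
    ext f g
    obtain ⟨j, j', rfl⟩ := exists_eq_append (k := k) (k' := 1) f
    obtain ⟨i, i', rfl⟩ := exists_eq_append (k := k) (k' := 1) g
    rw [partitionMap_tensor, h, partitionMap_unit]
    have hinj : Fin.append j j' = Fin.append i i' ↔ j = i ∧ j' = i' := by
      rw [← Prod.mk.injEq]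
      exact (Fin.appendEquiv (α := Fin n) k 1).injective.eq_iff (a := (j, j')) (b := (i, i'))
    simp only [Matrix.one_apply, hinj]
    split_ifs <;> simp_all

theorem IsFullCategory.one_mem_partitionSpan (hP : IsFullCategory P) (n k : ℕ) :
    1 ∈ partitionSpan P n k k := by
  obtain ⟨p, hp, h⟩ := hP.exists_partitionMap_eq_one n k
  exact h ▸ Submodule.subset_span ⟨p, hp, rfl⟩

/-- The index set of the sum of the first `N` tensor powers. -/
abbrev TensorIndex (n N : ℕ) : Type := Σ k : Fin N, (Fin (k : ℕ) → Fin n)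

/-- The blocks of a matrix that acts on the sum of the first `N` tensor powers. -/
def tensorBlock {N : ℕ} (B : Matrix (TensorIndex n N) (TensorIndex n N) ℂ) (k l : Fin N) :
    Matrix (Fin (l : ℕ) → Fin n) (Fin (k : ℕ) → Fin n) ℂ :=
  Matrix.of fun j i => B ⟨l, j⟩ ⟨k, i⟩

theorem tensorBlock_mul {N : ℕ} (B C : Matrix (TensorIndex n N) (TensorIndex n N) ℂ)
    (k l : Fin N) :
    tensorBlock (B * C) k l = ∑ m, tensorBlock B m l * tensorBlock C k m := by
  ext j i
  rw [Matrix.sum_apply]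
  simp only [tensorBlock, Matrix.of_apply, Matrix.mul_apply, Fintype.sum_sigma]

theorem tensorBlock_algebraMap_self {N : ℕ} (c : ℂ) (k : Fin N) :
    tensorBlock (algebraMap ℂ (Matrix (TensorIndex n N) (TensorIndex n N) ℂ) c) k k =
      c • (1 : Matrix (Fin (k : ℕ) → Fin n) (Fin (k : ℕ) → Fin n) ℂ) := by
  rw [Algebra.algebraMap_eq_smul_one]
  ext j i
  simp [tensorBlock, Matrix.one_apply]

theorem tensorBlock_algebraMap_of_ne {N : ℕ} (c : ℂ) {k l : Fin N} (h : k ≠ l) :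
    tensorBlock (algebraMap ℂ (Matrix (TensorIndex n N) (TensorIndex n N) ℂ) c) k l = 0 := by
  rw [Algebra.algebraMap_eq_smul_one]
  ext j i
  simp [tensorBlock, h.symm]

/-- The algebra of all endomorphisms of the sum of the first `N` tensor powers whose blocks lie
in the spans of the linear maps of the partitions of a full category. -/
def categoryAlgebra (hP : IsFullCategory P) (n N : ℕ) :
    StarSubalgebra ℂ (Matrix (TensorIndex n N) (TensorIndex n N) ℂ) where
  carrier := {B | ∀ k l : Fin N, tensorBlock B k l ∈ partitionSpan P n k l}
  mul_mem' {B C} hB hC k l := by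
    rw [tensorBlock_mul]
    exact sum_mem fun m _ => hP.mul_mem_partitionSpan (hB m l) (hC k m)
  add_mem' {B C} hB hC k l := add_mem (hB k l) (hC k l)
  algebraMap_mem' c k l := by
    rcases eq_or_ne k l with rfl | h
    · rw [tensorBlock_algebraMap_self]
      exact Submodule.smul_mem _ _ (hP.one_mem_partitionSpan n k)
    · rw [tensorBlock_algebraMap_of_ne c h]
      exact Submodule.zero_mem _
  star_mem' {B} hB k l := hP.conjTranspose_mem_partitionSpan (hB l k)

/-- The matrix with one prescribed block and zeros elsewhere. -/
def ofBlock {N : ℕ} (k l : Fin N) (T : Matrix (Fin (l : ℕ) → Fin n) (Fin (k : ℕ) → Fin n) ℂ) :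
    Matrix (TensorIndex n N) (TensorIndex n N) ℂ :=
  Matrix.of fun y x => if h : y.1 = l ∧ x.1 = k then
    T (fun t => y.2 (Fin.cast (by rw [h.1]) t)) (fun t => x.2 (Fin.cast (by rw [h.2]) t)) else 0

theorem ofBlock_apply {N : ℕ} (k l : Fin N)
    (T : Matrix (Fin (l : ℕ) → Fin n) (Fin (k : ℕ) → Fin n) ℂ) (j : Fin (l : ℕ) → Fin n)
    (i : Fin (k : ℕ) → Fin n) : ofBlock k l T ⟨l, j⟩ ⟨k, i⟩ = T j i := by
  simp [ofBlock]

theorem ofBlock_apply_of_ne {N : ℕ} {k l : Fin N}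
    (T : Matrix (Fin (l : ℕ) → Fin n) (Fin (k : ℕ) → Fin n) ℂ) {y x : TensorIndex n N}
    (h : ¬ (y.1 = l ∧ x.1 = k)) : ofBlock k l T y x = 0 := by
  simp only [ofBlock, Matrix.of_apply, dif_neg h]

theorem ofBlock_mem_categoryAlgebra {hP : IsFullCategory P} {N : ℕ} (k l : Fin N)
    {T : Matrix (Fin (l : ℕ) → Fin n) (Fin (k : ℕ) → Fin n) ℂ} (hT : T ∈ partitionSpan P n k l) :
    ofBlock k l T ∈ categoryAlgebra hP n N := by
  intro k' l'
  by_cases h : l' = l ∧ k' = k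
  · obtain ⟨rfl, rfl⟩ := h
    have : tensorBlock (ofBlock k' l' T) k' l' = T := by
      ext j i
      exact ofBlock_apply _ _ _ _ _
    rwa [this]
  · have : tensorBlock (ofBlock k l T) k' l' = 0 := by
      ext j i
      exact ofBlock_apply_of_ne T h
    rw [this]
    exact Submodule.zero_mem _

theorem ofBlock_mul_blockDiagonal {N : ℕ} (k l : Fin N)
    (T : Matrix (Fin (l : ℕ) → Fin n) (Fin (k : ℕ) → Fin n) ℂ)
    (D : ∀ k : Fin N, Matrix (Fin (k : ℕ) → Fin n) (Fin (k : ℕ) → Fin n) ℂ) :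
    ofBlock k l T * Matrix.blockDiagonal' D = ofBlock k l (T * D k) := by
  ext ⟨l', j⟩ ⟨k', i⟩
  rw [Matrix.mul_apply, Fintype.sum_sigma]
  rw [Fintype.sum_eq_single k']
  · simp only [Matrix.blockDiagonal'_apply_eq]
    by_cases h : l' = l ∧ k' = k
    · obtain ⟨rfl, rfl⟩ := h
      simp only [ofBlock_apply, Matrix.mul_apply]
    · rw [ofBlock_apply_of_ne _ h]
      exact Finset.sum_eq_zero fun a _ => by rw [ofBlock_apply_of_ne _ h, zero_mul]
  · intro m hm
    exact Finset.sum_eq_zero fun a _ => by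
      rw [Matrix.blockDiagonal'_apply_ne D _ _ hm, mul_zero]

theorem blockDiagonal_mul_ofBlock {N : ℕ} (k l : Fin N)
    (T : Matrix (Fin (l : ℕ) → Fin n) (Fin (k : ℕ) → Fin n) ℂ)
    (D : ∀ k : Fin N, Matrix (Fin (k : ℕ) → Fin n) (Fin (k : ℕ) → Fin n) ℂ) :
    Matrix.blockDiagonal' D * ofBlock k l T = ofBlock k l (D l * T) := by
  ext ⟨l', j⟩ ⟨k', i⟩
  rw [Matrix.mul_apply, Fintype.sum_sigma]
  rw [Fintype.sum_eq_single l']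
  · simp only [Matrix.blockDiagonal'_apply_eq]
    by_cases h : l' = l ∧ k' = k
    · obtain ⟨rfl, rfl⟩ := h
      simp only [ofBlock_apply, Matrix.mul_apply]
    · rw [ofBlock_apply_of_ne _ h]
      exact Finset.sum_eq_zero fun a _ => by rw [ofBlock_apply_of_ne _ h, mul_zero]
  · intro m hm
    exact Finset.sum_eq_zero fun a _ => by
      rw [Matrix.blockDiagonal'_apply_ne D _ _ hm.symm, zero_mul]

theorem ofBlock_injective {N : ℕ} (k l : Fin N) :
    Function.Injective (ofBlock (n := n) k l) := by
  intro S T h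
  ext j i
  rw [← ofBlock_apply k l S, h, ofBlock_apply]

theorem tensorBlock_ofBlock {N : ℕ} (k l : Fin N)
    (T : Matrix (Fin (l : ℕ) → Fin n) (Fin (k : ℕ) → Fin n) ℂ) :
    tensorBlock (ofBlock k l T) k l = T := by
  ext j i
  exact ofBlock_apply _ _ _ _ _

theorem ofBlock_one_mul {N : ℕ} (k : Fin N) (Y : Matrix (TensorIndex n N) (TensorIndex n N) ℂ)
    (i : Fin (k : ℕ) → Fin n) (y : TensorIndex n N) :
    (ofBlock k k (1 : Matrix (Fin (k : ℕ) → Fin n) (Fin (k : ℕ) → Fin n) ℂ) * Y) ⟨k, i⟩ y =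
      Y ⟨k, i⟩ y := by
  rw [Matrix.mul_apply, Fintype.sum_sigma, Fintype.sum_eq_single k]
  · simp [ofBlock_apply, Matrix.one_apply]
  · intro m hm
    exact Finset.sum_eq_zero fun a _ => by
      rw [ofBlock_apply_of_ne _ (fun h => hm h.2), zero_mul]

theorem mul_ofBlock_one_of_ne {N : ℕ} {k l : Fin N} (hkl : l ≠ k)
    (Y : Matrix (TensorIndex n N) (TensorIndex n N) ℂ)
    (i : Fin (l : ℕ) → Fin n) (y : TensorIndex n N) :
    (Y * ofBlock k k (1 : Matrix (Fin (k : ℕ) → Fin n) (Fin (k : ℕ) → Fin n) ℂ)) y ⟨l, i⟩ = 0 := by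
  rw [Matrix.mul_apply]
  exact Finset.sum_eq_zero fun a _ => by rw [ofBlock_apply_of_ne _ (fun h => hkl h.2), mul_zero]

/-- The commutant of the algebra of a category consists of block diagonal matrices. -/
theorem exists_eq_blockDiagonal {hP : IsFullCategory P} {N : ℕ}
    {Y : Matrix (TensorIndex n N) (TensorIndex n N) ℂ}
    (hY : ∀ s ∈ categoryAlgebra hP n N, s * Y = Y * s) :
    ∃ D : ∀ k : Fin N, Matrix (Fin (k : ℕ) → Fin n) (Fin (k : ℕ) → Fin n) ℂ,
      Y = Matrix.blockDiagonal' D := by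
  refine ⟨fun k => tensorBlock Y k k, ?_⟩
  ext ⟨k, i⟩ ⟨l, j⟩
  by_cases h : k = l
  · subst h
    rw [Matrix.blockDiagonal'_apply_eq]
    rfl
  -- `Y` commutes with the projection onto the summand `k`, which kills its entries outside the
  -- diagonal blocks.
  · rw [Matrix.blockDiagonal'_apply_ne _ _ _ h, ← ofBlock_one_mul k Y,
      hY _ (ofBlock_mem_categoryAlgebra k k (hP.one_mem_partitionSpan n k)),
      mul_ofBlock_one_of_ne (Ne.symm h)]

end partitionSpan

open FreeStarAlgebra

/-- A linear functional on the free algebra turns the relations of `T` into commutation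
relations. -/
theorem map_defect_x {n k l : ℕ} (f : FreeStarAlgebra n →ₗ[ℂ] ℂ)
    (T : Matrix (Fin l → Fin n) (Fin k → Fin n) ℂ) (j : Fin l → Fin n) (i : Fin k → Fin n) :
    f (defect (x n) T j i) =
      (T * Matrix.of fun a b => f (matrixTensorPower (x n) k a b)) j i -
      ((Matrix.of fun a b => f (matrixTensorPower (x n) l a b)) * T) j i := by
  simp [defect, Matrix.mul_apply, map_sum, map_smul, mul_comm]

/-- Tannaka–Krein duality: every linear map whose relations follow from those of the partitions
of a full category is a linear combination of the maps of the partitions. -/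
theorem mem_partitionSpan_of_defect_mem {P : PartitionFamily} (hP : IsFullCategory P) {n k l : ℕ}
    (T : Matrix (Fin l → Fin n) (Fin k → Fin n) ℂ)
    (hT : ∀ j i, defect (x n) T j i ∈ relationSpan P n) : T ∈ partitionSpan P n k l := by
  classical
  choose N hN using fun j i => exists_mem_relationSpanLT (hT j i)
  obtain ⟨N', hN'⟩ : ∃ N', ∀ j i, N j i ≤ N' :=
    ⟨∑ j, ∑ i, N j i, fun j i => (Finset.single_le_sum (f := fun i => N j i)
      (fun _ _ => Nat.zero_le _) (Finset.mem_univ i)).trans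
      (Finset.single_le_sum (f := fun j => ∑ i, N j i) (fun _ _ => Nat.zero_le _)
        (Finset.mem_univ j))⟩
  -- Large enough for the rows of `T` and for every partition needed to express its finitely many
  -- relations.
  let K := N' + k + l + 1
  let k' : Fin K := ⟨k, by lia⟩
  let l' : Fin K := ⟨l, by lia⟩
  have hmem : ofBlock (n := n) k' l' T ∈ categoryAlgebra hP n K := by
    refine Matrix.mem_of_double_commutant _ _ fun Y hY => ?_
    obtain ⟨D, rfl⟩ := exists_eq_blockDiagonal hY
    rw [ofBlock_mul_blockDiagonal, blockDiagonal_mul_ofBlock]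
    congr 1
    -- The blocks `D` prescribe a functional on words. It kills the relations of the partitions
    -- because `D` commutes with their maps; so it kills the relations of `T`, which says that `T`
    -- commutes with `D`.
    obtain ⟨f, hf⟩ := exists_linearMap (n := n)
      (fun k i j => if h : k < K then D ⟨k, h⟩ i j else 0)
    have hfD : ∀ (m : Fin K), (Matrix.of fun a b => f (matrixTensorPower (x n) m a b)) = D m := by
      intro m
      ext a b
      rw [Matrix.of_apply, hf, dif_pos m.2]
    have hle : relationSpanLT P n K ≤ LinearMap.ker f := by
      rw [relationSpanLT, Submodule.span_le]
      rintro _ ⟨a, b, p, j, i, ha, hb, hp, rfl⟩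
      change f _ = 0
      have h1 := hY _ (ofBlock_mem_categoryAlgebra (⟨a, ha⟩ : Fin K) ⟨b, hb⟩
        (Submodule.subset_span ⟨p, hp, rfl⟩))
      rw [ofBlock_mul_blockDiagonal, blockDiagonal_mul_ofBlock] at h1
      rw [map_defect_x, hfD ⟨a, ha⟩, hfD ⟨b, hb⟩, sub_eq_zero]
      exact congrFun (congrFun (ofBlock_injective _ _ h1) j) i
    ext j i
    have h2 : f (defect (x n) T j i) = 0 :=
      hle (relationSpanLT_mono ((hN' j i).trans (by lia)) (hN j i))
    rw [map_defect_x, sub_eq_zero] at h2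
    rw [← hfD k', ← hfD l']
    exact h2
  have := hmem k' l'
  rwa [tensorBlock_ofBlock] at this

open scoped TensorProduct

theorem matrixTensorPower_tmul {A B : Type*} [Ring A] [Algebra ℂ A] [Ring B] [Algebra ℂ B]
    {n k : ℕ} (M : Matrix (Fin n) (Fin n) A) (N : Matrix (Fin n) (Fin n) B)
    (i j : Fin k → Fin n) :
    matrixTensorPower (Matrix.of fun i j => ∑ s, M i s ⊗ₜ[ℂ] N s j) k i j =
      ∑ s, matrixTensorPower M k i s ⊗ₜ[ℂ] matrixTensorPower N k s j := by
  induction k with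
  | zero => simp [matrixTensorPower_zero, Algebra.TensorProduct.one_def]
  | succ k ih =>
    obtain ⟨a, i, rfl⟩ := exists_eq_cons i
    obtain ⟨b, j, rfl⟩ := exists_eq_cons j
    rw [matrixTensorPower_cons, ih, Matrix.of_apply, Finset.sum_mul_sum, sum_cons]
    simp only [matrixTensorPower_cons, Algebra.TensorProduct.tmul_mul_tmul]

theorem matrixTensorPower_op {A : Type*} [Ring A] [StarRing A] {n k : ℕ}
    {M : Matrix (Fin n) (Fin n) A} (hs : ∀ i j, star (M i j) = M i j) (i j : Fin k → Fin n) :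
    matrixTensorPower (Matrix.of fun i j => MulOpposite.op (M j i)) k i j =
      MulOpposite.op (star (matrixTensorPower M k j i)) := by
  induction k with
  | zero => simp [matrixTensorPower_zero]
  | succ k ih =>
    obtain ⟨a, i, rfl⟩ := exists_eq_cons i
    obtain ⟨b, j, rfl⟩ := exists_eq_cons j
    rw [matrixTensorPower_cons, ih, matrixTensorPower_cons, star_mul, hs, MulOpposite.op_mul]
    rfl

section blockDiagonal

variable {n N : ℕ} (D : ∀ k : Fin N, Matrix (Fin (k : ℕ) → Fin n) (Fin (k : ℕ) → Fin n) ℂ)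
  (Y : Matrix (TensorIndex n N) (TensorIndex n N) ℂ) (k l : Fin N)

theorem tensorBlock_mul_blockDiagonal :
    tensorBlock (Y * Matrix.blockDiagonal' D) k l = tensorBlock Y k l * D k := by
  ext j i
  rw [tensorBlock, Matrix.of_apply, Matrix.mul_apply, Fintype.sum_sigma,
    Fintype.sum_eq_single k, Matrix.mul_apply]
  · simp only [Matrix.blockDiagonal'_apply_eq]
    rfl
  · intro m hm
    exact Finset.sum_eq_zero fun a _ => by
      rw [Matrix.blockDiagonal'_apply_ne D _ _ hm, mul_zero]

theorem tensorBlock_blockDiagonal_mul :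
    tensorBlock (Matrix.blockDiagonal' D * Y) k l = D l * tensorBlock Y k l := by
  ext j i
  rw [tensorBlock, Matrix.of_apply, Matrix.mul_apply, Fintype.sum_sigma,
    Fintype.sum_eq_single l, Matrix.mul_apply]
  · simp only [Matrix.blockDiagonal'_apply_eq]
    rfl
  · intro m hm
    exact Finset.sum_eq_zero fun a _ => by
      rw [Matrix.blockDiagonal'_apply_ne D _ _ hm.symm, zero_mul]

variable {Y}

theorem tensorBlock_ext {Y' : Matrix (TensorIndex n N) (TensorIndex n N) ℂ}
    (h : ∀ k l : Fin N, tensorBlock Y k l = tensorBlock Y' k l) : Y = Y' := by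
  ext ⟨l, j⟩ ⟨k, i⟩
  exact congrFun (congrFun (h k l) j) i

end blockDiagonal

/-! ### Tannaka–Krein duality: from intertwiners to relations -/

namespace MatrixStarAlgebra

variable {n : ℕ} {G : MatrixStarAlgebra.{u} n}

/-- The values of a linear functional on the entries of the first `N` tensor powers. -/
def coefficientMatrix (G : MatrixStarAlgebra.{u} n) (N : ℕ) (ψ : G.carrier →ₗ[ℂ] ℂ) :
    Matrix (TensorIndex n N) (TensorIndex n N) ℂ :=
  Matrix.blockDiagonal' fun k : Fin N => (matrixTensorPower G.u k).map ψ

/-- The comultiplication provides the convolution of functionals, which corresponds to the product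
of their matrices. Likewise the counit gives the scalars, and the antipode combined with `star`
gives the adjoints. -/
theorem exists_coefficientMatrix_mul (hG : G.IsOrthogonalQuantumGroup) {N : ℕ}
    (ψ φ : G.carrier →ₗ[ℂ] ℂ) :
    ∃ χ, coefficientMatrix G N ψ * coefficientMatrix G N φ = coefficientMatrix G N χ := by
  obtain ⟨Δ, hΔ⟩ := hG.comultiplication
  refine ⟨LinearMap.mul' ℂ ℂ ∘ₗ TensorProduct.map ψ φ ∘ₗ Δ.toAlgHom.toLinearMap, ?_⟩
  rw [coefficientMatrix, coefficientMatrix, ← Matrix.blockDiagonal'_mul, coefficientMatrix]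
  congr 1
  funext k
  ext i j
  have h : Δ (matrixTensorPower G.u k i j) =
      ∑ s, matrixTensorPower G.u k i s ⊗ₜ[ℂ] matrixTensorPower G.u k s j := by
    rw [map_matrixTensorPower, ← matrixTensorPower_tmul]
    congr 1
    ext a b
    exact hΔ a b
  change _ = LinearMap.mul' ℂ ℂ (TensorProduct.map ψ φ (Δ (matrixTensorPower G.u k i j)))
  rw [h, map_sum, map_sum, Matrix.mul_apply]
  rfl

theorem exists_coefficientMatrix_star (hG : G.IsOrthogonalQuantumGroup) {N : ℕ}
    (ψ : G.carrier →ₗ[ℂ] ℂ) :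
    ∃ χ, star (coefficientMatrix G N ψ) = coefficientMatrix G N χ := by
  obtain ⟨S, hS⟩ := hG.antipode
  -- The two conjugations compensate each other, so `χ` is linear; on coefficients the antipode and
  -- `star` together just transpose the indices.
  let χ : G.carrier →ₗ[ℂ] ℂ :=
    { toFun := fun a => star (ψ (star (S a).unop))
      map_add' := fun a b => by simp
      map_smul' := fun c a => by simp }
  refine ⟨χ, ?_⟩
  rw [coefficientMatrix, Matrix.star_eq_conjTranspose, Matrix.blockDiagonal'_conjTranspose,
    coefficientMatrix]
  congr 1
  funext k
  ext i j
  have h : S (matrixTensorPower G.u k i j) =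
      MulOpposite.op (star (matrixTensorPower G.u k j i)) := by
    rw [map_matrixTensorPower, ← matrixTensorPower_op hG.selfAdjoint]
    congr 1
    ext a b
    exact hS a b
  change _ = star (ψ (star (S (matrixTensorPower G.u k i j)).unop))
  rw [h, MulOpposite.unop_op, star_star]
  rfl

theorem exists_coefficientMatrix_algebraMap (hG : G.IsOrthogonalQuantumGroup) {N : ℕ} (c : ℂ) :
    ∃ χ, algebraMap ℂ (Matrix (TensorIndex n N) (TensorIndex n N) ℂ) c =
      coefficientMatrix G N χ := by
  obtain ⟨ε, hε⟩ := hG.counit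
  refine ⟨c • ε.toAlgHom.toLinearMap, ?_⟩
  rw [Algebra.algebraMap_eq_smul_one, ← Matrix.blockDiagonal'_one, ← Matrix.blockDiagonal'_smul,
    coefficientMatrix]
  congr 1
  funext k
  ext i j
  change _ = c * ε (matrixTensorPower G.u k i j)
  have h : G.u.map ε = 1 := by
    ext a b
    rw [Matrix.map_apply, hε, Matrix.one_apply]
  rw [map_matrixTensorPower, h, matrixTensorPower_id, Pi.smul_apply, Matrix.smul_apply,
    Pi.one_apply, Matrix.one_apply, smul_eq_mul]

/-- The algebra dual to the coalgebra of the coefficients of the first `N` tensor powers. -/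
def coefficientAlgebra (hG : G.IsOrthogonalQuantumGroup) (N : ℕ) :
    StarSubalgebra ℂ (Matrix (TensorIndex n N) (TensorIndex n N) ℂ) where
  carrier := {B | ∃ ψ, B = coefficientMatrix G N ψ}
  mul_mem' := by
    rintro _ _ ⟨ψ, rfl⟩ ⟨φ, rfl⟩
    exact exists_coefficientMatrix_mul hG ψ φ
  add_mem' := by
    rintro _ _ ⟨ψ, rfl⟩ ⟨φ, rfl⟩
    refine ⟨ψ + φ, ?_⟩
    rw [coefficientMatrix, coefficientMatrix, ← Matrix.blockDiagonal'_add]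
    rfl
  algebraMap_mem' c := exists_coefficientMatrix_algebraMap hG c
  star_mem' := by
    rintro _ ⟨ψ, rfl⟩
    exact exists_coefficientMatrix_star hG ψ

/-- Linear functionals separate the elements of the algebra, so it suffices to test the intertwining
relation after applying each of them. -/
theorem isIntertwiner_tensorBlock {N : ℕ}
    {Y : Matrix (TensorIndex n N) (TensorIndex n N) ℂ}
    (hY : ∀ ψ, coefficientMatrix G N ψ * Y = Y * coefficientMatrix G N ψ) (k l : Fin N) :
    IsIntertwiner G.u (tensorBlock Y k l) := by
  intro j i
  rw [← sub_eq_zero, ← Module.forall_dual_apply_eq_zero_iff ℂ]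
  intro ψ
  have h := congrArg (fun B => tensorBlock B k l) (hY ψ)
  simp only [coefficientMatrix, tensorBlock_mul_blockDiagonal,
    tensorBlock_blockDiagonal_mul] at h
  have := congrFun (congrFun h j) i
  simp only [Matrix.mul_apply, Matrix.map_apply] at this
  simp only [map_sub, map_sum, map_smul, smul_eq_mul, this, mul_comm (tensorBlock Y k l _ i)]
  exact sub_self _

open FreeStarAlgebra

/-- All relations between the coefficients of a quantum group follow from the intertwining
relations of the partitions of a full category whose linear maps span the intertwiner spaces. -/
theorem mem_relationSpan_of_lift_eq_zero (hG : G.IsOrthogonalQuantumGroup) {P : PartitionFamily}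
    (hP : ∀ k l, ∀ T, IsIntertwiner G.u T → T ∈ partitionSpan P n k l)
    {a : FreeStarAlgebra n} (ha : lift G.u a = 0) : a ∈ relationSpan P n := by
  by_contra hn
  -- A functional vanishing on all relations but not on `a`; its matrices `F` of values on words
  -- commute with all maps of `P`.
  obtain ⟨f, hfa, hf⟩ := Submodule.exists_le_ker_of_notMem hn
  obtain ⟨N, hN⟩ := exists_mem_wordSpan a
  let F : ∀ k, Matrix (Fin k → Fin n) (Fin k → Fin n) ℂ :=
    fun k => (Matrix.of fun a b => f (matrixTensorPower (x n) k a b))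
  have hF : ∀ k l, ∀ T ∈ partitionSpan P n k l, T * F k = F l * T := by
    intro k l T hT
    induction hT using Submodule.span_induction with
    | zero => rw [Matrix.zero_mul, Matrix.mul_zero]
    | add S T _ _ hS hT => rw [Matrix.add_mul, Matrix.mul_add, hS, hT]
    | smul c T _ hT => rw [Matrix.smul_mul, Matrix.mul_smul, hT]
    | mem T hT =>
      obtain ⟨p, hp, rfl⟩ := hT
      ext j i
      rw [← sub_eq_zero, ← map_defect_x]
      exact hf (defect_mem_relationSpan hp j i)
  -- The commutant of the coefficient algebra consists of intertwiners, with which `F` commutes. By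
  -- the double commutant theorem `F` comes from a functional `ψ` on `G.carrier`, so `f` factors
  -- through `lift G.u` on words of length less than `N` and vanishes at `a`.
  obtain ⟨ψ, hψ⟩ : Matrix.blockDiagonal' (fun k : Fin N => F k) ∈ coefficientAlgebra hG N := by
    refine Matrix.mem_of_double_commutant _ _ fun Y hY => tensorBlock_ext fun k l => ?_
    rw [tensorBlock_mul_blockDiagonal, tensorBlock_blockDiagonal_mul]
    exact (hF _ _ _ (hP _ _ _ (isIntertwiner_tensorBlock (fun ψ => hY _ ⟨ψ, rfl⟩) k l))).symm
  have hψ' : ∀ k, k < N → ∀ i j, f (matrixTensorPower (x n) k i j) =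
      ψ (matrixTensorPower G.u k i j) := by
    intro k hk i j
    exact congrFun (congrFun (congrFun (Matrix.blockDiagonal'_injective hψ) ⟨k, hk⟩) i) j
  have hle : wordSpan n N ≤ LinearMap.ker (f - ψ ∘ₗ (lift G.u).toLinearMap) := by
    rw [wordSpan, Submodule.span_le]
    rintro _ ⟨k, hk, i, j, rfl⟩
    change f _ - ψ (lift G.u _) = 0
    rw [map_matrixTensorPower (lift G.u), map_lift_x, hψ' k hk, sub_self]
  have h : f a - ψ (lift G.u a) = 0 := hle hN
  rw [ha, map_zero, sub_zero] at h
  exact hfa h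

end MatrixStarAlgebra

/-! ### Intertwiners and the Hopf structure; the symmetric group -/

section IsIntertwiner

variable {n k l : ℕ} {A : Type*} [Ring A] [Algebra ℂ A] {M : Matrix (Fin n) (Fin n) A}

/-- The intertwiner condition for the pair partition turned upside down. -/
theorem isIntertwiner_involution_pair_iff : IsIntertwiner M (partitionMap n (involution pair)) ↔
    ∀ i j, ∑ k, M k i * M k j = if i = j then 1 else 0 := by
  have hT : ∀ (a b : Fin n) (i : Fin 0 → Fin n),
      partitionMap n (involution pair) i (Fin.cons a (Fin.cons b finZeroElim)) =
        if a = b then 1 else 0 := by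
    intro a b i
    rw [partitionMap_involution, partitionMap_pair]
  have key : ∀ (a b : Fin n) (i : Fin 0 → Fin n),
      (∑ x, partitionMap n (involution pair) i x •
        matrixTensorPower M 2 x (Fin.cons a (Fin.cons b finZeroElim)) =
        ∑ x, partitionMap n (involution pair) x (Fin.cons a (Fin.cons b finZeroElim)) •
        matrixTensorPower M 0 i x) ↔
      ∑ k, M k a * M k b = if a = b then 1 else 0 := by
    intro a b i
    rw [sum_cons (k := 1)]
    simp only [sum_cons (k := 0), Fintype.sum_unique, Unique.eq_default (α := Fin 0 → Fin n)]
    have : (default : Fin 0 → Fin n) = finZeroElim := Subsingleton.elim _ _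
    simp only [this, hT, matrixTensorPower_cons, matrixTensorPower_zero, mul_one]
    simp
  constructor
  · intro h a b
    exact (key a b finZeroElim).1 (h _ _)
  · intro h i j
    obtain ⟨a, j, rfl⟩ := exists_eq_cons j
    obtain ⟨b, j, rfl⟩ := exists_eq_cons j
    obtain rfl := Subsingleton.elim j finZeroElim
    exact (key a b i).2 (h a b)

/-- `T` is carried through the first tensor factor and then through the second. With
`isIntertwiner_one` and `isIntertwiner_op` this makes the relations compatible with
comultiplication, counit and antipode. -/
theorem isIntertwiner_tmul {B : Type*} [Ring B] [Algebra ℂ B] {L : Matrix (Fin n) (Fin n) B}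
    {T : Matrix (Fin l → Fin n) (Fin k → Fin n) ℂ} (hM : IsIntertwiner M T)
    (hL : IsIntertwiner L T) :
    IsIntertwiner (Matrix.of fun i j => ∑ s, M i s ⊗ₜ[ℂ] L s j) T := by
  intro j i
  simp only [matrixTensorPower_tmul, Finset.smul_sum]
  calc ∑ a, ∑ s, T j a • (matrixTensorPower M k a s ⊗ₜ[ℂ] matrixTensorPower L k s i)
      = ∑ s, (∑ a, T j a • matrixTensorPower M k a s) ⊗ₜ[ℂ] matrixTensorPower L k s i := by
        rw [Finset.sum_comm]
        simp only [TensorProduct.sum_tmul, TensorProduct.smul_tmul']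
    _ = ∑ s, (∑ b, T b s • matrixTensorPower M l j b) ⊗ₜ[ℂ] matrixTensorPower L k s i := by
        simp only [hM j]
    _ = ∑ b, matrixTensorPower M l j b ⊗ₜ[ℂ] ∑ s, T b s • matrixTensorPower L k s i := by
        simp only [TensorProduct.sum_tmul, TensorProduct.tmul_sum, TensorProduct.smul_tmul]
        exact Finset.sum_comm
    _ = ∑ b, matrixTensorPower M l j b ⊗ₜ[ℂ] ∑ c, T c i • matrixTensorPower L l b c := by
        simp only [hL _ i]
    _ = ∑ c, ∑ b, T c i • (matrixTensorPower M l j b ⊗ₜ[ℂ] matrixTensorPower L l b c) := by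
        simp only [TensorProduct.tmul_sum, TensorProduct.tmul_smul]
        exact Finset.sum_comm

theorem isIntertwiner_one (T : Matrix (Fin l → Fin n) (Fin k → Fin n) ℂ) :
    IsIntertwiner (1 : Matrix (Fin n) (Fin n) A) T := by
  intro j i
  simp [matrixTensorPower_id]

theorem isIntertwiner_op {A : Type*} [Ring A] [StarRing A] [Algebra ℂ A] [StarModule ℂ A]
    {M : Matrix (Fin n) (Fin n) A} (hs : ∀ i j, star (M i j) = M i j) {p : TwoRowPartition k l}
    (hp : IsIntertwiner M (partitionMap n (involution p))) :
    IsIntertwiner (Matrix.of fun i j => MulOpposite.op (M j i)) (partitionMap n p) := by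
  intro j i
  simp only [matrixTensorPower_op hs]
  have h := congrArg (fun a => MulOpposite.op (star a)) (hp i j)
  simp only [star_sum, star_smul, star_partitionMap, Finset.op_sum, MulOpposite.op_smul,
    partitionMap_involution] at h
  exact h.symm

theorem matrixTensorPower_perm (g : Equiv.Perm (Fin n)) (i j : Fin k → Fin n) :
    matrixTensorPower (Matrix.of fun i j => if g i = j then (1 : ℂ) else 0) k i j =
      if g ∘ i = j then 1 else 0 := by
  induction k with
  | zero => simp [matrixTensorPower_zero, Subsingleton.elim (g ∘ i) j]
  | succ k ih =>
    obtain ⟨a, i, rfl⟩ := exists_eq_cons i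
    obtain ⟨b, j, rfl⟩ := exists_eq_cons j
    rw [matrixTensorPower_cons, ih, Matrix.of_apply, Fin.comp_cons]
    simp only [Fin.cons_inj]
    split_ifs <;> simp_all

theorem partitionMap_perm (g : Equiv.Perm (Fin n)) (p : TwoRowPartition k l) (j : Fin l → Fin n)
    (i : Fin k → Fin n) : partitionMap n p (g ∘ j) (g ∘ i) = partitionMap n p j i := by
  classical
  rw [partitionMap_apply, partitionMap_apply, ← Sum.comp_elim]
  have : Setoid.ker (g ∘ Sum.elim i j) = Setoid.ker (Sum.elim i j) :=
    Setoid.ext fun x y => g.injective.eq_iff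
  rw [this]

/-- The entries of `T_p` depend only on which indices coincide, so they are invariant under
permutations of the basis. -/
theorem isIntertwiner_perm (g : Equiv.Perm (Fin n)) (p : TwoRowPartition k l) :
    IsIntertwiner (Matrix.of fun i j => if g i = j then (1 : ℂ) else 0) (partitionMap n p) := by
  intro j i
  obtain ⟨i, rfl⟩ : ∃ i', i = g ∘ i' := ⟨g.symm ∘ i, by ext; simp⟩
  have hinj : ∀ a : Fin k → Fin n, g ∘ a = g ∘ i ↔ a = i := fun a => g.injective.comp_left.eq_iff
  simp only [matrixTensorPower_perm, hinj, smul_eq_mul, mul_ite, mul_one, mul_zero,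
    Finset.sum_ite_eq, Finset.sum_ite_eq', Finset.mem_univ, if_true, partitionMap_perm]

/-- The coordinate functions on the symmetric group. -/
def permutationFunctions (n : ℕ) : Matrix (Fin n) (Fin n) (Equiv.Perm (Fin n) → ℂ) :=
  Matrix.of fun i j g => if g i = j then 1 else 0

theorem isIntertwiner_permutationFunctions (p : TwoRowPartition k l) :
    IsIntertwiner (permutationFunctions n) (partitionMap n p) := by
  intro j i
  funext g
  have h : ∀ k (i j : Fin k → Fin n), matrixTensorPower (permutationFunctions n) k i j g =
      matrixTensorPower (Matrix.of fun i j => if g i = j then (1 : ℂ) else 0) k i j :=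
    fun k i j =>
      map_matrixTensorPower (Pi.evalRingHom (fun _ : Equiv.Perm (Fin n) => ℂ) g) _ i j
  simpa only [Finset.sum_apply, Pi.smul_apply, h] using isIntertwiner_perm g p j i

end IsIntertwiner

theorem permutationFunctions_generate (n : ℕ) :
    StarAlgebra.adjoin ℂ {a | ∃ i j, a = permutationFunctions n i j} = ⊤ := by
  rw [eq_top_iff]
  rintro f -
  -- The product over `i` is the indicator function of `g`.
  have hf : f = ∑ g, f g • ∏ i, permutationFunctions n i (g i) := by
    funext h
    rw [Finset.sum_apply, Finset.sum_eq_single h]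
    · simp [permutationFunctions]
    · intro g _ hg
      obtain ⟨i, hi⟩ : ∃ i, g i ≠ h i := by
        by_contra! h'
        exact hg (Equiv.ext h')
      rw [Pi.smul_apply, Finset.prod_apply, Finset.prod_eq_zero (Finset.mem_univ i), smul_zero]
      exact if_neg hi.symm
    · simp
  rw [hf]
  refine sum_mem fun g _ => SMulMemClass.smul_mem _ (prod_mem fun i _ => ?_)
  exact StarAlgebra.subset_adjoin _ _ ⟨i, g i, rfl⟩

/-! ### Presented algebras correspond to their categories -/

section presented

variable {n : ℕ} {r : FreeStarAlgebra n → FreeStarAlgebra n → Prop} {P : PartitionFamily}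

theorem starRingCon_le_relationCon (hP : IsFullCategory P)
    (h : ∀ a b, r a b → a - b ∈ relationSpan P n) : starRingCon r ≤ relationCon hP n := by
  rw [starRingCon, RingCon.ringConGen_le]
  rintro a b (hab | hab)
  · exact h a b hab
  · have := star_mem_relationSpan hP _ (h _ _ hab)
    rw [star_sub, star_star, star_star] at this
    exact this

/-- All relations of an algebra presented by relations that follow from a full category follow
from that category. -/
theorem mem_relationSpan_of_lift_presentedAlgebra_eq_zero (hP : IsFullCategory P)
    (h : ∀ a b, r a b → a - b ∈ relationSpan P n) {a : FreeStarAlgebra n}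
    (ha : lift (presentedAlgebra r).u a = 0) : a ∈ relationSpan P n := by
  rw [lift_presentedAlgebra] at ha
  have h0 : starRingCon r a 0 := (starRingCon r).eq.1 ha
  have := starRingCon_le_relationCon hP h h0
  rwa [relationCon_apply, sub_zero] at this

theorem exists_starAlgHom_of_isIntertwiner {A : Type*} [Ring A] [StarRing A] [Algebra ℂ A]
    [StarModule ℂ A] {M : Matrix (Fin n) (Fin n) A} (hs : ∀ i j, star (M i j) = M i j)
    (h : ∀ a b, r a b → a - b ∈ relationSpan P n)
    (hM : ∀ k l, ∀ p ∈ P k l, IsIntertwiner M (partitionMap n p)) :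
    ∃ φ : (presentedAlgebra r).carrier →⋆ₐ[ℂ] A,
      ∀ i j, φ ((presentedAlgebra r).u i j) = M i j := by
  obtain ⟨φ, hφ, -⟩ := exists_starAlgHom (r := r) hs fun a b hab => by
    rw [← sub_eq_zero, ← map_sub]
    exact lift_eq_zero_of_mem_relationSpan hM (h a b hab)
  exact ⟨φ, hφ⟩

theorem isQuantumSubgroup_oPlus {G : MatrixStarAlgebra.{u} n}
    (hG : StarAlgebra.adjoin ℂ {a | ∃ i j, a = G.u i j} = ⊤)
    (hs : ∀ i j, star (G.u i j) = G.u i j)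
    (hrow : ∀ i j, ∑ k, G.u i k * G.u j k = if i = j then 1 else 0)
    (hcol : ∀ i j, ∑ k, G.u k i * G.u k j = if i = j then 1 else 0) :
    MatrixStarAlgebra.IsQuantumSubgroup G (OPlus n) := by
  obtain ⟨φ, hφ, -⟩ := exists_starAlgHom (r := QuantumRelation.Orthogonal n) hs fun a b hab => by
    cases hab with
    | row i j =>
      rw [map_sum]
      simp only [map_mul, lift_x, hrow]
      split_ifs <;> simp
    | col i j =>
      rw [map_sum]
      simp only [map_mul, lift_x, hcol]
      split_ifs <;> simp
  exact ⟨φ, StarAlgHom.surjective_of_generates hG φ hφ, hφ⟩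

/-- The quantum group presented by relations that are equivalent to the intertwining relations of
the partitions of a full category. -/
theorem presentedAlgebra_correspondsTo (hP : IsFullCategory P)
    (h1 : ∀ a b, r a b → a - b ∈ relationSpan P n)
    (h2 : ∀ k l, ∀ p ∈ P k l, IsIntertwiner (presentedAlgebra r).u (partitionMap n p)) :
    (presentedAlgebra r).CorrespondsTo P := by
  have hs := presentedAlgebra_star (r := r)
  have hrow := isIntertwiner_pair_iff.1 (h2 _ _ _ hP.pair_mem)
  have hcol := isIntertwiner_involution_pair_iff.1 (h2 _ _ _ (hP.involution_mem _ hP.pair_mem))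
  refine ⟨⟨hs, hrow, hcol, presentedAlgebra_generates, ?_, ?_, ?_⟩, ?_,
    isQuantumSubgroup_oPlus presentedAlgebra_generates hs hrow hcol, fun k l => ?_⟩
  -- The presented algebra maps to any algebra containing a self-adjoint matrix for which all `T_p`
  -- are intertwiners. Comultiplication, counit, antipode and the map to functions on `S_n` all
  -- arise in this way.
  · refine exists_starAlgHom_of_isIntertwiner
      (M := Matrix.of fun i j => ∑ s, (presentedAlgebra r).u i s ⊗ₜ[ℂ] (presentedAlgebra r).u s j)
      ?_ h1 fun k l p hp => isIntertwiner_tmul (h2 k l p hp) (h2 k l p hp)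
    intro i j
    rw [Matrix.of_apply, star_sum]
    simp only [TensorProduct.star_tmul, hs]
  · obtain ⟨ε, hε⟩ := exists_starAlgHom_of_isIntertwiner (A := ℂ) (M := 1) (by
      intro i j
      rw [Matrix.one_apply]
      split_ifs <;> simp) h1 fun k l p _ => isIntertwiner_one _
    exact ⟨ε, fun i j => (hε i j).trans (Matrix.one_apply)⟩
  · refine exists_starAlgHom_of_isIntertwiner
      (M := Matrix.of fun i j => MulOpposite.op ((presentedAlgebra r).u j i))
      ?_ h1 fun k l p hp => isIntertwiner_op hs (h2 _ _ _ (hP.involution_mem _ hp))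
    intro i j
    rw [Matrix.of_apply, ← MulOpposite.op_star, hs]
  · obtain ⟨φ, hφ⟩ := exists_starAlgHom_of_isIntertwiner (M := permutationFunctions n) (by
      intro i j
      funext g
      change star (if g i = j then (1 : ℂ) else 0) = if g i = j then 1 else 0
      split_ifs <;> simp) h1 fun k l p _ => isIntertwiner_permutationFunctions p
    exact ⟨φ, StarAlgHom.surjective_of_generates (permutationFunctions_generate n) φ hφ, hφ⟩
  · ext T
    rw [MatrixStarAlgebra.mem_intertwiners_iff]
    change _ ↔ T ∈ partitionSpan P n k l
    constructor
    · intro hT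
      -- The relations of an intertwiner vanish in the presented algebra, so they lie in the ideal
      -- of the category and duality applies.
      refine mem_partitionSpan_of_defect_mem hP T fun j i =>
        mem_relationSpan_of_lift_presentedAlgebra_eq_zero hP h1 ?_
      rw [map_defect, map_lift_x]
      exact (isIntertwiner_iff_defect _ _).1 hT j i
    · intro hT
      induction hT using Submodule.span_induction with
      | zero => exact IsIntertwiner.zero
      | add S T _ _ hS hT => exact hS.add hT
      | smul c T _ hT => exact hT.smul c
      | mem T hT =>
        obtain ⟨p, hp, rfl⟩ := hT
        exact h2 _ _ p hp

end presented

/-! ### The defining relations as intertwining relations -/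

namespace FreeStarAlgebra

variable {n : ℕ} {A : Type*} [Ring A] [Algebra ℂ A] {M : Matrix (Fin n) (Fin n) A}
  {r r' : FreeStarAlgebra n → FreeStarAlgebra n → Prop}

/-- The entries of a matrix satisfy the given relations. -/
def RelationsHold (r : FreeStarAlgebra n → FreeStarAlgebra n → Prop)
    (M : Matrix (Fin n) (Fin n) A) : Prop :=
  ∀ a b, r a b → lift M a = lift M b

theorem relationsHold_sup : RelationsHold (r ⊔ r') M ↔ RelationsHold r M ∧ RelationsHold r' M :=
  ⟨fun h => ⟨fun a b hab => h a b (Or.inl hab), fun a b hab => h a b (Or.inr hab)⟩,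
    fun h a b hab => hab.elim (h.1 a b) (h.2 a b)⟩

theorem lift_map {B : Type*} [Ring B] [Algebra ℂ B] (φ : A →ₐ[ℂ] B) (a : FreeStarAlgebra n) :
    lift (M.map φ) a = φ (lift M a) := by
  induction a using FreeStarAlgebra.induction with
  | scalar c => rw [AlgHom.commutes, AlgHom.commutes, AlgHom.commutes]
  | gen i j => rw [lift_x, lift_x, Matrix.map_apply]
  | mul a b ha hb => rw [map_mul, map_mul, map_mul, ha, hb]
  | add a b ha hb => rw [map_add, map_add, map_add, ha, hb]

theorem RelationsHold.map {B : Type*} [Ring B] [Algebra ℂ B] (h : RelationsHold r M)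
    (φ : A →ₐ[ℂ] B) : RelationsHold r (M.map φ) := fun a b hab => by
  rw [lift_map, lift_map, h a b hab]

theorem relationsHold_orthogonal_iff : RelationsHold (QuantumRelation.Orthogonal n) M ↔
    IsIntertwiner M (partitionMap n pair) ∧ IsIntertwiner M (partitionMap n (involution pair)) := by
  rw [isIntertwiner_pair_iff, isIntertwiner_involution_pair_iff]
  constructor
  · intro h
    refine ⟨fun i j => ?_, fun i j => ?_⟩
    · have := h _ _ (.row i j)
      rw [map_sum, apply_ite (lift M), map_one, map_zero] at this
      simpa only [map_mul, lift_x] using this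
    · have := h _ _ (.col i j)
      rw [map_sum, apply_ite (lift M), map_one, map_zero] at this
      simpa only [map_mul, lift_x] using this
  · rintro ⟨hrow, hcol⟩ a b (⟨i, j⟩ | ⟨i, j⟩)
    · rw [map_sum, apply_ite (lift M), map_one, map_zero, ← hrow]
      simp only [map_mul, lift_x]
    · rw [map_sum, apply_ite (lift M), map_one, map_zero, ← hcol]
      simp only [map_mul, lift_x]

theorem partitionMap_reversal {k : ℕ} (j i : Fin k → Fin n) :
    partitionMap n (Setoid.ker (Sum.elim id Fin.rev) : TwoRowPartition k k) j i =
      if j = i ∘ Fin.rev then 1 else 0 := by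
  classical
  rw [partitionMap_apply]
  refine if_congr ⟨fun h => ?_, ?_⟩ rfl rfl
  · funext x
    exact (@h (Sum.inl x.rev) (Sum.inr x) rfl).symm
  · rintro rfl x y h
    rcases x with x | x <;> rcases y with y | y <;> rw [Setoid.ker_def] at h ⊢ <;>
      exact congrArg i h

/-- The half-liberating partition and the crossing are the cases `k = 3` and `k = 2`. -/
theorem isIntertwiner_reversal_iff {k : ℕ} :
    IsIntertwiner M (partitionMap n (Setoid.ker (Sum.elim id Fin.rev) : TwoRowPartition k k)) ↔
      ∀ i j : Fin k → Fin n, matrixTensorPower M k (i ∘ Fin.rev) (j ∘ Fin.rev) =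
        matrixTensorPower M k i j := by
  have hrev : ∀ i : Fin k → Fin n, (i ∘ Fin.rev) ∘ Fin.rev = i := fun i => by ext; simp
  have key : ∀ j i : Fin k → Fin n, (j = i ∘ Fin.rev) ↔ i = j ∘ Fin.rev := fun j i =>
    ⟨by rintro rfl; exact (hrev i).symm, by rintro rfl; exact (hrev j).symm⟩
  have h1 : ∀ j i, ∑ a, partitionMap n (Setoid.ker (Sum.elim id Fin.rev)) j a •
      matrixTensorPower M k a i = matrixTensorPower M k (j ∘ Fin.rev) i := by
    intro j i
    simp only [partitionMap_reversal, key j]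
    simp
  have h2 : ∀ j i, ∑ b, partitionMap n (Setoid.ker (Sum.elim id Fin.rev)) b i •
      matrixTensorPower M k j b = matrixTensorPower M k j (i ∘ Fin.rev) := by
    intro j i
    simp [partitionMap_reversal]
  constructor
  · intro h i j
    rw [← h1, h, h2, hrev]
  · intro h j i
    rw [h1, h2, ← h j, hrev]

theorem relationsHold_halfCommuting_iff : RelationsHold (QuantumRelation.HalfCommuting n) M ↔
    IsIntertwiner M (partitionMap n halfLiberating) := by
  rw [halfLiberating, isIntertwiner_reversal_iff]
  constructor
  · intro h i j
    have := h _ _ (.mk (i 2) (j 2) (i 1) (j 1) (i 0) (j 0))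
    simpa [lift_x, matrixTensorPower_apply, List.ofFn_succ, mul_assoc] using this
  · rintro h a b ⟨i, j, k, l, p, q⟩
    have := h ![p, k, i] ![q, l, j]
    simpa [lift_x, matrixTensorPower_apply, List.ofFn_succ, mul_assoc] using this

theorem relationsHold_commuting_iff : RelationsHold (QuantumRelation.Commuting n) M ↔
    IsIntertwiner M (partitionMap n crossing) := by
  rw [crossing, isIntertwiner_reversal_iff]
  constructor
  · intro h i j
    have := h _ _ (.mk (i 1) (j 1) (i 0) (j 0))
    simpa [lift_x, matrixTensorPower_apply, List.ofFn_succ] using this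
  · rintro h a b ⟨i, j, k, l⟩
    have := h ![k, i] ![l, j]
    simpa [lift_x, matrixTensorPower_apply, List.ofFn_succ] using this

theorem partitionMap_top (a b c d : Fin n) :
    partitionMap n (⊤ : TwoRowPartition 2 2) ![c, d] ![a, b] =
      if a = b ∧ b = c ∧ c = d then 1 else 0 := by
  classical
  rw [partitionMap_apply]
  refine if_congr ⟨fun h => ?_, ?_⟩ rfl rfl
  · exact ⟨@h (Sum.inl 0) (Sum.inl 1) trivial, @h (Sum.inl 1) (Sum.inr 0) trivial,
      @h (Sum.inr 0) (Sum.inr 1) trivial⟩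
  · rintro ⟨rfl, rfl, rfl⟩ x y -
    have e : ∀ x, Sum.elim ![a, a] ![a, a] x = a := by
      rintro (x | x) <;> fin_cases x <;> rfl
    rw [Setoid.ker_def, e, e]

theorem isIntertwiner_top_iff : IsIntertwiner M (partitionMap n (⊤ : TwoRowPartition 2 2)) ↔
    ∀ a b c d, (if c = d then M c a * M d b else 0) = if a = b then M c a * M d b else 0 := by
  have hcons : ∀ i : Fin 2 → Fin n, ∃ a b, i = ![a, b] :=
    fun i => ⟨i 0, i 1, by ext x; fin_cases x <;> rfl⟩
  have hsum : ∀ F : (Fin 2 → Fin n) → A, ∑ i, F i = ∑ a, ∑ b, F ![a, b] := by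
    intro F
    rw [sum_cons]
    refine Finset.sum_congr rfl fun a _ => ?_
    rw [sum_cons]
    refine Finset.sum_congr rfl fun b _ => ?_
    rw [Fintype.sum_unique]
    exact congrArg F (by ext x; fin_cases x <;> rfl)
  have htp : ∀ a b c d, matrixTensorPower M 2 ![a, b] ![c, d] = M a c * M b d := by
    intro a b c d
    simp [matrixTensorPower_apply, List.ofFn_succ]
  have key : ∀ a b c d : Fin n,
      (∑ i, partitionMap n (⊤ : TwoRowPartition 2 2) ![c, d] i • matrixTensorPower M 2 i ![a, b] =
        ∑ i, partitionMap n (⊤ : TwoRowPartition 2 2) i ![a, b] • matrixTensorPower M 2 ![c, d] i) ↔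
      (if c = d then M c a * M d b else 0) = if a = b then M c a * M d b else 0 := by
    intro a b c d
    rw [hsum, hsum]
    simp only [partitionMap_top, htp, ite_and, ite_smul, one_smul, zero_smul]
    by_cases h : c = d <;> by_cases h' : a = b <;> simp [h, h']
  constructor
  · intro h a b c d
    exact (key a b c d).1 (h _ _)
  · intro h j i
    obtain ⟨c, d, rfl⟩ := hcons j
    obtain ⟨a, b, rfl⟩ := hcons i
    exact (key a b c d).2 (h a b c d)

/-- With two points in each row the relation of the four block involves no sums, only two Kronecker
symbols. The cubic relations are the cases in which exactly one of them vanishes. -/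
theorem relationsHold_cubic_iff : RelationsHold (QuantumRelation.Cubic n) M ↔
    IsIntertwiner M (partitionMap n (⊤ : TwoRowPartition 2 2)) := by
  rw [isIntertwiner_top_iff]
  constructor
  · intro h a b c d
    by_cases hab : a = b <;> by_cases hcd : c = d
    · rw [if_pos hab, if_pos hcd]
    · rw [if_pos hab, if_neg hcd, hab]
      simpa [lift_x] using (h _ _ (.row c d b hcd)).symm
    · rw [if_neg hab, if_pos hcd, hcd]
      simpa [lift_x] using h _ _ (.col a b d hab)
    · rw [if_neg hab, if_neg hcd]
  · rintro h a b (⟨i, j, k, hij⟩ | ⟨i, j, k, hij⟩)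
    · simpa [lift_x, hij] using (h k k i j).symm
    · simpa [lift_x, hij] using h i j k k

/-- All entries of the map of two singletons are `1`, so the two sides of its relation are a column
sum and a row sum. -/
theorem relationsHold_equalSums_iff : RelationsHold (QuantumRelation.EqualSums n) M ↔
    IsIntertwiner M (partitionMap n (⊥ : TwoRowPartition 1 1)) := by
  classical
  have hT : ∀ j i, partitionMap n (⊥ : TwoRowPartition 1 1) j i = 1 := fun j i => by
    rw [partitionMap_apply, if_pos bot_le]
  have hsum : ∀ F : (Fin 1 → Fin n) → A, ∑ i, F i = ∑ a, F fun _ => a := fun F =>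
    ((Equiv.funUnique (Fin 1) (Fin n)).symm.sum_comp F).symm
  constructor
  · intro h j i
    have := h _ _ (.mk (j 0) (i 0))
    simp only [hT, one_smul, hsum, matrixTensorPower_one]
    simpa [lift_x] using this.symm
  · rintro h a b ⟨i, j⟩
    have := h (fun _ => i) (fun _ => j)
    simp only [hT, one_smul, hsum, matrixTensorPower_one] at this
    simpa [lift_x] using this.symm

theorem relationsHold_intertwining_iff {k l : ℕ} {p : TwoRowPartition k l} :
    RelationsHold (QuantumRelation.Intertwining n p) M ↔ IsIntertwiner M (partitionMap n p) := by
  have h1 : ∀ j i, lift M (((partitionMap n p).map (algebraMap ℂ (FreeStarAlgebra n)) *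
      matrixTensorPower (x n) k : Matrix _ _ (FreeStarAlgebra n)) j i) =
      ∑ a, partitionMap n p j a • matrixTensorPower M k a i := by
    intro j i
    simp only [map_algebraMap_mul_apply, map_sum, map_smul,
      map_matrixTensorPower (lift M), map_lift_x]
  have h2 : ∀ j i, lift M ((matrixTensorPower (x n) l *
      (partitionMap n p).map (algebraMap ℂ (FreeStarAlgebra n)) :
        Matrix _ _ (FreeStarAlgebra n)) j i) =
      ∑ b, partitionMap n p b i • matrixTensorPower M l j b := by
    intro j i
    simp only [mul_map_algebraMap_apply, map_sum, map_smul,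
      map_matrixTensorPower (lift M), map_lift_x]
  constructor
  · intro h j i
    rw [← h1, ← h2]
    exact h _ _ (.mk j i)
  · rintro h a b ⟨j, i⟩
    rw [h1, h2]
    exact h j i

theorem relationsHold_presentedAlgebra : RelationsHold r (presentedAlgebra r).u :=
  fun _ _ => lift_presentedAlgebra_eq

/-- The matrix of generators modulo the ideal is generic: what holds for it lies in the ideal.
Membership thus follows from the same characterisations of relations that serve for concrete
matrices. -/
theorem RelationsHold.sub_mem_relationSpan {P : PartitionFamily} {hP : IsFullCategory P}
    (h : RelationsHold r (relationMatrix hP n)) (a b : FreeStarAlgebra n) (hab : r a b) :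
    a - b ∈ relationSpan P n := by
  have hl : ∀ a, lift (relationMatrix hP n) a = (relationCon hP n).mkₐ (α := ℂ) a := fun a => by
    rw [relationMatrix, lift_map]
    congr 1
    have : lift (x n) = AlgHom.id ℂ _ := FreeAlgebra.hom_ext (funext fun y => lift_x _ y.1 y.2)
    rw [this, AlgHom.id_apply]
  have := h a b hab
  rwa [hl, hl, mkₐ_eq_iff] at this

end FreeStarAlgebra

namespace IsFullCategory

variable {C : PartitionFamily}

theorem top_mem_iff (hC : IsFullCategory C) :
    (⊤ : TwoRowPartition 2 2) ∈ C 2 2 ↔ fourBlock ∈ C 0 4 := by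
  rw [fourBlock_mem_iff]
  have h1 : HasWord C [0, 0] [0, 0] ↔ HasWord C [] [0, 0, 0, 0] := hC.hasWord_iff_nil _ _
  rw [← h1, HasWord]
  have : (⊤ : TwoRowPartition 2 2) = ofLabels (List.get [0, 0]) (List.get [0, 0]) := by
    have e : ∀ x, Sum.elim (List.get [0, 0]) (List.get [0, 0]) x = 0 := by
      rintro (x | x) <;> fin_cases x <;> rfl
    refine Setoid.ext fun x y => ⟨fun _ => ?_, fun _ => trivial⟩
    exact (e x).trans (e y).symm
  rw [this]
  rfl

theorem bot_mem_iff (hC : IsFullCategory C) :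
    (⊥ : TwoRowPartition 1 1) ∈ C 1 1 ↔ doubleSingleton ∈ C 0 2 := by
  rw [doubleSingleton_mem_iff]
  have h1 : HasWord C [0] [1] ↔ HasWord C [] [0, 1] := hC.hasWord_iff_nil _ _
  rw [← h1, HasWord]
  have : (⊥ : TwoRowPartition 1 1) = ofLabels (List.get [0]) (List.get [1]) := by
    refine Setoid.ext fun x y => ⟨?_, ?_⟩
    · rintro rfl
      rfl
    · intro h
      rcases x with x | x <;> rcases y with y | y <;> fin_cases x <;> fin_cases y
      · rfl
      · exact absurd h zero_ne_one
      · exact absurd h one_ne_zero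
      · rfl
  rw [this]
  rfl

end IsFullCategory

/-! ### Presentations of the four families -/

open MatrixStarAlgebra

section presentations

variable {n : ℕ} {r : FreeStarAlgebra n → FreeStarAlgebra n → Prop} {P : PartitionFamily}

/-- The relations are equivalent to the intertwining relations of the partitions of a family. -/
structure IsPresentation (r : FreeStarAlgebra n → FreeStarAlgebra n → Prop)
    (P : PartitionFamily) : Prop where
  sub_mem : ∀ a b, r a b → a - b ∈ relationSpan P n
  isIntertwiner : ∀ k l, ∀ p ∈ P k l, IsIntertwiner (presentedAlgebra r).u (partitionMap n p)

theorem isFullCategory_intertwiningPartitions_of_relationsHold (hn : 1 ≤ n) {A : Type*} [Ring A]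
    [StarRing A] [Algebra ℂ A] [StarModule ℂ A] {M : Matrix (Fin n) (Fin n) A}
    (hs : ∀ i j, star (M i j) = M i j) (h : RelationsHold (QuantumRelation.Orthogonal n) M) :
    IsFullCategory (intertwiningPartitions M) :=
  isFullCategory_intertwiningPartitions hn hs
    (isIntertwiner_pair_iff.1 (relationsHold_orthogonal_iff.1 h).1)
    (isIntertwiner_involution_pair_iff.1 (relationsHold_orthogonal_iff.1 h).2)

theorem relationsHold_cubic_iff_fourBlock (hn : 1 ≤ n) {A : Type*} [Ring A]
    [StarRing A] [Algebra ℂ A] [StarModule ℂ A] {M : Matrix (Fin n) (Fin n) A}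
    (hs : ∀ i j, star (M i j) = M i j) (h : RelationsHold (QuantumRelation.Orthogonal n) M) :
    RelationsHold (QuantumRelation.Cubic n) M ↔ IsIntertwiner M (partitionMap n fourBlock) :=
  relationsHold_cubic_iff.trans
    (isFullCategory_intertwiningPartitions_of_relationsHold hn hs h).top_mem_iff

/-- Relations that contain orthogonality present a category if they are equivalent to the
intertwining relations of generators of the category. -/
theorem isPresentation_generatedCategory (hn : 1 ≤ n)
    (ho : RelationsHold (QuantumRelation.Orthogonal n) (presentedAlgebra r).u)
    {S : Set (Σ k : ℕ, Σ l : ℕ, TwoRowPartition k l)}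
    (h1 : RelationsHold r (relationMatrix (isFullCategory_generatedCategory S) n))
    (h2 : ∀ g ∈ S, IsIntertwiner (presentedAlgebra r).u (partitionMap n g.2.2)) :
    IsPresentation r (generatedCategory S) :=
  ⟨h1.sub_mem_relationSpan, fun k l _ hp =>
    generatedCategory_subset (isFullCategory_intertwiningPartitions_of_relationsHold hn
      presentedAlgebra_star ho) h2 k l hp⟩

theorem relationsHold_orthogonal_relationMatrix (hP : IsFullCategory P) :
    RelationsHold (QuantumRelation.Orthogonal n) (relationMatrix hP n) :=
  relationsHold_orthogonal_iff.2 ⟨isIntertwiner_relationMatrix hP n hP.pair_mem,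
    isIntertwiner_relationMatrix hP n (hP.involution_mem _ hP.pair_mem)⟩

theorem relationsHold_halfCommuting_relationMatrix (hP : IsFullCategory P)
    (h : halfLiberating ∈ P 3 3) :
    RelationsHold (QuantumRelation.HalfCommuting n) (relationMatrix hP n) :=
  relationsHold_halfCommuting_iff.2 (isIntertwiner_relationMatrix hP n h)

theorem relationsHold_cubic_relationMatrix (hP : IsFullCategory P) (h : fourBlock ∈ P 0 4) :
    RelationsHold (QuantumRelation.Cubic n) (relationMatrix hP n) :=
  relationsHold_cubic_iff.2 (isIntertwiner_relationMatrix hP n (hP.top_mem_iff.2 h))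

theorem relationsHold_equalSums_relationMatrix (hP : IsFullCategory P)
    (h : doubleSingleton ∈ P 0 2) :
    RelationsHold (QuantumRelation.EqualSums n) (relationMatrix hP n) :=
  relationsHold_equalSums_iff.2 (isIntertwiner_relationMatrix hP n (hP.bot_mem_iff.2 h))

theorem relationsHold_intertwining_relationMatrix (hP : IsFullCategory P) {k l : ℕ}
    {p : TwoRowPartition k l} (h : p ∈ P k l) :
    RelationsHold (QuantumRelation.Intertwining n p) (relationMatrix hP n) :=
  relationsHold_intertwining_iff.2 (isIntertwiner_relationMatrix hP n h)

theorem isPresentation_oStar (hn : 1 ≤ n) :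
    IsPresentation (QuantumRelation.Orthogonal n ⊔ QuantumRelation.HalfCommuting n)
      (generatedCategory {⟨3, 3, halfLiberating⟩}) := by
  obtain ⟨ho, hh⟩ := relationsHold_sup.1 (relationsHold_presentedAlgebra
    (r := QuantumRelation.Orthogonal n ⊔ QuantumRelation.HalfCommuting n))
  refine isPresentation_generatedCategory hn ho (relationsHold_sup.2
    ⟨relationsHold_orthogonal_relationMatrix _,
      relationsHold_halfCommuting_relationMatrix _ (mem_generatedCategory (by simp))⟩) ?_
  rintro g rfl
  exact relationsHold_halfCommuting_iff.1 hh

theorem isPresentation_bSharpStar (hn : 1 ≤ n) :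
    IsPresentation (QuantumRelation.Orthogonal n ⊔ QuantumRelation.EqualSums n ⊔
      QuantumRelation.HalfCommuting n)
      (generatedCategory {⟨3, 3, halfLiberating⟩, ⟨0, 2, doubleSingleton⟩}) := by
  obtain ⟨h, hh⟩ := relationsHold_sup.1 (relationsHold_presentedAlgebra
    (r := QuantumRelation.Orthogonal n ⊔ QuantumRelation.EqualSums n ⊔
      QuantumRelation.HalfCommuting n))
  obtain ⟨ho, he⟩ := relationsHold_sup.1 h
  refine isPresentation_generatedCategory hn ho (relationsHold_sup.2 ⟨relationsHold_sup.2
    ⟨relationsHold_orthogonal_relationMatrix _,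
      relationsHold_equalSums_relationMatrix _ (mem_generatedCategory (by simp))⟩,
      relationsHold_halfCommuting_relationMatrix _ (mem_generatedCategory (by simp))⟩) ?_
  rintro g (rfl | rfl)
  · exact relationsHold_halfCommuting_iff.1 hh
  · exact (isFullCategory_intertwiningPartitions_of_relationsHold hn presentedAlgebra_star
      ho).bot_mem_iff.1 (relationsHold_equalSums_iff.1 he)

theorem isPresentation_hStar (hn : 1 ≤ n) :
    IsPresentation (QuantumRelation.Orthogonal n ⊔ QuantumRelation.Cubic n ⊔
      QuantumRelation.HalfCommuting n)
      (generatedCategory {⟨3, 3, halfLiberating⟩, ⟨0, 4, fourBlock⟩}) := by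
  obtain ⟨h, hh⟩ := relationsHold_sup.1 (relationsHold_presentedAlgebra
    (r := QuantumRelation.Orthogonal n ⊔ QuantumRelation.Cubic n ⊔
      QuantumRelation.HalfCommuting n))
  obtain ⟨ho, hc⟩ := relationsHold_sup.1 h
  refine isPresentation_generatedCategory hn ho (relationsHold_sup.2 ⟨relationsHold_sup.2
    ⟨relationsHold_orthogonal_relationMatrix _,
      relationsHold_cubic_relationMatrix _ (mem_generatedCategory (by simp))⟩,
      relationsHold_halfCommuting_relationMatrix _ (mem_generatedCategory (by simp))⟩) ?_
  rintro g (rfl | rfl)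
  · exact relationsHold_halfCommuting_iff.1 hh
  · exact (relationsHold_cubic_iff_fourBlock hn presentedAlgebra_star ho).1 hc

theorem isPresentation_hSeries (hn : 1 ≤ n) (s : ℕ) :
    IsPresentation (QuantumRelation.Orthogonal n ⊔ QuantumRelation.Cubic n ⊔
      QuantumRelation.HalfCommuting n ⊔ QuantumRelation.Intertwining n (hPartition s))
      (generatedCategory
        {⟨3, 3, halfLiberating⟩, ⟨0, 4, fourBlock⟩, ⟨0, 2 * s, hPartition s⟩}) := by
  obtain ⟨h, hs⟩ := relationsHold_sup.1 (relationsHold_presentedAlgebra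
    (r := QuantumRelation.Orthogonal n ⊔ QuantumRelation.Cubic n ⊔
      QuantumRelation.HalfCommuting n ⊔ QuantumRelation.Intertwining n (hPartition s)))
  obtain ⟨h, hh⟩ := relationsHold_sup.1 h
  obtain ⟨ho, hc⟩ := relationsHold_sup.1 h
  refine isPresentation_generatedCategory hn ho (relationsHold_sup.2 ⟨relationsHold_sup.2
    ⟨relationsHold_sup.2 ⟨relationsHold_orthogonal_relationMatrix _,
      relationsHold_cubic_relationMatrix _ (mem_generatedCategory (by simp))⟩,
      relationsHold_halfCommuting_relationMatrix _ (mem_generatedCategory (by simp))⟩,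
      relationsHold_intertwining_relationMatrix _ (mem_generatedCategory (by simp))⟩) ?_
  rintro g (rfl | rfl | rfl)
  · exact relationsHold_halfCommuting_iff.1 hh
  · exact (relationsHold_cubic_iff_fourBlock hn presentedAlgebra_star ho).1 hc
  · exact relationsHold_intertwining_iff.1 hs

theorem IsPresentation.correspondsTo (h : IsPresentation r P) (hP : IsFullCategory P) :
    (presentedAlgebra r).CorrespondsTo P :=
  presentedAlgebra_correspondsTo hP h.sub_mem h.isIntertwiner

/-- A quantum group whose intertwiner spaces are spanned by the partitions of a full category is
the one presented by the relations of the category. -/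
theorem IsPresentation.isSameQuantumGroup (h : IsPresentation r P) {G : MatrixStarAlgebra.{u} n}
    (hG : G.IsOrthogonalQuantumGroup)
    (h1 : ∀ k l, ∀ T, IsIntertwiner G.u T → T ∈ partitionSpan P n k l)
    (h2 : ∀ k l, ∀ p ∈ P k l, IsIntertwiner G.u (partitionMap n p)) :
    IsSameQuantumGroup G (presentedAlgebra r) := by
  obtain ⟨φ, hφ, hφ'⟩ := exists_starAlgHom (r := r) hG.selfAdjoint fun a b hab => by
    rw [← sub_eq_zero, ← map_sub]
    exact lift_eq_zero_of_mem_relationSpan h2 (h.sub_mem a b hab)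
  -- An element of the kernel is a relation between the coefficients of `G`. By duality it follows
  -- from the category, so it already vanishes in the presented algebra.
  have hinj : Function.Injective φ := by
    rw [injective_iff_map_eq_zero]
    intro a ha
    obtain ⟨a, rfl⟩ := lift_presentedAlgebra_surjective a
    rw [hφ'] at ha
    exact lift_eq_zero_of_mem_relationSpan h.isIntertwiner
      (mem_relationSpan_of_lift_eq_zero hG h1 ha)
  refine ⟨(StarAlgEquiv.ofBijective φ
    ⟨hinj, StarAlgHom.surjective_of_generates hG.generates φ hφ⟩).symm, fun i j => ?_⟩
  rw [StarAlgEquiv.symm_apply_eq]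
  exact (hφ i j).symm

/-- If the generators of a quantum group satisfy the relations of a quantum subgroup, the two
coincide. -/
theorem isSameQuantumGroup_of_relationsHold {G : MatrixStarAlgebra.{u} n}
    (hG : G.IsOrthogonalQuantumGroup) (h : IsQuantumSubgroup (presentedAlgebra r) G)
    (hr : RelationsHold r G.u) : IsSameQuantumGroup (presentedAlgebra r) G := by
  obtain ⟨χ, -, hχ⟩ := h
  obtain ⟨φ, hφ, hφ'⟩ := exists_starAlgHom hG.selfAdjoint hr
  -- The inclusion gives `χ`, and the relations give `φ` in the other direction; they are inverse on
  -- generators.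
  have hχφ : ∀ a, χ (φ a) = a := by
    intro a
    obtain ⟨a, rfl⟩ := lift_presentedAlgebra_surjective a
    have : G.u.map χ.toAlgHom = (presentedAlgebra r).u := by
      ext i j
      exact hχ i j
    rw [hφ', ← this, lift_map]
    rfl
  exact ⟨StarAlgEquiv.ofBijective φ ⟨Function.LeftInverse.injective hχφ,
    StarAlgHom.surjective_of_generates hG.generates φ hφ⟩, hφ⟩

theorem relationsHold_of_isQuantumSubgroup {G : MatrixStarAlgebra.{u} n}
    (h : IsQuantumSubgroup G (presentedAlgebra r)) : RelationsHold r G.u := by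
  obtain ⟨φ, -, hφ⟩ := h
  have : (presentedAlgebra r).u.map φ.toAlgHom = G.u := by
    ext i j
    exact hφ i j
  rw [← this]
  exact relationsHold_presentedAlgebra.map _

end presentations

/-! ### The corollary and the main theorem -/

/-- The family in the definition of easiness need not be a full category. Enlarging it to all
partitions whose maps are intertwiners does not change the spans. -/
theorem MatrixStarAlgebra.CorrespondsTo.mem_partitionSpan {n : ℕ} {G : MatrixStarAlgebra.{u} n}
    {P : PartitionFamily} (h : G.CorrespondsTo P) {k l : ℕ}
    {T : Matrix (Fin l → Fin n) (Fin k → Fin n) ℂ} (hT : IsIntertwiner G.u T) :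
    T ∈ partitionSpan (intertwiningPartitions G.u) n k l := by
  have h1 : T ∈ (Submodule.span ℂ (partitionMap n '' P k l) : Set _) := by
    rw [← h.intertwiners_eq]
    exact (mem_intertwiners_iff G T).2 hT
  refine Submodule.span_mono (Set.image_mono fun p hp => ?_) h1
  refine (mem_intertwiners_iff G _).1 ?_
  rw [h.intertwiners_eq]
  exact Submodule.subset_span ⟨p, hp, rfl⟩

theorem exists_isSameQuantumGroup_hSeries {n : ℕ} (hn : 1 ≤ n) {G : MatrixStarAlgebra.{u} n}
    (hG : G.IsEasy) (h1 : IsProperQuantumSubgroup (HGroup n) G)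
    (h2 : IsProperQuantumSubgroup G (HStar n)) :
    ∃ s : ℕ, 3 ≤ s ∧ IsSameQuantumGroup G (HSeries n s) := by
  obtain ⟨P, -, hP⟩ := hG
  have hO := hP.isOrthogonalQuantumGroup
  obtain ⟨h, hh⟩ := relationsHold_sup.1 (relationsHold_of_isQuantumSubgroup h2.1)
  obtain ⟨ho, hc⟩ := relationsHold_sup.1 h
  have hQ := isFullCategory_intertwiningPartitions_of_relationsHold hn hO.selfAdjoint ho
  have hfour : fourBlock ∈ intertwiningPartitions G.u 0 4 :=
    (relationsHold_cubic_iff_fourBlock hn hO.selfAdjoint ho).1 hc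
  -- The crossing would make the generators commute, so `G` would satisfy the relations of its
  -- subgroup `H_n` and coincide with it.
  have hcross : crossing ∉ intertwiningPartitions G.u 2 2 := fun hx =>
    h1.2 (isSameQuantumGroup_of_relationsHold hO h1.1
      (relationsHold_sup.2 ⟨h, relationsHold_commuting_iff.2 hx⟩))
  have key : ∀ {r : FreeStarAlgebra n → FreeStarAlgebra n → Prop} {C : PartitionFamily},
      IsPresentation r C → intertwiningPartitions G.u = C →
        IsSameQuantumGroup G (presentedAlgebra r) := by
    rintro r _ hr rfl
    exact hr.isSameQuantumGroup hO (fun k l T hT => hP.mem_partitionSpan hT) fun _ _ _ hp => hp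
  rcases hQ.classification (relationsHold_halfCommuting_iff.1 hh) hcross with
    h | h | h | ⟨s, hs, h⟩
  · exact absurd hfour h.1
  · exact absurd hfour h.1
  · exact absurd (key (isPresentation_hStar hn) h) h2.2
  · exact ⟨s, hs, key (isPresentation_hSeries hn s) h⟩

open TwoRowPartition MatrixStarAlgebra in
theorem mainTheorem4 :
    (∀ P : PartitionFamily, IsFullCategory P →
      halfLiberating ∈ P 3 3 → crossing ∉ P 2 2 →
        (P = generatedCategory {⟨3, 3, halfLiberating⟩} ∧
          ∀ n : ℕ, 1 ≤ n → (OStar n).CorrespondsTo P) ∨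
        (P = generatedCategory {⟨3, 3, halfLiberating⟩, ⟨0, 2, doubleSingleton⟩} ∧
          ∀ n : ℕ, 1 ≤ n → (BSharpStar n).CorrespondsTo P) ∨
        (P = generatedCategory {⟨3, 3, halfLiberating⟩, ⟨0, 4, fourBlock⟩} ∧
          ∀ n : ℕ, 1 ≤ n → (HStar n).CorrespondsTo P) ∨
        (∃ s : ℕ, 3 ≤ s ∧
          P = generatedCategory
            {⟨3, 3, halfLiberating⟩, ⟨0, 4, fourBlock⟩, ⟨0, 2 * s, hPartition s⟩} ∧
          ∀ n : ℕ, 1 ≤ n → (HSeries n s).CorrespondsTo P)) ∧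
    (∀ n : ℕ, 1 ≤ n → ∀ G : MatrixStarAlgebra.{u} n, G.IsEasy →
      IsProperQuantumSubgroup (HGroup n) G → IsProperQuantumSubgroup G (HStar n) →
        ∃ s : ℕ, 3 ≤ s ∧ IsSameQuantumGroup G (HSeries n s)) := by
  refine ⟨fun P hP hh hc => ?_, fun n hn G hG h1 h2 =>
    exists_isSameQuantumGroup_hSeries hn hG h1 h2⟩
  rcases hP.classification hh hc with ⟨-, h⟩ | ⟨-, h⟩ | h | ⟨s, hs, h⟩
  · exact .inl ⟨h, fun n hn => h ▸ (isPresentation_oStar hn).correspondsTo (h ▸ hP)⟩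
  · exact .inr (.inl ⟨h, fun n hn => h ▸ (isPresentation_bSharpStar hn).correspondsTo (h ▸ hP)⟩)
  · exact .inr (.inr (.inl ⟨h, fun n hn => h ▸ (isPresentation_hStar hn).correspondsTo (h ▸ hP)⟩))
  · exact .inr (.inr (.inr ⟨s, hs, h, fun n hn =>
      h ▸ (isPresentation_hSeries hn s).correspondsTo (h ▸ hP)⟩))
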